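/- Let $\Gamma$ and $\Lambda$ be finitely generated torsion-free nilpotent groups with finite generating sets $S$ and $T$, let $\Gamma\curvearrowright(X,m)$ be an ergodic probability measure preserving action, and let $\alpha:\Gamma\times X\to\Lambda$ be an integrable measurable cocycle: each $\alpha(\gamma,\cdot)$ is measurable, $\alpha(\gamma_1\gamma_2,x)=\alpha(\gamma_1,\gamma_2 x)\,\alpha(\gamma_2,x)$ for all $\gamma_1,\gamma_2\in\Gamma$ and a.e. $x$, and $\int_X|\alpha(\gamma,x)|_\Lambda\,dm(x)<\infty$ for all $\gamma\in\Gamma$, where $|\cdot|_\Lambda$ is the word norm of $T$. Let $H$ be the Mal'cev completion of $\Lambda$, i.e. the simply connected nilpotent Lie group in which $\Lambda$ is a cocompact lattice, let $\mathfrak h$ be its Lie algebra with lower central series $\mathfrak h^1=\mathfrak h$, $\mathfrak h^{i+1}=[\mathfrak h,\mathfrak h^i]$, and identify $H$ with $\mathfrak h$ by $\exp$. Choose a splitting $\mathfrak h=V_1\oplus\cdots\oplus V_r$ with $\mathfrak h^i=V_i\oplus\cdots\oplus V_r$. Let $\pi_{ab}:\mathfrak h\to V_1$ be the projection, let $\delta_t(v)=t^iv$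 for $v\in V_i$, and let $[v,w]_\infty$ be the $V_{i+j}$-component of $[v,w]$ for $v\in V_i$, $w\in V_j$, extended bilinearly; this is the bracket of the associated graded Lie algebra $\mathfrak h_\infty=\bigoplus_i\mathfrak h^i/\mathfrak h^{i+1}$ under the natural identification $V_i\cong\mathfrak h^i/\mathfrak h^{i+1}$. Let $\star$ be the Baker--Campbell--Hausdorff product of $[\cdot,\cdot]_\infty$, so that $H_\infty=(\mathfrak h,\star)$ is the Carnot group associated with $\Lambda$, and let $d_\infty$ be the sub-Finsler Carnot--Carath\'eodory metric on $H_\infty$ of an arbitrary norm on $V_1$ (for instance the one that arises as the asymptotic cone metric of the word metric on $\Lambda$). Put $$\overline{\alpha_{ab}}(\gamma)=\int_X\pi_{ab}(\alpha(\gamma,x))\,dm(x)\in V_1 .$$ Let $s_1,\dots,s_k\in S$ be fixed, let $a_{n,i}\in\mathbb N$ with $a_{n,i}\to\infty$ as $n\to\infty$ for each $1\le i\le k$, and let $\gamma_n=s_1^{a_{n,1}}\cdots s_k^{a_{n,k}}$. Then $$d_\infty\bigl(\alpha(\gamma_n,x),\ \delta_{a_{n,1}}\overline{\alpha_{ab}}(s_1)\star\cdots\star\delta_{a_{n,k}}\overline{\alpha_{ab}}(s_k)\bigr)=o\bigl(\max_i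 a_{n,i}\bigr)$$ in probability, i.e. for every $\varepsilon>0$ $$m\Bigl\{x:\ d_\infty\bigl(\alpha(\gamma_n,x),\ \delta_{a_{n,1}}\overline{\alpha_{ab}}(s_1)\star\cdots\star\delta_{a_{n,k}}\overline{\alpha_{ab}}(s_k)\bigr)\big/\max_i a_{n,i}<\varepsilon\Bigr\}\longrightarrow 1\qquad(n\to\infty).$$ -/

import Mathlib

open MeasureTheory Filter Topology

noncomputable section

/-! ### Word norms and integrable cocycles -/

/-- The word norm of `g` with respect to `T ∪ T⁻¹`. -/
def wordNorm {G : Type*} [Group G] (T : Set G) (g : G) : ℕ :=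
  sInf {n : ℕ | ∃ l : List G, l.length = n ∧ (∀ t ∈ l, t ∈ T ∨ t⁻¹ ∈ T) ∧ l.prod = g}

/-- `α` is a measurable cocycle over the action of `Γ` on `(X, μ)` with values in the discrete
countable group `Λ`, integrable with respect to the word norm of the generating set `T`. -/
structure IsIntegrableCocycle {Γ Λ X : Type*} [Group Γ] [Group Λ] [MulAction Γ X]
    [MeasurableSpace X] (T : Set Λ) (μ : Measure X) (α : Γ → X → Λ) : Prop where
  measurable : ∀ (g : Γ) (l : Λ), MeasurableSet (α g ⁻¹' {l})
  cocycle : ∀ g₁ g₂ : Γ, ∀ᵐ x ∂μ, α (g₁ * g₂) x = α g₁ (g₂ • x) * α g₂ x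
  integrable : ∀ g : Γ, Integrable (fun x => (wordNorm T (α g x) : ℝ)) μ

/-! ### The Baker–Campbell–Hausdorff product -/

section BCH

variable {E : Type*} [AddCommGroup E] [Module ℝ E]

/-- The right-nested bracket `[z₁, [z₂, … [z_{l-1}, z_l] … ]]` of a list of vectors with respect
to a bilinear bracket `B`. -/
def nestedBracket (B : E →ₗ[ℝ] E →ₗ[ℝ] E) : List E → E
  | [] => 0
  | [z] => z
  | z :: w :: l => B z (nestedBracket B (w :: l))

/-- Dynkin's form of the Baker–Campbell–Hausdorff series for `log (exp x exp y)`,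
`∑_{n ≥ 1} (-1)^(n-1)/n ∑_{rᵢ + sᵢ > 0} [x^{r₁} y^{s₁} ⋯ x^{rₙ} y^{sₙ}] / (∑ (rᵢ + sᵢ) ∏ rᵢ! sᵢ!)`,
for a Lie bracket `B` all of whose iterated brackets with more than `c` entries vanish:
the terms omitted here (`n > c`, or some `rᵢ > c`, or some `sᵢ > c`) are such brackets. -/
def bch (B : E →ₗ[ℝ] E →ₗ[ℝ] E) (c : ℕ) (x y : E) : E :=
  ∑ n ∈ Finset.Icc 1 c, ((-1 : ℝ) ^ (n - 1) / n) •
    ∑ p ∈ Fintype.piFinset fun _ : Fin n =>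
        (Finset.range (c + 1) ×ˢ Finset.range (c + 1)).filter fun q => 0 < q.1 + q.2,
      (((∑ i, ((p i).1 + (p i).2) : ℕ) : ℝ) *
          ((∏ i, (p i).1.factorial * (p i).2.factorial : ℕ) : ℝ))⁻¹ •
        nestedBracket B
          (List.ofFn fun i => List.replicate (p i).1 x ++ List.replicate (p i).2 y).flatten

end BCH

/-! ### Nilpotent Lie groups in logarithmic coordinates -/

section Lie

variable {𝔥 : Type*} [LieRing 𝔥] [LieAlgebra ℝ 𝔥]

/-- The product of the simply connected Lie group `H` of a nilpotent Lie algebra `𝔥`, transported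
to `𝔥` by the diffeomorphism `exp : 𝔥 → H`. -/
def lieMul (x y : 𝔥) : 𝔥 :=
  bch (LieModule.toEnd ℝ 𝔥 𝔥 : 𝔥 →ₗ[ℝ] 𝔥 →ₗ[ℝ] 𝔥) (LieModule.nilpotencyLength 𝔥 𝔥) x y

/-- `ι` (the logarithm of the inclusion `Λ < H`) exhibits the simply connected nilpotent Lie group
`H = (𝔥, lieMul)` as the Mal'cev completion of `Λ`: it is an injective homomorphism whose image is
a discrete cocompact subgroup. -/
structure IsMalcevCompletion {Λ : Type*} [Group Λ] [TopologicalSpace 𝔥] (ι : Λ → 𝔥) : Prop where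
  map_mul : ∀ a b : Λ, ι (a * b) = lieMul (ι a) (ι b)
  injective : Function.Injective ι
  discrete : DiscreteTopology (Set.range ι)
  cocompact : ∃ K : Set 𝔥, IsCompact K ∧ ∀ h : 𝔥, ∃ l : Λ, ∃ k ∈ K, h = lieMul (ι l) k

variable (𝔥) in
/-- A splitting `𝔥 = V₁ ⊕ ⋯ ⊕ V_r` with `𝔥^i = V_i ⊕ ⋯ ⊕ V_r` for the lower central series
`𝔥¹ = 𝔥`, `𝔥^{i+1} = [𝔥, 𝔥^i]` (so `𝔥^{i+1}` is `LieModule.lowerCentralSeries ℝ 𝔥 𝔥 i`).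
The conditions force `V 0 = ⊥`, and `V i = ⊥` for `i` above the nilpotency step. -/
structure LCSSplitting where
  V : ℕ → Submodule ℝ 𝔥
  isInternal : DirectSum.IsInternal V
  lcs_eq : ∀ i : ℕ,
    (LieModule.lowerCentralSeries ℝ 𝔥 𝔥 i).toSubmodule = ⨆ j : ℕ, ⨆ _ : i < j, V j

namespace LCSSplitting

variable (D : LCSSplitting 𝔥)

/-- The projection of `𝔥` onto `V i` along the other summands. -/
def proj (i : ℕ) : 𝔥 →ₗ[ℝ] 𝔥 :=
  (D.V i).subtype ∘ₗ DirectSum.component ℝ ℕ (fun j => D.V j) i ∘ₗ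
    (LinearEquiv.ofBijective (DirectSum.coeLinearMap D.V) D.isInternal).symm.toLinearMap

/-- The dilation `δ_t`, multiplication by `t ^ i` on `V i`. -/
def dilation (t : ℝ) : 𝔥 →ₗ[ℝ] 𝔥 :=
  ∑ i ∈ Finset.Icc 1 (LieModule.nilpotencyLength 𝔥 𝔥), t ^ i • D.proj i

/-- The bracket `[-,-]_∞` of the associated graded Lie algebra `⨁ 𝔥^i/𝔥^{i+1}`, transported to `𝔥`
by the identifications `V i ≃ 𝔥^i/𝔥^{i+1}`: for `v ∈ V i` and `w ∈ V j` it is the component of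
`[v, w]` in `V (i + j)`. -/
def gradedBracket : 𝔥 →ₗ[ℝ] 𝔥 →ₗ[ℝ] 𝔥 :=
  ∑ i ∈ Finset.Icc 1 (LieModule.nilpotencyLength 𝔥 𝔥),
    ∑ j ∈ Finset.Icc 1 (LieModule.nilpotencyLength 𝔥 𝔥),
      ((LieModule.toEnd ℝ 𝔥 𝔥 : 𝔥 →ₗ[ℝ] 𝔥 →ₗ[ℝ] 𝔥).compl₁₂ (D.proj i) (D.proj j)).compr₂
        (D.proj (i + j))

/-- The product `⋆` of the Carnot group `H_∞` in logarithmic coordinates. -/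
def star (x y : 𝔥) : 𝔥 :=
  bch D.gradedBracket (LieModule.nilpotencyLength 𝔥 𝔥) x y

/-- `c : [0,1] → H_∞` is an absolutely continuous horizontal curve whose left-invariant velocity
`c(t)⁻¹ c'(t)`, the derivative of `τ ↦ c(t)⁻¹ ⋆ c(t + τ)` at `τ = 0`, is `u t ∈ V₁` for almost
every `t`. Regularity of the vector-valued curves is tested against linear functionals, and the
inverse of `x` in logarithmic coordinates is `-x`. -/
structure IsHorizontal (c : ℝ → 𝔥) (u : ℝ → D.V 1) : Prop where
  absolutelyContinuous : ∀ φ : 𝔥 →ₗ[ℝ] ℝ,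
    AbsolutelyContinuousOnInterval (fun t => φ (c t)) 0 1
  velocity : ∀ φ : 𝔥 →ₗ[ℝ] ℝ, ∀ᵐ t ∂(volume.restrict (Set.Icc (0 : ℝ) 1)),
    HasDerivAt (fun τ : ℝ => φ (D.star (-(c t)) (c (t + τ)))) (φ (u t : 𝔥)) 0

/-- The sub-Finsler Carnot–Carathéodory distance on `H_∞` of the norm `N` on `V₁`: the infimum of
the lengths `∫ N(c⁻¹ c')` of the horizontal curves from `g` to `h` (`∞` if there are none). -/
def ccDist (N : Seminorm ℝ (D.V 1)) (g h : 𝔥) : ENNReal :=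
  ⨅ (c : ℝ → 𝔥) (u : ℝ → D.V 1) (_ : D.IsHorizontal c u ∧ c 0 = g ∧ c 1 = h),
    ∫⁻ t in Set.Icc (0 : ℝ) 1, ENNReal.ofReal (N (u t))

/-- The average `∫ π_ab(α(γ, x)) dμ(x) ∈ V₁` of the abelian coordinates of `α(γ, ·)`, where
`π_ab` is the projection to `V₁`; the integral is taken in the coordinates of a basis. -/
def abMean {Γ Λ X : Type*} [MeasurableSpace X] [FiniteDimensional ℝ 𝔥] (μ : Measure X)
    (ι : Λ → 𝔥) (α : Γ → X → Λ) (g : Γ) : 𝔥 :=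
  ∑ i, (∫ x, (Module.finBasis ℝ 𝔥).coord i (D.proj 1 (ι (α g x))) ∂μ) •
    Module.finBasis ℝ 𝔥 i

end LCSSplitting

end Lie

end

/-! Write `M` for `max a_i` and rescale by `δ_{1/M}`. In the rescaled coordinates the group law of
`H` is the Baker–Campbell–Hausdorff series of `scaledBracket (1/M)`, a bracket polynomial in `1/M`
whose value at `0` is the graded bracket. On bounded sets it is therefore `O(1/M)`-close to `⋆`
(`dilation_lieMul`, `exists_scaledBracket_le`, `exists_bch_sub_le`). On the Carnot side only upper
bounds for `d_∞` are needed: a group commutator of short horizontal products follows the graded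
bracket up to higher degree, and brackets with `V 1` span the higher layers, so an element with
small coordinates is a horizontal product of small total length. Bounded points that are close in
coordinates are then close in `d_∞`, and dilation multiplies the estimate by `t`
(`exists_ccDist_dilation_le`). It remains to show that `δ_{1/M} α(γ_n, x)` is close in coordinates,
in probability, to the `⋆`-product of the vectors `(a_i/M) · abMean (s_i)`.

For the powers of one element `s`, the convergence of `δ_{1/n} α(sⁿ, x)` to `abMean s` is proved by
induction on the degree of the component.

In degree one the coordinates of `α` are integrable real cocycles. The mean ergodic theorem in `L¹`
gives a limit of the averages along `sⁿ`, but `s` need not act ergodically. Nilpotency of `Γ`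
repairs this: descending through commutators in the upper central series shows that the limit is
fixed by all of `Γ` (`map_rate_eq`), hence constant, and integration identifies the constant
(`tendsto_integral_abs_cocycle_sub`).

In degree `i ≥ 2` the interval `[0, N]` is cut into `m` blocks. The nonlinear part of the series in
degree `i` depends only on components of lower degree, and vanishes on proportional vectors. By
induction all partial products and all blocks are nearly proportional to the same vector, so the
degree `i` component is nearly the sum of those of the blocks. Each block contributes at most a
constant times the `i`-th power of its rescaled word norm (`exists_proj_le_wordNorm`), about
`m^{-i}` apart from an integrable tail, and `m · m^{-i}` is small
(`tendsto_proj_of_uniformlySmall`). The blocks require the convergence at all times `t ≤ N` on scale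
`N`, which is the notion `UniformlySmall`.

Products of `k` powers follow by induction on `k`, using invariance of the measure and continuity of
the rescaled group law (`exists_tendsto_product`).

The group laws of `⋆` come from Dynkin's formula in an associative algebra (`exists_bch_eq_nilLog`),
transported through a faithful representation by nilpotent operators (`isFaithfulNilRep`). -/

noncomputable section

set_option linter.unusedSectionVars false

/-! ### Evaluating power series at nilpotent elements -/

section NilpotentEvaluation

open PowerSeries

variable {A : Type*} [Ring A] [Algebra ℝ A]

/-- The value `∑_{k < m} f_k a ^ k` of a power series at an element with `a ^ m = 0`. -/
def nilEval (m : ℕ) (a : A) (f : ℝ⟦X⟧) : A := Polynomial.aeval a (trunc m f)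

theorem aeval_eq_zero_of_X_pow_dvd {m : ℕ} {a : A} (ha : a ^ m = 0) {p : Polynomial ℝ}
    (h : Polynomial.X ^ m ∣ p) : Polynomial.aeval a p = 0 := by
  obtain ⟨r, rfl⟩ := h
  simp [ha]

theorem aeval_trunc_coe {m : ℕ} {a : A} (ha : a ^ m = 0) (p : Polynomial ℝ) :
    Polynomial.aeval a (trunc m (p : ℝ⟦X⟧)) = Polynomial.aeval a p := by
  rw [← sub_eq_zero, ← map_sub]
  refine aeval_eq_zero_of_X_pow_dvd ha (Polynomial.X_pow_dvd_iff.2 fun d hd => ?_)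
  simp [Polynomial.coeff_sub, coeff_trunc, hd]

theorem nilEval_coe {m : ℕ} {a : A} (ha : a ^ m = 0) (p : Polynomial ℝ) :
    nilEval m a (p : ℝ⟦X⟧) = Polynomial.aeval a p := aeval_trunc_coe ha p

theorem nilEval_eq_sum (m : ℕ) (a : A) (f : ℝ⟦X⟧) :
    nilEval m a f = ∑ k ∈ Finset.range m, coeff k f • a ^ k := by
  rw [nilEval, Polynomial.aeval_eq_sum_range' (n := m + 1)
    (Nat.lt_succ_of_le ((trunc m f).natDegree_le_iff_coeff_eq_zero.2 fun k hk => by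
      simp [coeff_trunc, hk.not_gt])), Finset.sum_range_succ]
  simp only [coeff_trunc, lt_irrefl, if_false, zero_smul, add_zero]
  exact Finset.sum_congr rfl fun k hk => by rw [if_pos (Finset.mem_range.1 hk)]

theorem nilEval_add (m : ℕ) (a : A) (f g : ℝ⟦X⟧) :
    nilEval m a (f + g) = nilEval m a f + nilEval m a g := by
  simp [nilEval]

theorem nilEval_mul {m : ℕ} {a : A} (ha : a ^ m = 0) (f g : ℝ⟦X⟧) :
    nilEval m a (f * g) = nilEval m a f * nilEval m a g := by
  rw [nilEval, nilEval, nilEval, ← trunc_trunc_mul_trunc, ← Polynomial.coe_mul,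
    aeval_trunc_coe ha, map_mul]

theorem nilEval_pow {m : ℕ} {a : A} (ha : a ^ m = 0) (f : ℝ⟦X⟧) (n : ℕ) :
    nilEval m a (f ^ n) = nilEval m a f ^ n := by
  induction n with
  | zero =>
    have := nilEval_coe ha (1 : Polynomial ℝ)
    simpa using this
  | succ n ih => rw [pow_succ, nilEval_mul ha, ih, pow_succ]

theorem nilEval_one {m : ℕ} {a : A} (ha : a ^ m = 0) : nilEval m a 1 = 1 := by
  simpa using nilEval_pow ha 1 0

theorem nilEval_X {m : ℕ} {a : A} (ha : a ^ m = 0) : nilEval m a X = a := by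
  simpa using nilEval_coe ha (Polynomial.X : Polynomial ℝ)

theorem nilEval_smul {m : ℕ} (a : A) (r : ℝ) (f : ℝ⟦X⟧) :
    nilEval m a (r • f) = r • nilEval m a f := by
  simp [nilEval_eq_sum, Finset.smul_sum, mul_smul]

theorem nilEval_sum (m : ℕ) (a : A) {κ : Type*} (s : Finset κ) (f : κ → ℝ⟦X⟧) :
    nilEval m a (∑ i ∈ s, f i) = ∑ i ∈ s, nilEval m a (f i) := by
  classical
  induction s using Finset.induction_on with
  | empty => simp [nilEval_eq_sum]
  | insert i s hi ih => rw [Finset.sum_insert hi, nilEval_add, ih, Finset.sum_insert hi]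

/-- Modulo `X ^ n` the outer series is a polynomial, and the remainder evaluates to a multiple of
`nilEval m a g ^ n = 0`. Identities between exponentials and logarithms of nilpotent elements thus
reduce to formal ones. -/
theorem nilEval_subst {m n : ℕ} {a : A} (ha : a ^ m = 0) {f g : ℝ⟦X⟧} (hg : HasSubst g)
    (hgn : nilEval m a g ^ n = 0) :
    nilEval m a (f.subst g) = nilEval n (nilEval m a g) f := by
  obtain ⟨r, hr⟩ : (X : ℝ⟦X⟧) ^ n ∣ f - (trunc n f : ℝ⟦X⟧) := by
    rw [X_pow_dvd_iff]
    intro d hd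
    simp [coeff_trunc, hd]
  have hf : f = (trunc n f : ℝ⟦X⟧) + X ^ n * r := by rw [← hr]; ring
  conv_lhs => rw [hf]
  rw [subst_add hg, subst_mul hg, subst_pow hg, subst_X hg, nilEval_add, nilEval_mul ha,
    nilEval_pow ha, hgn, zero_mul, add_zero, subst_coe hg]
  rw [Polynomial.aeval_eq_sum_range, nilEval_sum, nilEval, Polynomial.aeval_eq_sum_range]
  refine Finset.sum_congr rfl fun k _ => ?_
  rw [nilEval_smul, nilEval_pow ha]

theorem one_add_X_mul_deriv_log : (1 + X) * d⁄dX ℝ (log ℝ) = 1 := by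
  rw [deriv_log]
  ext n
  rcases n with _ | n
  · simp
  · rw [add_mul, one_mul, map_add, coeff_succ_X_mul]
    simp [pow_succ, coeff_one]

/-- Both sides have derivative `1`, because `log' = 1 / (1 + X)` turns into `1 / exp` after
substitution, and both have constant term `0`. -/
theorem log_subst_exp_sub_one : (log ℝ).subst (exp ℝ - 1) = X := by
  have h : HasSubst (exp ℝ - 1) := HasSubst.exp_sub_one
  refine derivative.ext ?_ ?_
  · rw [derivative_subst h, map_sub, derivative_exp]
    have := congrArg (fun f : ℝ⟦X⟧ => f.subst (exp ℝ - 1)) one_add_X_mul_deriv_log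
    have h1 : (1 : ℝ⟦X⟧).subst (exp ℝ - 1) = 1 := by
      rw [← coe_substAlgHom h, map_one]
    simp only [subst_mul h, subst_add h, subst_X h, h1] at this
    rw [add_sub_cancel] at this
    simp [mul_comm, this]
  · have := constantCoeff_logOf (f := exp ℝ) (by simp)
    rw [logOf_eq] at this
    simpa using this

theorem exp_subst_log : (exp ℝ).subst (log ℝ) = 1 + X := by
  have h : HasSubst (log ℝ) := HasSubst.log
  set g := (exp ℝ).subst (log ℝ) with hg
  set l := d⁄dX ℝ (log ℝ) with hl
  have hgd : d⁄dX ℝ g = g * l := by rw [hg, derivative_subst h, derivative_exp]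
  have hld : d⁄dX ℝ l = - (l * l) := by
    have h0 := one_add_X_mul_deriv_log
    rw [← hl] at h0
    have h1 := congrArg (d⁄dX ℝ) h0
    rw [Derivation.leibniz] at h1
    simp only [smul_eq_mul, map_add, derivative_X] at h1
    have : d⁄dX ℝ l = l * ((1 + X) * d⁄dX ℝ l) := by rw [← mul_assoc, mul_comm l, h0, one_mul]
    rw [this, show (1 + X) * d⁄dX ℝ l = - l by
      have h2 : (d⁄dX ℝ) (1 : ℝ⟦X⟧) = 0 := Derivation.map_one_eq_zero _
      simpa [eq_neg_iff_add_eq_zero, h2] using h1]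
    ring
  -- From `g' = g l` and `l' = -l²` the product `g l` has derivative zero. Its constant term is `1`,
  -- so `g` is the inverse of `l`, which is `1 + X`.
  have hgl : g * l = 1 := by
    refine derivative.ext ?_ ?_
    · rw [Derivation.leibniz, hgd, hld]
      simp only [smul_eq_mul, Derivation.map_one_eq_zero]
      ring
    · have h1 : constantCoeff g = 1 := by
        rw [hg]
        have : (exp ℝ).subst (log ℝ) = 1 + (exp ℝ - 1).subst (log ℝ) := by
          rw [← coe_substAlgHom h, map_sub, map_one]; ring
        rw [this, map_add]
        have h2 : constantCoeff ((exp ℝ - 1).subst (log ℝ)) = 0 := by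
          exact constantCoeff_subst_eq_zero constantCoeff_log _ (by simp)
        simp [h2]
      rw [map_mul, h1, hl]
      simp [deriv_log]
  calc g = (1 + X) * l * g := by rw [one_add_X_mul_deriv_log, one_mul]
    _ = (1 + X) * (g * l) := by ring
    _ = 1 + X := by rw [hgl, mul_one]

theorem nilEval_exp_sub_one {m : ℕ} {a : A} (ha : a ^ m = 0) :
    nilEval m a (exp ℝ - 1) = nilEval m a (exp ℝ) - 1 := by
  rw [eq_sub_iff_add_eq]
  calc _ = nilEval m a (exp ℝ - 1) + nilEval m a 1 := by rw [nilEval_one ha]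
    _ = _ := by rw [← nilEval_add, sub_add_cancel]

/-- The logarithm `∑_{n < m} (-1)^(n+1) z^n / n` of `1 + z` for an element with `z ^ m = 0`. -/
def nilLog (m : ℕ) (z : A) : A := nilEval m z (log ℝ)

theorem nilLog_eq_sum (m : ℕ) (z : A) :
    nilLog m z = ∑ n ∈ Finset.Ico 1 m, ((-1 : ℝ) ^ (n - 1) / n) • z ^ n := by
  rw [nilLog, nilEval_eq_sum]
  symm
  refine Finset.sum_subset_zero_on_sdiff (fun n hn => ?_) (fun n hn => ?_) (fun n hn => ?_)
  · simp only [Finset.mem_Ico, Finset.mem_range] at hn ⊢; omega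
  · have : n = 0 := by
      simp only [Finset.mem_sdiff, Finset.mem_Ico, Finset.mem_range] at hn; omega
    simp [this]
  · obtain ⟨k, rfl⟩ : ∃ k, n = k + 1 := ⟨n - 1, by simp only [Finset.mem_Ico] at hn; omega⟩
    rw [coeff_log]
    simp [pow_succ]

variable [Module ℚ A]

theorem exp_eq_nilEval {m : ℕ} {a : A} (ha : a ^ m = 0) :
    IsNilpotent.exp a = nilEval m a (exp ℝ) := by
  rw [IsNilpotent.exp_eq_sum ha, nilEval_eq_sum]
  refine Finset.sum_congr rfl fun k _ => ?_
  rw [coeff_exp, ← Rat.cast_smul_eq_qsmul ℝ]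
  simp

theorem nilLog_exp {m n : ℕ} {a : A} (ha : a ^ m = 0) (hn : (IsNilpotent.exp a - 1) ^ n = 0) :
    nilLog n (IsNilpotent.exp a - 1) = a := by
  rw [exp_eq_nilEval ha, ← nilEval_exp_sub_one ha] at hn ⊢
  rw [nilLog, ← nilEval_subst ha HasSubst.exp_sub_one hn, log_subst_exp_sub_one, nilEval_X ha]

theorem exp_nilLog {m n : ℕ} {z : A} (hz : z ^ m = 0) (hn : nilLog m z ^ n = 0) :
    IsNilpotent.exp (nilLog m z) = 1 + z := by
  rw [exp_eq_nilEval hn, nilLog, ← nilEval_subst hz HasSubst.log hn, exp_subst_log, nilEval_add,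
    nilEval_one hz, nilEval_X hz]

end NilpotentEvaluation

/-! ### The commutator bracket and the Dynkin series in an associative algebra -/

section Words

variable {E F : Type*}

/-- The exponents `(r, s)`, not both zero, of the blocks `x ^ r y ^ s` in the series. -/
def bchExponents (c : ℕ) : Finset (ℕ × ℕ) :=
  (Finset.range (c + 1) ×ˢ Finset.range (c + 1)).filter fun q => 0 < q.1 + q.2

/-- The word `x^{r₁} y^{s₁} ⋯ x^{rₙ} y^{sₙ}`. -/
def bchWord {n : ℕ} (p : Fin n → ℕ × ℕ) (x y : E) : List E :=
  (List.ofFn fun i => List.replicate (p i).1 x ++ List.replicate (p i).2 y).flatten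

theorem length_bchWord {n : ℕ} (p : Fin n → ℕ × ℕ) (x y : E) :
    (bchWord p x y).length = ∑ i, ((p i).1 + (p i).2) := by
  simp [bchWord, List.sum_ofFn, Function.comp_def]

theorem map_bchWord {n : ℕ} (p : Fin n → ℕ × ℕ) (x y : E) (f : E → F) :
    (bchWord p x y).map f = bchWord p (f x) (f y) := by
  simp [bchWord, List.map_flatten, List.map_ofFn, Function.comp_def]

theorem mem_bchWord {n : ℕ} {p : Fin n → ℕ × ℕ} {x y z : E} (h : z ∈ bchWord p x y) :
    z = x ∨ z = y := by
  simp only [bchWord, List.mem_flatten, List.mem_ofFn] at h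
  obtain ⟨l, ⟨i, rfl⟩, hz⟩ := h
  simp only [List.mem_append, List.mem_replicate] at hz
  tauto

theorem pos_of_mem_bchExponents {c : ℕ} {q : ℕ × ℕ} (h : q ∈ bchExponents c) : 0 < q.1 + q.2 :=
  (Finset.mem_filter.1 h).2

theorem le_length_bchWord {c n : ℕ} {p : Fin n → ℕ × ℕ}
    (hp : p ∈ Fintype.piFinset fun _ : Fin n => bchExponents c) (x y : E) :
    n ≤ (bchWord p x y).length := by
  rw [length_bchWord]
  calc n = ∑ _i : Fin n, 1 := by simp
    _ ≤ _ := Finset.sum_le_sum fun i _ =>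
      pos_of_mem_bchExponents (Fintype.mem_piFinset.1 hp i)

theorem sum_piFinset_fin_succ {ι' M : Type*} [AddCommMonoid M] (n : ℕ) (s : Finset ι')
    (f : (Fin (n + 1) → ι') → M) :
    ∑ p ∈ Fintype.piFinset fun _ : Fin (n + 1) => s, f p =
      ∑ a ∈ s, ∑ p ∈ Fintype.piFinset fun _ : Fin n => s, f (Fin.cons a p) := by
  rw [← Finset.sum_product']
  refine Finset.sum_bij' (fun p _ => (p 0, Fin.tail p)) (fun q _ => Fin.cons q.1 q.2) ?_ ?_ ?_ ?_ ?_
  · intro p hp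
    rw [Fintype.mem_piFinset] at hp
    simp only [Finset.mem_product, Fintype.mem_piFinset]
    exact ⟨hp 0, fun i => hp i.succ⟩
  · intro q hq
    simp only [Finset.mem_product, Fintype.mem_piFinset] at hq ⊢
    refine Fin.cases hq.1 fun i => ?_
    simpa using hq.2 i
  · intro p _; simp
  · intro q _; simp
  · intro p _; simp

theorem bchWord_cons {n : ℕ} (a : ℕ × ℕ) (p : Fin n → ℕ × ℕ) (x y : E) :
    bchWord (Fin.cons a p : Fin (n + 1) → ℕ × ℕ) x y =
      List.replicate a.1 x ++ (List.replicate a.2 y ++ bchWord p x y) := by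
  simp [bchWord, List.ofFn_succ]

end Words

/-! ### Nested brackets: functoriality and truncation of the series. -/

section Nested

variable {E F : Type*} [AddCommGroup E] [Module ℝ E] [AddCommGroup F] [Module ℝ F]

theorem nestedBracket_cons (B : E →ₗ[ℝ] E →ₗ[ℝ] E) (z : E) {l : List E} (hl : l ≠ []) :
    nestedBracket B (z :: l) = B z (nestedBracket B l) := by
  cases l with
  | nil => exact absurd rfl hl
  | cons w l => rfl

theorem nestedBracket_replicate_append (B : E →ₗ[ℝ] E →ₗ[ℝ] E) (z : E) (r : ℕ) {l : List E}
    (hl : l ≠ []) :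
    nestedBracket B (List.replicate r z ++ l) =
      ((B z : Module.End ℝ E) ^ r) (nestedBracket B l) := by
  induction r with
  | zero => simp
  | succ r ih =>
    rw [List.replicate_succ, List.cons_append, nestedBracket_cons B z (by simp [hl]), ih, pow_succ']
    rfl

theorem map_nestedBracket {B : E →ₗ[ℝ] E →ₗ[ℝ] E} {B' : F →ₗ[ℝ] F →ₗ[ℝ] F} (f : E →ₗ[ℝ] F)
    (hf : ∀ x y, f (B x y) = B' (f x) (f y)) (l : List E) :
    f (nestedBracket B l) = nestedBracket B' (l.map f) := by
  induction l with
  | nil => simp [nestedBracket]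
  | cons z l ih =>
    by_cases hl : l = []
    · subst hl; simp [nestedBracket]
    · rw [nestedBracket_cons B z hl, List.map_cons, nestedBracket_cons B' _ (by simpa using hl),
        hf, ih]

theorem bch_eq (B : E →ₗ[ℝ] E →ₗ[ℝ] E) (c : ℕ) (x y : E) :
    bch B c x y = ∑ n ∈ Finset.Icc 1 c, ((-1 : ℝ) ^ (n - 1) / n) •
      ∑ p ∈ Fintype.piFinset fun _ : Fin n => bchExponents c,
        (((∑ i, ((p i).1 + (p i).2) : ℕ) : ℝ) *
          ((∏ i, (p i).1.factorial * (p i).2.factorial : ℕ) : ℝ))⁻¹ •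
          nestedBracket B (bchWord p x y) := rfl

theorem map_bch {B : E →ₗ[ℝ] E →ₗ[ℝ] E} {B' : F →ₗ[ℝ] F →ₗ[ℝ] F} (f : E →ₗ[ℝ] F)
    (hf : ∀ x y, f (B x y) = B' (f x) (f y)) (c : ℕ) (x y : E) :
    f (bch B c x y) = bch B' c (f x) (f y) := by
  simp only [bch_eq, map_sum, map_smul, map_nestedBracket f hf, map_bchWord]

/-- Enlarging the truncation order does not change the series of a nilpotent bracket. -/
theorem bch_eq_bch_of_le (B : E →ₗ[ℝ] E →ₗ[ℝ] E) {c M : ℕ} (h : c ≤ M)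
    (hB : ∀ l : List E, c < l.length → nestedBracket B l = 0) (x y : E) :
    bch B c x y = bch B M x y := by
  rw [bch_eq, bch_eq]
  symm
  rw [← Finset.sum_subset (Finset.Icc_subset_Icc_right h)]
  · refine Finset.sum_congr rfl fun n _ => ?_
    congr 1
    symm
    refine Finset.sum_subset ?_ ?_
    · intro p hp
      rw [Fintype.mem_piFinset] at hp ⊢
      intro i
      have := hp i
      simp only [bchExponents, Finset.mem_filter, Finset.mem_product, Finset.mem_range] at this ⊢
      omega
    · intro p hp hp'
      rw [hB _ _, smul_zero]
      rw [length_bchWord]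
      rw [Fintype.mem_piFinset] at hp hp'
      push Not at hp'
      obtain ⟨i, hi⟩ := hp'
      have h1 := pos_of_mem_bchExponents (hp i)
      have h2 : c < (p i).1 + (p i).2 := by
        by_contra hcon
        refine hi ?_
        simp only [bchExponents, Finset.mem_filter, Finset.mem_product, Finset.mem_range]
        omega
      exact h2.trans_le
        (Finset.single_le_sum (f := fun i => (p i).1 + (p i).2) (fun _ _ => Nat.zero_le _)
          (Finset.mem_univ i))
  · intro n hn hn'
    simp only [Finset.mem_Icc] at hn hn'
    rw [Finset.sum_eq_zero, smul_zero]
    intro p hp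
    rw [hB _ _, smul_zero]
    have := le_length_bchWord hp x y
    omega

end Nested

/-! ### Commutators in an associative algebra and the exponential of `ad u`. -/

section Commutator

variable {A : Type*} [Ring A] [Algebra ℝ A]

variable (A) in
/-- The commutator bracket of an associative algebra. -/
def commBracket : A →ₗ[ℝ] A →ₗ[ℝ] A := LinearMap.mul ℝ A - (LinearMap.mul ℝ A).flip

@[simp]
theorem commBracket_apply (a b : A) : commBracket A a b = a * b - b * a := rfl

theorem commBracket_eq_mulLeft_sub (a : A) :
    commBracket A a = LinearMap.mulLeft ℝ a - LinearMap.mulRight ℝ a := rfl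

/-- A derivation fixing the letters is the Euler operator on their words. This is what cancels the
total degree in the denominators of the Dynkin series. -/
theorem derivation_nestedBracket {d : A →ₗ[ℝ] A} (hd : ∀ a b, d (a * b) = d a * b + a * d b)
    {l : List A} (hl : ∀ z ∈ l, d z = z) :
    d (nestedBracket (commBracket A) l) = (l.length : ℝ) • nestedBracket (commBracket A) l := by
  induction l with
  | nil => simp [nestedBracket]
  | cons z l ih =>
    by_cases h : l = []
    · subst h; simpa [nestedBracket] using hl z
    · rw [nestedBracket_cons _ z h]
      have h1 := ih fun w hw => hl w (List.mem_cons_of_mem _ hw)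
      have h2 := hl z List.mem_cons_self
      simp only [commBracket_apply, map_sub, hd, h1, h2, List.length_cons, Nat.cast_add,
        Nat.cast_one, mul_smul_comm, smul_mul_assoc, add_smul, one_smul, smul_sub]
      abel

theorem commute_mulLeft_mulRight (u v : A) :
    Commute (LinearMap.mulLeft ℝ u : Module.End ℝ A) (LinearMap.mulRight ℝ v) :=
  LinearMap.ext fun a => (mul_assoc u a v).symm

theorem isNilpotent_mulLeft {u : A} (hu : IsNilpotent u) :
    IsNilpotent (LinearMap.mulLeft ℝ u) := by
  obtain ⟨n, hn⟩ := hu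
  exact ⟨n, by rw [LinearMap.pow_mulLeft, hn, LinearMap.mulLeft_zero_eq_zero]⟩

theorem isNilpotent_mulRight {u : A} (hu : IsNilpotent u) :
    IsNilpotent (LinearMap.mulRight ℝ u) := by
  obtain ⟨n, hn⟩ := hu
  exact ⟨n, by rw [LinearMap.pow_mulRight, hn, LinearMap.mulRight_zero_eq_zero]⟩

theorem isNilpotent_commBracket {u : A} (hu : IsNilpotent u) :
    IsNilpotent (commBracket A u : Module.End ℝ A) := by
  rw [commBracket_eq_mulLeft_sub]
  exact (commute_mulLeft_mulRight u u).isNilpotent_sub (isNilpotent_mulLeft hu)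
    (isNilpotent_mulRight hu)

variable [Module ℚ A]

theorem exp_mulLeft {u : A} (hu : IsNilpotent u) :
    IsNilpotent.exp (LinearMap.mulLeft ℝ u) = LinearMap.mulLeft ℝ (IsNilpotent.exp u) :=
  (hu.map_exp (Algebra.lmul ℝ A)).symm

theorem exp_mulRight {u : A} (hu : IsNilpotent u) :
    IsNilpotent.exp (LinearMap.mulRight ℝ u) = LinearMap.mulRight ℝ (IsNilpotent.exp u) := by
  obtain ⟨n, hn⟩ := hu
  rw [IsNilpotent.exp_eq_sum (k := n) (by
    rw [LinearMap.pow_mulRight, hn, LinearMap.mulRight_zero_eq_zero]), IsNilpotent.exp_eq_sum hn]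
  ext a
  simp [LinearMap.pow_mulRight, Finset.mul_sum, LinearMap.sum_apply,
    ← Rat.cast_smul_eq_qsmul ℝ]

/-- `exp (ad u)` is conjugation by `exp u`. -/
theorem exp_commBracket_apply {u : A} (hu : IsNilpotent u) (a : A) :
    IsNilpotent.exp (commBracket A u : Module.End ℝ A) a =
      IsNilpotent.exp u * a * IsNilpotent.exp (-u) := by
  have h : (commBracket A u : Module.End ℝ A) =
      LinearMap.mulLeft ℝ u + LinearMap.mulRight ℝ (-u) := by
    ext b; simp [sub_eq_add_neg]
  rw [h, IsNilpotent.exp_add_of_commute (commute_mulLeft_mulRight u (-u))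
    (isNilpotent_mulLeft hu) (isNilpotent_mulRight hu.neg), exp_mulLeft hu, exp_mulRight hu.neg]
  simp [mul_assoc]

end Commutator

/-! ### Dynkin's formula for `log (exp x exp y)` -/

section Dynkin

open IsNilpotent (exp exp_eq_sum exp_mul_exp_neg_self exp_neg_mul_exp_self)

variable {A : Type*} [Ring A] [Algebra ℝ A]

theorem derivation_pow {d : A →ₗ[ℝ] A} (hd : ∀ a b, d (a * b) = d a * b + a * d b) {x : A}
    (hdx : d x = x) (k : ℕ) : d (x ^ k) = (k : ℝ) • x ^ k := by
  induction k with
  | zero =>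
    have := hd 1 1
    simp only [mul_one, one_mul] at this
    simpa using this
  | succ k ih =>
    rw [pow_succ, hd, ih, hdx, smul_mul_assoc]
    push_cast
    rw [add_smul, one_smul]

/-- A multiplicatively closed nilpotent space of elements of an associative algebra. -/
structure IsNilpotentSpace (S : Submodule ℝ A) (m : ℕ) : Prop where
  mul_le : S * S ≤ S
  pow_eq : S ^ m = ⊥

namespace IsNilpotentSpace

variable {S : Submodule ℝ A} {m : ℕ}

theorem pow_eq_zero (h : IsNilpotentSpace S m) {z : A} (hz : z ∈ S) : z ^ m = 0 := by
  have := Submodule.pow_mem_pow S hz m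
  rwa [h.pow_eq, Submodule.mem_bot] at this

theorem pow_succ_mem (h : IsNilpotentSpace S m) {z : A} (hz : z ∈ S) (k : ℕ) :
    z ^ (k + 1) ∈ S := by
  induction k with
  | zero => simpa using hz
  | succ k ih => rw [pow_succ]; exact h.mul_le (Submodule.mul_mem_mul ih hz)

theorem isNilpotent (h : IsNilpotentSpace S m) {z : A} (hz : z ∈ S) : IsNilpotent z :=
  ⟨m, h.pow_eq_zero hz⟩

open Polynomial in
/-- Polynomials with coefficients in a given space. -/
def polySpace (S : Submodule ℝ A) : Submodule ℝ A[X] where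
  carrier := {p | ∀ n, p.coeff n ∈ S}
  add_mem' hp hq n := by rw [coeff_add]; exact S.add_mem (hp n) (hq n)
  zero_mem' n := by simp
  smul_mem' r p hp n := by rw [coeff_smul]; exact S.smul_mem r (hp n)

theorem polySpace_mul_le (S S' : Submodule ℝ A) :
    polySpace S * polySpace S' ≤ polySpace (S * S') := by
  rw [Submodule.mul_le]
  intro p hp q hq n
  rw [Polynomial.coeff_mul]
  exact Submodule.sum_mem _ fun i _ => Submodule.mul_mem_mul (hp _) (hq _)

theorem polySpace_mono {S S' : Submodule ℝ A} (h : S ≤ S') : polySpace S ≤ polySpace S' :=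
  fun _ hp n => h (hp n)

theorem polySpace_pow_le (S : Submodule ℝ A) (k : ℕ) :
    polySpace S ^ (k + 1) ≤ polySpace (S ^ (k + 1)) := by
  induction k with
  | zero => simp
  | succ k ih =>
    rw [pow_succ, pow_succ S]
    exact (mul_le_mul' ih le_rfl).trans (polySpace_mul_le _ _)

theorem nilLog_mem (h : IsNilpotentSpace S m) {z : A} (hz : z ∈ S) : nilLog m z ∈ S := by
  rw [nilLog_eq_sum]
  refine Submodule.sum_mem _ fun n hn => S.smul_mem _ ?_
  obtain ⟨k, rfl⟩ : ∃ k, n = k + 1 := ⟨n - 1, by simp at hn; omega⟩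
  exact h.pow_succ_mem hz k

theorem polynomial (h : IsNilpotentSpace S (m + 1)) : IsNilpotentSpace (polySpace S) (m + 1) where
  mul_le := (polySpace_mul_le S S).trans (polySpace_mono h.mul_le)
  pow_eq := by
    rw [eq_bot_iff]
    refine (polySpace_pow_le S m).trans fun p hp => ?_
    rw [Submodule.mem_bot]
    ext n
    have := hp n
    rw [h.pow_eq, Submodule.mem_bot] at this
    simpa using this

end IsNilpotentSpace

variable [Module ℚ A]

/-- The omitted exponent pair `(0, 0)` accounts for the `1`. With `f = ad x` and `g = ad y` this
sums all possible values of one block of a Dynkin word. -/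
theorem exp_sub_one_eq_sum {E : Type*} [AddCommGroup E] [Module ℝ E] [Module ℚ E] {c : ℕ}
    {f g : Module.End ℝ E} (hf : f ^ (c + 1) = 0) (hg : g ^ (c + 1) = 0) :
    exp f * exp g - 1 = ∑ q ∈ bchExponents c,
      ((q.1.factorial * q.2.factorial : ℕ) : ℝ)⁻¹ • (f ^ q.1 * g ^ q.2) := by
  rw [exp_eq_sum hf, exp_eq_sum hg, Finset.sum_mul_sum, ← Finset.sum_product', bchExponents,
    ← Finset.add_sum_erase _ _ (show (0, 0) ∈
      Finset.range (c + 1) ×ˢ Finset.range (c + 1) by simp)]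
  simp only [Nat.factorial_zero, Nat.cast_one, inv_one, pow_zero, one_smul, mul_one,
    add_sub_cancel_left]
  refine Finset.sum_congr ?_ fun q _ => ?_
  · ext ⟨r, s⟩
    simp only [Finset.mem_erase, Finset.mem_filter, ne_eq, Prod.mk.injEq]
    constructor
    · rintro ⟨h1, h2⟩; exact ⟨h2, by omega⟩
    · rintro ⟨h1, h2⟩; exact ⟨by omega, h1⟩
  · rw [← Rat.cast_smul_eq_qsmul ℝ, ← Rat.cast_smul_eq_qsmul ℝ, smul_mul_smul_comm]
    congr 1
    push_cast
    rw [mul_inv]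

/-- A right-nested bracket ending in two equal letters is zero, so only the exponents `(1, 0)` and
`(r, 1)` survive; they give `x` and the terms of `exp (ad x) y`. -/
theorem sum_nestedBracket_single {x y : A} {c : ℕ} (hc : 1 ≤ c)
    (hx : (commBracket A x : Module.End ℝ A) ^ (c + 1) = 0) :
    ∑ q ∈ bchExponents c, ((q.1.factorial * q.2.factorial : ℕ) : ℝ)⁻¹ •
        nestedBracket (commBracket A) (List.replicate q.1 x ++ List.replicate q.2 y) =
      x + exp (commBracket A x : Module.End ℝ A) y := by
  have hrep : ∀ (z : A) (r : ℕ), nestedBracket (commBracket A) (List.replicate (r + 2) z) = 0 := by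
    intro z r
    have := nestedBracket_replicate_append (commBracket A) z (r + 1) (l := [z]) (by simp)
    rw [show List.replicate (r + 1) z ++ [z] = List.replicate (r + 2) z from
      (List.replicate_succ' ..).symm] at this
    rw [this, pow_succ]
    simp [nestedBracket]
  have hsplit : bchExponents c = {(1, 0)} ∪ (Finset.range (c + 1) ×ˢ {1}) ∪
      (bchExponents c).filter fun q => (q.2 = 0 ∧ q.1 ≠ 1) ∨ 2 ≤ q.2 := by
    ext ⟨r, s⟩
    simp only [bchExponents, Finset.mem_filter, Finset.mem_product, Finset.mem_range,
      Finset.mem_union, Finset.mem_singleton, Prod.mk.injEq]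
    omega
  rw [hsplit, Finset.sum_union, Finset.sum_union]
  · rw [Finset.sum_singleton, Finset.sum_product]
    have h0 : ∑ q ∈ (bchExponents c).filter fun q => (q.2 = 0 ∧ q.1 ≠ 1) ∨ 2 ≤ q.2,
        ((q.1.factorial * q.2.factorial : ℕ) : ℝ)⁻¹ •
          nestedBracket (commBracket A) (List.replicate q.1 x ++ List.replicate q.2 y) = 0 := by
      refine Finset.sum_eq_zero fun q hq => ?_
      obtain ⟨hq1, hq2⟩ := Finset.mem_filter.1 hq
      have hpos := pos_of_mem_bchExponents hq1
      rcases hq2 with ⟨h1, h2⟩ | h2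
      · obtain ⟨r, hr⟩ : ∃ r, q.1 = r + 2 := ⟨q.1 - 2, by omega⟩
        rw [h1, hr, List.replicate_zero, List.append_nil, hrep, smul_zero]
      · obtain ⟨r, hr⟩ : ∃ r, q.2 = r + 2 := ⟨q.2 - 2, by omega⟩
        rw [nestedBracket_replicate_append _ _ _ (by simp [hr]), hr, hrep, map_zero, smul_zero]
    rw [h0, add_zero, exp_eq_sum hx]
    congr 1
    · simp [nestedBracket]
    · rw [LinearMap.sum_apply]
      refine Finset.sum_congr rfl fun r _ => ?_
      rw [Finset.sum_singleton, nestedBracket_replicate_append _ _ _ (by simp),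
        ← Rat.cast_smul_eq_qsmul ℝ]
      simp [nestedBracket]
  · rw [Finset.disjoint_left]
    rintro ⟨r, s⟩ h1 h2
    simp at h1 h2
    omega
  · rw [Finset.disjoint_left]
    rintro ⟨r, s⟩ h1 h2
    simp at h1 h2
    omega

/-- The last block gives `x + exp (ad x) y`. Each block put in front applies powers of `ad x` and
`ad y`, and summing over its exponents applies `exp (ad x) exp (ad y) - 1`. -/
theorem sum_nestedBracket_bchWord {x y : A} {c : ℕ} (hc : 1 ≤ c)
    (hx : (commBracket A x : Module.End ℝ A) ^ (c + 1) = 0)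
    (hy : (commBracket A y : Module.End ℝ A) ^ (c + 1) = 0) (n : ℕ) :
    ∑ p ∈ Fintype.piFinset fun _ : Fin (n + 1) => bchExponents c,
        ((∏ i, (p i).1.factorial * (p i).2.factorial : ℕ) : ℝ)⁻¹ •
          nestedBracket (commBracket A) (bchWord p x y) =
      ((exp (commBracket A x : Module.End ℝ A) * exp (commBracket A y : Module.End ℝ A) - 1) ^ n)
        (x + exp (commBracket A x : Module.End ℝ A) y) := by
  induction n with
  | zero =>
    rw [sum_piFinset_fin_succ]
    simp only [Fintype.piFinset_of_isEmpty, Finset.univ_unique, Finset.sum_singleton, pow_zero,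
      Module.End.one_apply, bchWord_cons]
    simp only [bchWord, List.ofFn_zero, List.flatten_nil, List.append_nil]
    have := sum_nestedBracket_single (y := y) hc hx
    simpa using this
  | succ n ih =>
    rw [sum_piFinset_fin_succ, pow_succ', Module.End.mul_apply, ← ih, exp_sub_one_eq_sum hx hy,
      LinearMap.sum_apply]
    refine Finset.sum_congr rfl fun a _ => ?_
    rw [map_sum]
    simp only [LinearMap.smul_apply, map_smul]
    refine Finset.sum_congr rfl fun p hp => ?_
    have hne : bchWord p x y ≠ [] := by
      have := le_length_bchWord hp x y
      intro h; simp [h] at this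
    rw [bchWord_cons, nestedBracket_replicate_append _ _ _ (by simp [hne]),
      nestedBracket_replicate_append _ _ _ hne, Fin.prod_univ_succ, smul_smul, Module.End.mul_apply]
    simp only [Fin.cons_zero, Fin.cons_succ]
    congr 1
    push_cast
    rw [mul_inv, mul_comm]

/-- The derivation multiplying `x` and `y` by `1` takes the Dynkin series to a series of
powers of `Ad (exp x exp y) - 1`. -/
theorem derivation_bch {d : A →ₗ[ℝ] A} (hd : ∀ a b, d (a * b) = d a * b + a * d b) {x y : A}
    (hdx : d x = x) (hdy : d y = y) {c : ℕ} (hc : 1 ≤ c)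
    (hx : (commBracket A x : Module.End ℝ A) ^ (c + 1) = 0)
    (hy : (commBracket A y : Module.End ℝ A) ^ (c + 1) = 0) :
    d (bch (commBracket A) c x y) = ∑ n ∈ Finset.Icc 1 c, ((-1 : ℝ) ^ (n - 1) / n) •
      ((exp (commBracket A x : Module.End ℝ A) * exp (commBracket A y : Module.End ℝ A) - 1) ^
        (n - 1)) (x + exp (commBracket A x : Module.End ℝ A) y) := by
  rw [bch_eq, map_sum]
  refine Finset.sum_congr rfl fun n hn => ?_
  obtain ⟨m, rfl⟩ : ∃ m, n = m + 1 := ⟨n - 1, by simp at hn; omega⟩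
  rw [map_smul, Nat.add_sub_cancel, ← sum_nestedBracket_bchWord hc hx hy, map_sum]
  congr 1
  refine Finset.sum_congr rfl fun p hp => ?_
  rw [map_smul, derivation_nestedBracket hd, length_bchWord, smul_smul]
  · congr 1
    have h1 := le_length_bchWord hp x y
    rw [length_bchWord] at h1
    have h2 : ((∑ i, ((p i).1 + (p i).2) : ℕ) : ℝ) ≠ 0 := by
      exact_mod_cast (by omega : (∑ i, ((p i).1 + (p i).2)) ≠ 0)
    rw [mul_inv, mul_comm, ← mul_assoc, mul_inv_cancel₀ h2, one_mul]
  · intro z hz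
    rcases mem_bchWord hz with rfl | rfl <;> assumption

theorem derivation_exp {d : A →ₗ[ℝ] A} (hd : ∀ a b, d (a * b) = d a * b + a * d b) {x : A}
    (hx : IsNilpotent x) (hdx : d x = x) : d (exp x) = x * exp x := by
  obtain ⟨m, hm⟩ := hx
  have hm' : x ^ (m + 1) = 0 := by rw [pow_succ, hm, zero_mul]
  conv_rhs => rw [exp_eq_sum hm]
  rw [exp_eq_sum hm', map_sum, Finset.sum_range_succ', Finset.mul_sum]
  simp only [← Rat.cast_smul_eq_qsmul ℝ, map_smul, derivation_pow hd hdx]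
  simp only [Nat.cast_zero, zero_smul, smul_zero, add_zero, mul_smul_comm, ← pow_succ', smul_smul]
  refine Finset.sum_congr rfl fun k _ => ?_
  congr 1
  rw [Nat.factorial_succ]
  push_cast
  have : (k : ℝ) + 1 ≠ 0 := by positivity
  field_simp

/-- The derivative of the logarithm. -/
theorem derivation_log {d : A →ₗ[ℝ] A} (hd : ∀ a b, d (a * b) = d a * b + a * d b) {x y L : A}
    (hx : IsNilpotent x) (hy : IsNilpotent y) (hL : IsNilpotent L)
    (hdx : d x = x) (hdy : d y = y) (hexp : exp L = exp x * exp y) :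
    ∃ M₀ : ℕ, ∀ M, M₀ ≤ M → d L = ∑ n ∈ Finset.Icc 1 M, ((-1 : ℝ) ^ (n - 1) / n) •
      ((exp (commBracket A x : Module.End ℝ A) * exp (commBracket A y : Module.End ℝ A) - 1) ^
        (n - 1)) (x + exp (commBracket A x : Module.End ℝ A) y) := by
  set W := x + exp (commBracket A x : Module.End ℝ A) y with hW
  set P := exp (commBracket A x : Module.End ℝ A) * exp (commBracket A y : Module.End ℝ A) - 1
    with hP
  have hl := isNilpotent_mulLeft hL
  -- The derivative of the logarithm is read off from `𝒩 = log (exp 𝒩)` applied to the operator `d`: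
  -- `𝒩 d`, the commutator of `mulLeft L` with `d`, takes `1` to `-d L`, whereas `exp 𝒩` is
  -- conjugation by `mulLeft (exp L)`, whose action on `d` and on left multiplications is explicit.
  set 𝒩 : Module.End ℝ (Module.End ℝ A) := commBracket (Module.End ℝ A) (LinearMap.mulLeft ℝ L)
    with h𝒩
  have hnil : IsNilpotent 𝒩 := isNilpotent_commBracket hl
  obtain ⟨M₀, hM₀⟩ := IsNilpotent.isNilpotent_exp_sub_one
    (A := Module.End ℝ (Module.End ℝ A)) hnil
  obtain ⟨m, hm⟩ := hnil
  have hLinv : exp (-L) = exp (-y) * exp (-x) := by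
    calc exp (-L) = exp (-L) * ((exp x * exp y) * (exp (-y) * exp (-x))) := by
          rw [mul_assoc (exp x), ← mul_assoc (exp y), exp_mul_exp_neg_self hy, one_mul,
            exp_mul_exp_neg_self hx, mul_one]
      _ = exp (-y) * exp (-x) := by
          rw [← hexp, ← mul_assoc, exp_neg_mul_exp_self hL, one_mul]
  have hE : ∀ f : Module.End ℝ A, exp 𝒩 f =
      LinearMap.mulLeft ℝ (exp L) * f * LinearMap.mulLeft ℝ (exp (-L)) := by
    intro f
    rw [h𝒩, exp_commBracket_apply hl, exp_mulLeft hL,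
      show -(LinearMap.mulLeft ℝ L) = LinearMap.mulLeft ℝ (-L) by ext; simp, exp_mulLeft hL.neg]
  have hPa : ∀ a, P a = exp L * a * exp (-L) - a := by
    intro a
    rw [hP, LinearMap.sub_apply, Module.End.mul_apply, exp_commBracket_apply hx,
      exp_commBracket_apply hy, hexp, hLinv]
    simp [mul_assoc]
  have hE1 : ∀ a, (exp 𝒩 - 1) (LinearMap.mulLeft ℝ a) = LinearMap.mulLeft ℝ (P a) := by
    intro a
    rw [LinearMap.sub_apply, hE, hPa]
    ext b
    simp [mul_assoc, sub_mul]
  have hEn : ∀ n a, ((exp 𝒩 - 1) ^ n) (LinearMap.mulLeft ℝ a) =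
      LinearMap.mulLeft ℝ ((P ^ n) a) := by
    intro n
    induction n with
    | zero => intro a; simp
    | succ n ih =>
      intro a
      rw [pow_succ, Module.End.mul_apply, hE1, ih, pow_succ, Module.End.mul_apply]
  have hd1 : d 1 = 0 := by simpa using hd 1 1
  have hdG : d (exp L) = W * exp L := by
    rw [hexp, hd, derivation_exp hd hx hdx, derivation_exp hd hy hdy, hW,
      exp_commBracket_apply hx, add_mul]
    congr 1
    · rw [mul_assoc]
    · rw [← mul_assoc _ (exp x) (exp y), mul_assoc _ (exp (-x)) (exp x), exp_neg_mul_exp_self hx,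
        mul_one, mul_assoc]
  -- Conjugating a derivation by left multiplication with `exp L` subtracts its logarithmic
  -- derivative `d (exp L) exp (-L)`, which is `W`.
  have hEd : (exp 𝒩 - 1) d = - LinearMap.mulLeft ℝ W := by
    rw [LinearMap.sub_apply, hE]
    ext b
    simp only [LinearMap.sub_apply, Module.End.mul_apply, LinearMap.mulLeft_apply,
      Module.End.one_apply, LinearMap.neg_apply]
    have h1 : d (exp L * (exp (-L) * b)) = d b := by
      rw [← mul_assoc, exp_mul_exp_neg_self hL, one_mul]
    rw [hd, hdG, mul_assoc, ← mul_assoc (exp L), exp_mul_exp_neg_self hL, one_mul] at h1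
    rw [← h1]
    abel
  refine ⟨M₀, fun M hM => ?_⟩
  have hlog := nilLog_exp (A := Module.End ℝ (Module.End ℝ A)) (n := M + 1) hm
    (pow_eq_zero_of_le (by omega) hM₀)
  rw [nilLog_eq_sum, show Finset.Ico 1 (M + 1) = Finset.Icc 1 M from rfl] at hlog
  have h1 := congrArg (fun T : Module.End ℝ (Module.End ℝ A) => T d 1) hlog
  simp only [LinearMap.sum_apply, LinearMap.smul_apply, h𝒩, commBracket_apply, LinearMap.sub_apply,
    Module.End.mul_apply, LinearMap.mulLeft_apply, hd1, mul_zero, mul_one, zero_sub] at h1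
  rw [← neg_inj, ← h1, ← Finset.sum_neg_distrib]
  refine Finset.sum_congr rfl fun n hn => ?_
  obtain ⟨k, rfl⟩ : ∃ k, n = k + 1 := ⟨n - 1, by simp at hn; omega⟩
  rw [pow_succ, Module.End.mul_apply, hEd, map_neg, hEn]
  simp

/-! ### The Baker–Campbell–Hausdorff formula in a nilpotent space of elements. -/

namespace IsNilpotentSpace

variable {S : Submodule ℝ A} {m : ℕ}

theorem exp_sub_one_mem (h : IsNilpotentSpace S m) {z : A} (hz : z ∈ S) : exp z - 1 ∈ S := by
  have hz0 : z ^ (m + 1) = 0 := by rw [pow_succ, h.pow_eq_zero hz, zero_mul]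
  rw [exp_eq_sum hz0, Finset.sum_range_succ']
  simp only [Nat.factorial_zero, Nat.cast_one, inv_one, pow_zero, one_smul, add_sub_cancel_right]
  refine Submodule.sum_mem _ fun k _ => ?_
  rw [← Rat.cast_smul_eq_qsmul ℝ]
  exact S.smul_mem _ (h.pow_succ_mem hz k)

theorem exp_mul_exp_sub_one_mem (h : IsNilpotentSpace S m) {x y : A} (hx : x ∈ S) (hy : y ∈ S) :
    exp x * exp y - 1 ∈ S := by
  have : exp x * exp y - 1 = (exp x - 1) * (exp y - 1) + (exp x - 1) + (exp y - 1) := by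
    noncomm_ring
  rw [this]
  exact S.add_mem (S.add_mem (h.mul_le (Submodule.mul_mem_mul (h.exp_sub_one_mem hx)
    (h.exp_sub_one_mem hy))) (h.exp_sub_one_mem hx)) (h.exp_sub_one_mem hy)

theorem exp_nilLog (h : IsNilpotentSpace S m) {x y : A} (hx : x ∈ S) (hy : y ∈ S) :
    exp (nilLog m (exp x * exp y - 1)) = exp x * exp y := by
  have h1 := h.exp_mul_exp_sub_one_mem hx hy
  rw [_root_.exp_nilLog (h.pow_eq_zero h1) (h.pow_eq_zero (h.nilLog_mem h1)), add_sub_cancel]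

open Polynomial in
/-- **Baker–Campbell–Hausdorff formula** in Dynkin's form. -/
theorem exists_bch_eq_nilLog (h : IsNilpotentSpace S (m + 1)) {x y : A} (hx : x ∈ S) (hy : y ∈ S) :
    ∃ M₀ : ℕ, ∀ M, M₀ ≤ M → bch (commBracket A) M x y = nilLog (m + 1) (exp x * exp y - 1) := by
  have hP := h.polynomial
  -- `A` need not carry a derivation fixing `x` and `y`, but the Euler derivation `X d/dX` of `A[X]`
  -- fixes the monomials `x X` and `y X`.
  set d : A[X] →ₗ[ℝ] A[X] := (LinearMap.mulLeft ℝ (X : A[X])).comp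
    ((derivative : A[X] →ₗ[A] A[X]).restrictScalars ℝ) with hd
  have hdp : ∀ p, d p = X * derivative p := fun p => rfl
  have hleib : ∀ a b, d (a * b) = d a * b + a * d b := by
    intro a b
    simp only [hdp, derivative_mul, mul_add, ← mul_assoc]
    rw [X_mul (p := a)]
  have hmon : ∀ z : A, d (monomial 1 z) = monomial 1 z := by
    intro z
    rw [hdp, derivative_monomial]
    simp [C_mul_X_eq_monomial]
  have hmem : ∀ {z : A}, z ∈ S → monomial 1 z ∈ polySpace S := by
    intro z hz n
    rw [coeff_monomial]
    split_ifs
    · exact hz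
    · exact S.zero_mem
  set x' : A[X] := monomial 1 x
  set y' : A[X] := monomial 1 y
  have hx' := hmem hx
  have hy' := hmem hy
  set L := nilLog (m + 1) (exp x' * exp y' - 1) with hL
  obtain ⟨M₀, hM₀⟩ := derivation_log hleib (hP.isNilpotent hx') (hP.isNilpotent hy')
    (hP.isNilpotent (hP.nilLog_mem (hP.exp_mul_exp_sub_one_mem hx' hy'))) (hmon x) (hmon y)
    (hP.exp_nilLog hx' hy')
  obtain ⟨k₁, hk₁⟩ := isNilpotent_commBracket (hP.isNilpotent hx')
  obtain ⟨k₂, hk₂⟩ := isNilpotent_commBracket (hP.isNilpotent hy')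
  refine ⟨M₀ + k₁ + k₂ + 1, fun M hM => ?_⟩
  have hF := derivation_bch hleib (hmon x) (hmon y) (c := M) (by omega)
    (pow_eq_zero_of_le (by omega) hk₁) (pow_eq_zero_of_le (by omega) hk₂)
  rw [← hM₀ M (by omega)] at hF
  set F := bch (commBracket A[X]) M x' y' with hFdef
  -- The Euler derivation takes equal values on `F` and `L`, and it multiplies the coefficient of
  -- degree `n` by `n`. Hence `F` and `L` can differ only in the constant term.
  have hcoeff : ∀ n, n ≠ 0 → (F - L).coeff n = 0 := by
    intro n hn
    obtain ⟨n, rfl⟩ := Nat.exists_eq_succ_of_ne_zero hn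
    have h0 : (d (F - L)).coeff (n + 1) = 0 := by rw [map_sub, hF, sub_self, coeff_zero]
    rw [hdp, coeff_X_mul, coeff_derivative] at h0
    have h1 : ((n : ℝ) + 1) • (F - L).coeff (n + 1) = 0 := by
      rw [← h0, Algebra.smul_def, map_add, map_natCast, map_one]
      exact ((Nat.cast_commute n _).add_left (Commute.one_left _)).eq
    exact (smul_eq_zero.1 h1).resolve_left (by positivity)
  have hcomm : ∀ (t : ℝ) (a : A), Commute ((AlgHom.id ℝ A) a) (algebraMap ℝ A t) := fun t a =>
    (Algebra.commutes t a).symm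
  let ev : ℝ → A[X] →ₐ[ℝ] A := fun t => eval₂AlgHom (AlgHom.id ℝ A) (algebraMap ℝ A t) (hcomm t)
  have hev : ∀ (t : ℝ) (p : A[X]), ev t p = p.eval (algebraMap ℝ A t) := fun t p => rfl
  have hevF : ∀ t : ℝ, ev t F = bch (commBracket A) M (t • x) (t • y) := by
    intro t
    rw [hFdef]
    have := map_bch (B := commBracket A[X]) (B' := commBracket A) (ev t).toLinearMap
      (fun a b => by simp) M x' y'
    simp only [AlgHom.toLinearMap_apply] at this
    rw [this]
    simp [hev, x', y', Algebra.smul_def, Algebra.commutes]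
  have hevL : ∀ t : ℝ, ev t L = nilLog (m + 1) (exp (t • x) * exp (t • y) - 1) := by
    intro t
    have h1 : ∀ z : A, ev t (monomial 1 z) = t • z := by
      intro z; simp [hev, Algebra.smul_def, Algebra.commutes]
    rw [hL, nilLog_eq_sum, nilLog_eq_sum, map_sum]
    refine Finset.sum_congr rfl fun n _ => ?_
    rw [map_smul, map_pow, map_sub, map_mul, map_one, (hP.isNilpotent hx').map_exp,
      (hP.isNilpotent hy').map_exp, h1, h1]
  have hconst : ∀ t : ℝ, ev t (F - L) = (F - L).coeff 0 := by
    intro t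
    rw [hev, eval_eq_sum_range, Finset.sum_range_succ']
    rw [Finset.sum_eq_zero fun n _ => by rw [hcoeff (n + 1) (by omega), zero_mul]]
    simp
  -- Since `F - L` is constant, its value at `1`, the difference sought, equals its value at `0`,
  -- where both series vanish.
  have h01 := (hconst 1).trans (hconst 0).symm
  rw [map_sub, map_sub, hevF, hevF, hevL, hevL, one_smul, one_smul, zero_smul, zero_smul] at h01
  have hb0 : bch (commBracket A) M (0 : A) 0 = 0 := by
    have := map_bch (B := commBracket A) (B' := commBracket A) (0 : A →ₗ[ℝ] A) (by simp) M 0 0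
    simpa using this.symm
  have hl0 : nilLog (m + 1) (exp (0 : A) * exp (0 : A) - 1) = 0 := by
    rw [nilLog_eq_sum]
    refine Finset.sum_eq_zero fun n hn => ?_
    have : n ≠ 0 := by simp at hn; omega
    simp [this]
  rw [hb0, hl0, sub_zero, sub_eq_zero] at h01
  exact h01

end IsNilpotentSpace

end Dynkin

/-! ### Lower central series and graded brackets -/

section Splitting

variable {𝔥 : Type*} [LieRing 𝔥] [LieAlgebra ℝ 𝔥]

/-- Induction on `i` through the Jacobi identity `⁅⁅a, b⁆, y⁆ = ⁅a, ⁅b, y⁆⁆ - ⁅b, ⁅a, y⁆⁆`. The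
extra `+ 1` comes from indexing the series from `0`. -/
theorem lie_mem_lowerCentralSeries {i j : ℕ} {x y : 𝔥}
    (hx : x ∈ LieModule.lowerCentralSeries ℝ 𝔥 𝔥 i) (hy : y ∈ LieModule.lowerCentralSeries ℝ 𝔥 𝔥 j) :
    ⁅x, y⁆ ∈ LieModule.lowerCentralSeries ℝ 𝔥 𝔥 (i + j + 1) := by
  induction i generalizing x y j with
  | zero =>
    rw [zero_add, LieModule.lowerCentralSeries_succ]
    exact LieSubmodule.lie_mem_lie (LieSubmodule.mem_top x) hy
  | succ i ih =>
    have hx' : x ∈ (LieModule.lowerCentralSeries ℝ 𝔥 𝔥 (i + 1)).toSubmodule := hx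
    rw [LieModule.lowerCentralSeries_succ, LieSubmodule.lieIdeal_oper_eq_linear_span'] at hx'
    induction hx' using Submodule.span_induction with
    | mem z hz =>
      obtain ⟨a, _, b, hb, rfl⟩ := hz
      rw [lie_lie]
      have h1 : ⁅a, ⁅b, y⁆⁆ ∈ LieModule.lowerCentralSeries ℝ 𝔥 𝔥 (i + 1 + j + 1) := by
        have := ih hb hy
        rw [show i + 1 + j + 1 = (i + j + 1) + 1 by ring, LieModule.lowerCentralSeries_succ]
        exact LieSubmodule.lie_mem_lie (LieSubmodule.mem_top a) this
      have h2 : ⁅b, ⁅a, y⁆⁆ ∈ LieModule.lowerCentralSeries ℝ 𝔥 𝔥 (i + 1 + j + 1) := by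
        have h3 : ⁅a, y⁆ ∈ LieModule.lowerCentralSeries ℝ 𝔥 𝔥 (j + 1) := by
          rw [LieModule.lowerCentralSeries_succ]
          exact LieSubmodule.lie_mem_lie (LieSubmodule.mem_top a) hy
        have := ih hb h3
        rwa [show i + (j + 1) + 1 = i + 1 + j + 1 by ring] at this
      exact sub_mem h1 h2
    | zero => rw [zero_lie]; exact zero_mem _
    | add a b ha hb iha ihb =>
      have h' : ∀ z, z ∈ Submodule.span ℝ {m : 𝔥 | ∃ x ∈ (⊤ : LieIdeal ℝ 𝔥),
          ∃ n ∈ LieModule.lowerCentralSeries ℝ 𝔥 𝔥 i, ⁅x, n⁆ = m} →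
          z ∈ LieModule.lowerCentralSeries ℝ 𝔥 𝔥 (i + 1) := by
        intro z hz
        rw [← LieSubmodule.lieIdeal_oper_eq_linear_span'] at hz
        rwa [LieModule.lowerCentralSeries_succ]
      rw [add_lie]
      exact add_mem (iha (h' _ ha)) (ihb (h' _ hb))
    | smul t a ha iha =>
      have h' : a ∈ LieModule.lowerCentralSeries ℝ 𝔥 𝔥 (i + 1) := by
        rw [← LieSubmodule.lieIdeal_oper_eq_linear_span'] at ha
        rwa [LieModule.lowerCentralSeries_succ]
      rw [smul_lie]
      exact SMulMemClass.smul_mem t (iha h')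

/-- The nilpotency length refers to the series over `ℤ`, which has the same underlying sets as the
one over `ℝ`. -/
theorem lowerCentralSeries_nilpotencyLength [LieRing.IsNilpotent 𝔥] :
    LieModule.lowerCentralSeries ℝ 𝔥 𝔥 (LieModule.nilpotencyLength 𝔥 𝔥) = ⊥ := by
  have h : LieModule.lowerCentralSeries ℤ 𝔥 𝔥 (LieModule.nilpotencyLength 𝔥 𝔥) = ⊥ :=
    Nat.sInf_mem (LieModule.IsNilpotent.nilpotent ℤ 𝔥 𝔥)
  rw [← SetLike.coe_set_eq] at h ⊢
  rw [LieModule.coe_lowerCentralSeries_eq_int, h]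
  rfl

/-! ### Degrees, dilations, and the deformation of the Lie bracket to the graded bracket. -/

namespace LCSSplitting

variable (D : LCSSplitting 𝔥)

theorem proj_apply (i : ℕ) (x : 𝔥) : D.proj i x =
    ((LinearEquiv.ofBijective (DirectSum.coeLinearMap D.V) D.isInternal).symm x i : 𝔥) := rfl

theorem proj_mem (i : ℕ) (x : 𝔥) : D.proj i x ∈ D.V i := by
  rw [proj_apply]; exact Subtype.coe_prop _

theorem proj_of_mem {i : ℕ} {x : 𝔥} (hx : x ∈ D.V i) : D.proj i x = x := by
  rw [proj_apply, D.isInternal.ofBijective_coeLinearMap_of_mem hx]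

theorem proj_of_mem_ne {i j : ℕ} (hij : i ≠ j) {x : 𝔥} (hx : x ∈ D.V i) : D.proj j x = 0 := by
  rw [proj_apply, D.isInternal.ofBijective_coeLinearMap_of_mem_ne hij hx]
  rfl

theorem induction_on {p : 𝔥 → Prop} (x : 𝔥) (hV : ∀ i, ∀ v ∈ D.V i, p v)
    (hadd : ∀ a b, p a → p b → p (a + b)) : p x := by
  have hx : x ∈ ⨆ i, D.V i := by
    rw [D.isInternal.submodule_iSup_eq_top]; exact Submodule.mem_top
  exact Submodule.iSup_induction (motive := p) _ hx hV (hV 0 0 (zero_mem _)) hadd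

theorem proj_proj_self (i : ℕ) (x : 𝔥) : D.proj i (D.proj i x) = D.proj i x :=
  D.proj_of_mem (D.proj_mem i x)

theorem proj_proj_of_ne {i j : ℕ} (h : i ≠ j) (x : 𝔥) : D.proj j (D.proj i x) = 0 :=
  D.proj_of_mem_ne h (D.proj_mem i x)

theorem mem_lcs_iff (i : ℕ) (x : 𝔥) :
    x ∈ LieModule.lowerCentralSeries ℝ 𝔥 𝔥 i ↔ ∀ j ≤ i, D.proj j x = 0 := by
  rw [← LieSubmodule.mem_toSubmodule, D.lcs_eq]
  constructor
  · intro hx j hj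
    have : (⨆ k : ℕ, ⨆ _ : i < k, D.V k) ≤ LinearMap.ker (D.proj j) := by
      refine iSup₂_le fun k hk v hv => ?_
      exact D.proj_of_mem_ne (by omega) hv
    exact this hx
  · intro hx
    have key : x = (DirectSum.coeLinearMap D.V)
        ((LinearEquiv.ofBijective (DirectSum.coeLinearMap D.V) D.isInternal).symm x) :=
      ((LinearEquiv.ofBijective (DirectSum.coeLinearMap D.V) D.isInternal).apply_symm_apply x).symm
    classical
    rw [key, DirectSum.coeLinearMap_eq_dfinsuppSum]
    refine Submodule.dfinsuppSum_mem _ _ _ fun k hk => ?_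
    have hik : i < k := by
      by_contra hcon
      refine hk (Subtype.ext ?_)
      have := hx k (by omega)
      rwa [proj_apply] at this
    exact Submodule.mem_iSup_of_mem k (Submodule.mem_iSup_of_mem hik (Subtype.coe_prop _))

/-- The elements without components of degree less than `k`. -/
def fil (k : ℕ) : Submodule ℝ 𝔥 := ⨅ j : ℕ, ⨅ _ : j < k, LinearMap.ker (D.proj j)

theorem mem_fil {k : ℕ} {x : 𝔥} : x ∈ D.fil k ↔ ∀ j < k, D.proj j x = 0 := by
  simp [fil, Submodule.mem_iInf]

theorem mem_fil_succ {k : ℕ} {x : 𝔥} :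
    x ∈ D.fil (k + 1) ↔ x ∈ LieModule.lowerCentralSeries ℝ 𝔥 𝔥 k := by
  rw [mem_fil, D.mem_lcs_iff]
  simp

theorem fil_anti {k l : ℕ} (h : k ≤ l) : D.fil l ≤ D.fil k := fun _ hx =>
  D.mem_fil.2 fun j hj => D.mem_fil.1 hx j (hj.trans_le h)

theorem mem_fil_one (x : 𝔥) : x ∈ D.fil 1 := by
  rw [D.mem_fil_succ, LieModule.lowerCentralSeries_zero]
  exact LieSubmodule.mem_top x

/-- The first term of the lower central series is the whole algebra, so the layers of positive index
already span it. -/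
theorem proj_zero (x : 𝔥) : D.proj 0 x = 0 := D.mem_fil.1 (D.mem_fil_one x) 0 one_pos

theorem V_le_fil (i : ℕ) : D.V i ≤ D.fil i := fun _ hx =>
  D.mem_fil.2 fun _ hj => D.proj_of_mem_ne hj.ne' hx

theorem lie_mem_fil {i j : ℕ} {x y : 𝔥} (hx : x ∈ D.fil i) (hy : y ∈ D.fil j) :
    ⁅x, y⁆ ∈ D.fil (i + j) := by
  -- `fil 0` and `fil 1` are both everything, so degree `0` is treated as degree `1` before the
  -- shift by one between `fil` and the lower central series.
  have aux : ∀ {k : ℕ} {z : 𝔥}, z ∈ D.fil k → ∃ k', k ≤ k' + 1 ∧ k' + 1 ≤ max k 1 ∧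
      z ∈ LieModule.lowerCentralSeries ℝ 𝔥 𝔥 k' := by
    intro k z hz
    rcases k with _ | k
    · exact ⟨0, by omega, by simp, by
        rw [LieModule.lowerCentralSeries_zero]; exact LieSubmodule.mem_top z⟩
    · exact ⟨k, le_rfl, by omega, D.mem_fil_succ.1 hz⟩
  obtain ⟨i', hi, _, hx'⟩ := aux hx
  obtain ⟨j', hj, _, hy'⟩ := aux hy
  have := D.mem_fil_succ.2 (lie_mem_lowerCentralSeries hx' hy')
  exact D.fil_anti (by omega) this

variable [LieRing.IsNilpotent 𝔥]

theorem fil_eq_bot {k : ℕ} (h : LieModule.nilpotencyLength 𝔥 𝔥 < k) : D.fil k = ⊥ := by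
  rw [eq_bot_iff]
  intro x hx
  have := D.mem_fil_succ.1 (D.fil_anti (Nat.succ_le_of_lt h) hx)
  rwa [lowerCentralSeries_nilpotencyLength] at this

theorem proj_eq_zero {i : ℕ} (h : LieModule.nilpotencyLength 𝔥 𝔥 < i) (x : 𝔥) :
    D.proj i x = 0 := by
  have := D.V_le_fil i (D.proj_mem i x)
  rwa [D.fil_eq_bot h, Submodule.mem_bot] at this

theorem sum_proj (x : 𝔥) :
    ∑ i ∈ Finset.Icc 1 (LieModule.nilpotencyLength 𝔥 𝔥), D.proj i x = x := by
  refine D.induction_on (p := fun x =>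
    ∑ i ∈ Finset.Icc 1 (LieModule.nilpotencyLength 𝔥 𝔥), D.proj i x = x) x ?_ ?_
  · intro i v hv
    by_cases hi : i ∈ Finset.Icc 1 (LieModule.nilpotencyLength 𝔥 𝔥)
    · rw [Finset.sum_eq_single_of_mem i hi fun j _ hj => D.proj_of_mem_ne hj.symm hv,
        D.proj_of_mem hv]
    · have hv0 : v = 0 := by
        rw [← D.proj_of_mem hv]
        rw [Finset.mem_Icc, not_and_or] at hi
        rcases hi with hi | hi
        · rw [show i = 0 by omega, D.proj_zero]
        · exact D.proj_eq_zero (by omega) v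
      simp [hv0]
  · intro a b ha hb
    simp only [map_add, Finset.sum_add_distrib, ha, hb]

theorem ext_proj {x y : 𝔥} (h : ∀ i, D.proj i x = D.proj i y) : x = y := by
  rw [← D.sum_proj x, ← D.sum_proj y]
  exact Finset.sum_congr rfl fun i _ => h i

theorem proj_sum_proj (s : Finset ℕ) (k : ℕ) (f : ℕ → 𝔥) :
    D.proj k (∑ i ∈ s, D.proj i (f i)) = if k ∈ s then D.proj k (f k) else 0 := by
  rw [map_sum]
  split_ifs with h
  · rw [Finset.sum_eq_single_of_mem k h fun j _ hj => D.proj_proj_of_ne hj _, D.proj_proj_self]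
  · exact Finset.sum_eq_zero fun j hj => D.proj_proj_of_ne (by rintro rfl; exact h hj) _

theorem dilation_apply (t : ℝ) (x : 𝔥) : D.dilation t x =
    ∑ i ∈ Finset.Icc 1 (LieModule.nilpotencyLength 𝔥 𝔥), t ^ i • D.proj i x := by
  simp [dilation, LinearMap.sum_apply]

theorem proj_dilation (t : ℝ) (i : ℕ) (x : 𝔥) : D.proj i (D.dilation t x) = t ^ i • D.proj i x := by
  have : D.dilation t x = ∑ j ∈ Finset.Icc 1 (LieModule.nilpotencyLength 𝔥 𝔥),
      D.proj j (t ^ j • x) := by simp [D.dilation_apply]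
  rw [this, D.proj_sum_proj]
  split_ifs with h
  · rw [map_smul]
  · rw [Finset.mem_Icc, not_and_or] at h
    rcases h with h | h
    · rw [show i = 0 by omega, D.proj_zero, smul_zero]
    · rw [D.proj_eq_zero (by omega), smul_zero]

theorem dilation_dilation (s t : ℝ) (x : 𝔥) :
    D.dilation s (D.dilation t x) = D.dilation (s * t) x := by
  refine D.ext_proj fun i => ?_
  rw [proj_dilation, proj_dilation, proj_dilation, smul_smul, mul_pow]

theorem dilation_one (x : 𝔥) : D.dilation 1 x = x := by
  refine D.ext_proj fun i => ?_
  rw [proj_dilation, one_pow, one_smul]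

theorem dilation_of_mem_V_one (t : ℝ) {v : 𝔥} (hv : v ∈ D.V 1) : D.dilation t v = t • v := by
  refine D.ext_proj fun i => ?_
  rw [proj_dilation, map_smul]
  by_cases h : i = 1
  · rw [h, pow_one]
  · rw [D.proj_of_mem_ne (Ne.symm h) hv, smul_zero, smul_zero]

/-- The deformation of the Lie bracket in which the component of degree `k` of `[v, w]`, for
`v ∈ V i` and `w ∈ V j`, is multiplied by `t ^ (k - i - j)`: the Lie bracket for `t = 1`, the graded
bracket for `t = 0`. -/
def scaledBracket (t : ℝ) : 𝔥 →ₗ[ℝ] 𝔥 →ₗ[ℝ] 𝔥 :=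
  ∑ i ∈ Finset.Icc 1 (LieModule.nilpotencyLength 𝔥 𝔥),
    ∑ j ∈ Finset.Icc 1 (LieModule.nilpotencyLength 𝔥 𝔥),
      ∑ k ∈ Finset.Icc 1 (LieModule.nilpotencyLength 𝔥 𝔥),
        (if i + j ≤ k then t ^ (k - (i + j)) else 0) •
        ((LieModule.toEnd ℝ 𝔥 𝔥 : 𝔥 →ₗ[ℝ] 𝔥 →ₗ[ℝ] 𝔥).compl₁₂ (D.proj i) (D.proj j)).compr₂
          (D.proj k)

theorem scaledBracket_apply (t : ℝ) (x y : 𝔥) : D.scaledBracket t x y =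
    ∑ i ∈ Finset.Icc 1 (LieModule.nilpotencyLength 𝔥 𝔥),
      ∑ j ∈ Finset.Icc 1 (LieModule.nilpotencyLength 𝔥 𝔥),
        ∑ k ∈ Finset.Icc 1 (LieModule.nilpotencyLength 𝔥 𝔥),
          (if i + j ≤ k then t ^ (k - (i + j)) else 0) • D.proj k ⁅D.proj i x, D.proj j y⁆ := by
  simp only [scaledBracket, LinearMap.sum_apply, LinearMap.smul_apply]
  rfl

theorem gradedBracket_apply (x y : 𝔥) : D.gradedBracket x y =
    ∑ i ∈ Finset.Icc 1 (LieModule.nilpotencyLength 𝔥 𝔥),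
      ∑ j ∈ Finset.Icc 1 (LieModule.nilpotencyLength 𝔥 𝔥),
        D.proj (i + j) ⁅D.proj i x, D.proj j y⁆ := by
  simp [gradedBracket, LinearMap.sum_apply]

theorem scaledBracket_swap (t : ℝ) (x y : 𝔥) : D.scaledBracket t x y = - D.scaledBracket t y x := by
  rw [scaledBracket_apply, scaledBracket_apply, Finset.sum_comm, ← Finset.sum_neg_distrib]
  refine Finset.sum_congr rfl fun j _ => ?_
  rw [← Finset.sum_neg_distrib]
  refine Finset.sum_congr rfl fun i _ => ?_
  rw [← Finset.sum_neg_distrib]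
  refine Finset.sum_congr rfl fun k _ => ?_
  rw [← lie_skew, map_neg, smul_neg, add_comm i j]

theorem scaledBracket_self (t : ℝ) (x : 𝔥) : D.scaledBracket t x x = 0 :=
  (smul_eq_zero.1 (show (2 : ℝ) • D.scaledBracket t x x = 0 by
    rw [two_smul]; nth_rw 2 [D.scaledBracket_swap]; exact add_neg_cancel _)).resolve_left
    two_ne_zero

theorem scaledBracket_zero : D.scaledBracket 0 = D.gradedBracket := by
  refine LinearMap.ext₂ fun x y => ?_
  rw [scaledBracket_apply, gradedBracket_apply]
  refine Finset.sum_congr rfl fun i hi => Finset.sum_congr rfl fun j hj => ?_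
  rw [Finset.sum_eq_single (i + j)]
  · simp
  · intro k _ hk
    split_ifs with h
    · rw [zero_pow (by omega), zero_smul]
    · rw [zero_smul]
  · intro h
    have : LieModule.nilpotencyLength 𝔥 𝔥 < i + j := by
      simp only [Finset.mem_Icc, not_and, not_le] at h hi
      exact h (by omega)
    rw [D.proj_eq_zero this, smul_zero]

theorem proj_lie_eq_zero {i j k : ℕ} (h : k < i + j) (x y : 𝔥) :
    D.proj k ⁅D.proj i x, D.proj j y⁆ = 0 :=
  D.mem_fil.1 (D.lie_mem_fil (D.V_le_fil i (D.proj_mem i x)) (D.V_le_fil j (D.proj_mem j y))) k h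

/-- The dilation `δ_s` intertwines the deformed brackets. -/
theorem dilation_scaledBracket {s t : ℝ} (hst : s * t = 1) (x y : 𝔥) :
    D.dilation s (D.scaledBracket t x y) = ⁅D.dilation s x, D.dilation s y⁆ := by
  conv_rhs => rw [D.dilation_apply, D.dilation_apply, sum_lie_sum]
  rw [scaledBracket_apply, map_sum]
  refine Finset.sum_congr rfl fun i _ => ?_
  rw [map_sum]
  refine Finset.sum_congr rfl fun j _ => ?_
  rw [map_sum, smul_lie, lie_smul]
  nth_rw 2 [← D.sum_proj ⁅D.proj i x, D.proj j y⁆]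
  rw [Finset.smul_sum, Finset.smul_sum]
  refine Finset.sum_congr rfl fun k _ => ?_
  have hd : D.dilation s (D.proj k ⁅D.proj i x, D.proj j y⁆) =
      s ^ k • D.proj k ⁅D.proj i x, D.proj j y⁆ := by
    refine D.ext_proj fun l => ?_
    rw [proj_dilation, map_smul]
    by_cases h : k = l
    · rw [h]
    · rw [D.proj_proj_of_ne h, smul_zero, smul_zero]
  rw [map_smul, hd]
  split_ifs with h
  · rw [smul_smul, smul_smul]
    congr 1
    obtain ⟨m, rfl⟩ := Nat.exists_eq_add_of_le h
    rw [Nat.add_sub_cancel_left, pow_add, pow_add]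
    calc t ^ m * (s ^ i * s ^ j * s ^ m) = s ^ i * s ^ j * (s * t) ^ m := by rw [mul_pow]; ring
      _ = _ := by rw [hst, one_pow, mul_one]
  -- A bracket of elements of degrees `i` and `j` has no components below `i + j`, so the value `0`
  -- chosen there for the coefficient loses nothing.
  · rw [D.proj_lie_eq_zero (by omega)]
    simp

theorem dilation_gradedBracket (s : ℝ) (x y : 𝔥) :
    D.dilation s (D.gradedBracket x y) = D.gradedBracket (D.dilation s x) (D.dilation s y) := by
  rw [gradedBracket_apply, gradedBracket_apply, map_sum]
  refine Finset.sum_congr rfl fun i _ => ?_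
  rw [map_sum]
  refine Finset.sum_congr rfl fun j _ => ?_
  rw [proj_dilation, proj_dilation, smul_lie, lie_smul, map_smul, map_smul, smul_smul, ← pow_add]
  refine D.ext_proj fun l => ?_
  rw [proj_dilation, map_smul]
  by_cases h : i + j = l
  · rw [h]
  · rw [D.proj_proj_of_ne h, smul_zero, smul_zero]

theorem scaledBracket_mem_fil (t : ℝ) {i j : ℕ} {x y : 𝔥} (hx : x ∈ D.fil i) (hy : y ∈ D.fil j) :
    D.scaledBracket t x y ∈ D.fil (i + j) := by
  rw [scaledBracket_apply]
  refine Submodule.sum_mem _ fun i' _ => Submodule.sum_mem _ fun j' _ => Submodule.sum_mem _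
    fun k _ => ?_
  by_cases hi : i' < i
  · rw [D.mem_fil.1 hx i' hi]; simp
  by_cases hj : j' < j
  · rw [D.mem_fil.1 hy j' hj]; simp
  split_ifs with h
  · exact Submodule.smul_mem _ _ (D.fil_anti (by omega) (D.V_le_fil k (D.proj_mem k _)))
  · simp

theorem nestedBracket_mem_fil (t : ℝ) {l : List 𝔥} :
    nestedBracket (D.scaledBracket t) l ∈ D.fil l.length := by
  induction l with
  | nil => simp [nestedBracket]
  | cons z l ih =>
    by_cases h : l = []
    · subst h; exact D.mem_fil_one z
    · rw [nestedBracket_cons _ z h, List.length_cons, add_comm]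
      exact D.scaledBracket_mem_fil t (D.mem_fil_one z) ih

theorem nestedBracket_eq_zero (t : ℝ) {l : List 𝔥}
    (hl : LieModule.nilpotencyLength 𝔥 𝔥 < l.length) :
    nestedBracket (D.scaledBracket t) l = 0 := by
  have := D.nestedBracket_mem_fil t (l := l)
  rwa [D.fil_eq_bot hl, Submodule.mem_bot] at this

theorem gradedBracket_mem_fil {i j : ℕ} {x y : 𝔥} (hx : x ∈ D.fil i) (hy : y ∈ D.fil j) :
    D.gradedBracket x y ∈ D.fil (i + j) := by
  rw [← scaledBracket_zero]; exact D.scaledBracket_mem_fil 0 hx hy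

theorem gradedBracket_of_mem {i j : ℕ} {x y : 𝔥} (hx : x ∈ D.V i) (hy : y ∈ D.V j) :
    D.gradedBracket x y = D.proj (i + j) ⁅x, y⁆ := by
  have hzero : ∀ {k : ℕ} {z : 𝔥}, z ∈ D.V k → k ∉ Finset.Icc 1 (LieModule.nilpotencyLength 𝔥 𝔥) →
      z = 0 := by
    intro k z hz hk
    rw [← D.proj_of_mem hz]
    rw [Finset.mem_Icc, not_and_or] at hk
    rcases hk with hk | hk
    · rw [show k = 0 by omega, D.proj_zero]
    · exact D.proj_eq_zero (by omega) z
  by_cases hi : i ∈ Finset.Icc 1 (LieModule.nilpotencyLength 𝔥 𝔥)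
  swap
  · simp [hzero hx hi]
  by_cases hj : j ∈ Finset.Icc 1 (LieModule.nilpotencyLength 𝔥 𝔥)
  swap
  · simp [hzero hy hj]
  rw [gradedBracket_apply, Finset.sum_eq_single_of_mem i hi, Finset.sum_eq_single_of_mem j hj,
    D.proj_of_mem hx, D.proj_of_mem hy]
  · intro k _ hk
    rw [D.proj_of_mem_ne hk.symm hy]; simp
  · intro k _ hk
    refine Finset.sum_eq_zero fun l _ => ?_
    rw [D.proj_of_mem_ne hk.symm hx]; simp

theorem gradedBracket_mem {i j : ℕ} {x y : 𝔥} (hx : x ∈ D.V i) (hy : y ∈ D.V j) :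
    D.gradedBracket x y ∈ D.V (i + j) := by
  rw [D.gradedBracket_of_mem hx hy]; exact D.proj_mem _ _

theorem sub_proj_mem_fil {k : ℕ} {x : 𝔥} (hx : x ∈ D.fil k) : x - D.proj k x ∈ D.fil (k + 1) := by
  rw [mem_fil]
  intro j hj
  rw [map_sub]
  rcases Nat.lt_succ_iff_lt_or_eq.1 hj with h | rfl
  · rw [D.mem_fil.1 hx j h, D.proj_proj_of_ne h.ne', sub_zero]
  · rw [D.proj_proj_self, sub_self]

theorem lie_V_mem_fil {i j : ℕ} {x y : 𝔥} (hx : x ∈ D.V i) (hy : y ∈ D.V j) :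
    ⁅x, y⁆ ∈ D.fil (i + j) := D.lie_mem_fil (D.V_le_fil i hx) (D.V_le_fil j hy)

/-- Dropping everything but the leading component of `z` changes the bracket only in degrees above
`i + k`. This carries the Jacobi identity over to the graded bracket. -/
theorem proj_lie_proj_right {i k : ℕ} {x z : 𝔥} (hx : x ∈ D.fil i) (hz : z ∈ D.fil k) :
    D.proj (i + k) ⁅x, D.proj k z⁆ = D.proj (i + k) ⁅x, z⁆ := by
  have h := D.lie_mem_fil hx (D.sub_proj_mem_fil hz)
  rw [lie_sub] at h
  have := D.mem_fil.1 h (i + k) (by omega)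
  rw [map_sub, sub_eq_zero] at this
  exact this.symm

theorem proj_lie_proj_left {i k : ℕ} {x z : 𝔥} (hx : x ∈ D.fil i) (hz : z ∈ D.fil k) :
    D.proj (k + i) ⁅D.proj k z, x⁆ = D.proj (k + i) ⁅z, x⁆ := by
  rw [← lie_skew, ← lie_skew z, map_neg, map_neg, add_comm, D.proj_lie_proj_right hx hz]

theorem gradedBracket_swap (x y : 𝔥) : D.gradedBracket x y = - D.gradedBracket y x := by
  rw [← scaledBracket_zero, scaledBracket_swap]

theorem gradedBracket_self (x : 𝔥) : D.gradedBracket x x = 0 := by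
  rw [← scaledBracket_zero, scaledBracket_self]

/-- The Jacobi identity of the graded bracket. -/
theorem gradedBracket_leibniz (x y z : 𝔥) : D.gradedBracket x (D.gradedBracket y z) =
    D.gradedBracket (D.gradedBracket x y) z + D.gradedBracket y (D.gradedBracket x z) := by
  refine D.induction_on (p := fun x => D.gradedBracket x (D.gradedBracket y z) =
    D.gradedBracket (D.gradedBracket x y) z + D.gradedBracket y (D.gradedBracket x z)) x ?_ ?_
  swap
  · intro a b ha hb
    simp only [map_add, LinearMap.add_apply, ha, hb]; abel
  intro i x hx
  refine D.induction_on (p := fun y => D.gradedBracket x (D.gradedBracket y z) =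
    D.gradedBracket (D.gradedBracket x y) z + D.gradedBracket y (D.gradedBracket x z)) y ?_ ?_
  swap
  · intro a b ha hb
    simp only [map_add, LinearMap.add_apply, ha, hb]; abel
  intro j y hy
  refine D.induction_on (p := fun z => D.gradedBracket x (D.gradedBracket y z) =
    D.gradedBracket (D.gradedBracket x y) z + D.gradedBracket y (D.gradedBracket x z)) z ?_ ?_
  swap
  · intro a b ha hb
    simp only [map_add, ha, hb]; abel
  intro k z hz
  rw [D.gradedBracket_of_mem hx (D.gradedBracket_mem hy hz), D.gradedBracket_of_mem hy hz,
    D.gradedBracket_of_mem (D.gradedBracket_mem hx hy) hz, D.gradedBracket_of_mem hx hy,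
    D.gradedBracket_of_mem hy (D.gradedBracket_mem hx hz), D.gradedBracket_of_mem hx hz,
    D.proj_lie_proj_right (D.V_le_fil i hx) (D.lie_V_mem_fil hy hz),
    D.proj_lie_proj_left (D.V_le_fil k hz) (D.lie_V_mem_fil hx hy),
    D.proj_lie_proj_right (D.V_le_fil j hy) (D.lie_V_mem_fil hx hz),
    show i + (j + k) = i + j + k by ring, show j + (i + k) = i + j + k by ring, ← map_add,
    leibniz_lie]

/-- `V (i + 1)` is spanned by the graded brackets of `V 1` and `V i`. -/
theorem V_succ_le_span {i : ℕ} (hi : 1 ≤ i) :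
    D.V (i + 1) ≤ Submodule.span ℝ {z | ∃ v ∈ D.V 1, ∃ w ∈ D.V i, D.gradedBracket v w = z} := by
  intro x hx
  obtain ⟨i, rfl⟩ : ∃ k, i = k + 1 := ⟨i - 1, by omega⟩
  have h1 : x ∈ (LieModule.lowerCentralSeries ℝ 𝔥 𝔥 (i + 1)).toSubmodule :=
    D.mem_fil_succ.1 (D.V_le_fil _ hx)
  rw [LieModule.lowerCentralSeries_succ, LieSubmodule.lieIdeal_oper_eq_linear_span'] at h1
  rw [← D.proj_of_mem hx]
  have h2 := Submodule.mem_map_of_mem (f := D.proj (i + 1 + 1)) h1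
  rw [Submodule.map_span] at h2
  refine Submodule.span_mono ?_ h2
  rintro _ ⟨_, ⟨a, _, b, hb, rfl⟩, rfl⟩
  refine ⟨D.proj 1 a, D.proj_mem 1 a, D.proj (i + 1) b, D.proj_mem _ b, ?_⟩
  have hb' := D.mem_fil_succ.2 hb
  rw [D.gradedBracket_of_mem (D.proj_mem 1 a) (D.proj_mem _ b),
    D.proj_lie_proj_right (D.V_le_fil 1 (D.proj_mem 1 a)) hb',
    D.proj_lie_proj_left hb' (D.mem_fil_one a), add_comm 1]

end LCSSplitting

end Splitting

/-! ### The terms of the Baker–Campbell–Hausdorff series of degree at least two -/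

section Tail

variable {E : Type*} [AddCommGroup E] [Module ℝ E]

/-- The terms of degree at least two of the series `bch`. -/
def bchTail (B : E →ₗ[ℝ] E →ₗ[ℝ] E) (c : ℕ) (x y : E) : E :=
  ∑ n ∈ Finset.Icc 1 c, ((-1 : ℝ) ^ (n - 1) / n) •
    ∑ p ∈ Fintype.piFinset fun _ : Fin n => bchExponents c,
      (((∑ i, ((p i).1 + (p i).2) : ℕ) : ℝ) *
        ((∏ i, (p i).1.factorial * (p i).2.factorial : ℕ) : ℝ))⁻¹ •
        if 2 ≤ (bchWord p x y).length then nestedBracket B (bchWord p x y) else 0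

theorem bch_eq_add_bchTail (B : E →ₗ[ℝ] E →ₗ[ℝ] E) {c : ℕ} (hc : 1 ≤ c) (x y : E) :
    bch B c x y = x + y + bchTail B c x y := by
  rw [← sub_eq_iff_eq_add, bch_eq, bchTail, ← Finset.sum_sub_distrib]
  simp only [← smul_sub, ← Finset.sum_sub_distrib]
  rw [Finset.sum_eq_single_of_mem 1 (by simp [hc])]
  · rw [sum_piFinset_fin_succ]
    simp only [Fintype.piFinset_of_isEmpty, Finset.univ_unique, Finset.sum_singleton, bchWord_cons]
    simp only [bchWord, List.ofFn_zero, List.flatten_nil, List.append_nil, List.length_append,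
      List.length_replicate]
    have hsub : ({(1, 0), (0, 1)} : Finset (ℕ × ℕ)) ⊆ bchExponents c := by
      intro q hq
      simp only [Finset.mem_insert, Finset.mem_singleton] at hq
      rcases hq with rfl | rfl <;> simp [bchExponents] <;> omega
    rw [← Finset.sum_subset hsub]
    · rw [Finset.sum_insert (by simp), Finset.sum_singleton]
      simp [nestedBracket]
    · intro q hq hq'
      have h1 := pos_of_mem_bchExponents hq
      have h2 : 2 ≤ q.1 + q.2 := by
        by_contra hcon
        refine hq' ?_
        obtain ⟨a, b⟩ := q
        simp only [Finset.mem_insert, Finset.mem_singleton, Prod.mk.injEq] at h1 hcon ⊢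
        omega
      rw [if_pos h2, sub_self, smul_zero]
  · intro n hn hn1
    rw [Finset.sum_eq_zero, smul_zero]
    intro p hp
    have := le_length_bchWord hp x y
    rw [Finset.mem_Icc] at hn
    rw [if_pos (by omega), sub_self, smul_zero]

theorem bchTail_mem (B : E →ₗ[ℝ] E →ₗ[ℝ] E) (c : ℕ) (x y : E) (P : Submodule ℝ E)
    (h : ∀ l : List E, 2 ≤ l.length → (∀ z ∈ l, z = x ∨ z = y) → nestedBracket B l ∈ P) :
    bchTail B c x y ∈ P := by
  refine Submodule.sum_mem _ fun n _ => P.smul_mem _ (Submodule.sum_mem _ fun p _ =>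
    P.smul_mem _ ?_)
  split_ifs with hl
  · exact h _ hl fun z hz => mem_bchWord hz
  · exact P.zero_mem

/-- A space that is mapped into itself by `B x` and `B y` and contains the brackets of `x` and `y`
contains all their nested brackets of length at least two. -/
theorem nestedBracket_mem_of_pair {B : E →ₗ[ℝ] E →ₗ[ℝ] E} {P : Submodule ℝ E} {s : Set E}
    (h2 : ∀ z ∈ s, ∀ w ∈ s, B z w ∈ P) (h : ∀ z ∈ s, ∀ w ∈ P, B z w ∈ P) :
    ∀ {l : List E}, 2 ≤ l.length → (∀ z ∈ l, z ∈ s) → nestedBracket B l ∈ P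
  | [], hl, _ => by simp at hl
  | [_], hl, _ => by simp at hl
  | [z, w], _, hs => h2 z (hs z (by simp)) w (hs w (by simp))
  | z :: w :: u :: l, _, hs =>
    h z (hs z (by simp)) _ (nestedBracket_mem_of_pair h2 h (l := w :: u :: l) (by simp)
      fun v hv => hs v (List.mem_cons_of_mem _ hv))

/-- All brackets of proportional vectors vanish. Only alternation is used, not the Jacobi identity,
so this covers the deformed brackets without further work. -/
theorem bch_smul_smul {B : E →ₗ[ℝ] E →ₗ[ℝ] E} (hB : ∀ x, B x x = 0) {c : ℕ} (hc : 1 ≤ c)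
    (s t : ℝ) (x : E) : bch B c (s • x) (t • x) = (s + t) • x := by
  have h : bchTail B c (s • x) (t • x) ∈ (⊥ : Submodule ℝ E) := by
    refine bchTail_mem _ _ _ _ _ fun l hl hs => ?_
    refine nestedBracket_mem_of_pair (s := {z | z = s • x ∨ z = t • x}) ?_ ?_ hl hs
    · rintro _ (rfl | rfl) _ (rfl | rfl) <;> simp [hB]
    · intro z _ w hw
      rw [Submodule.mem_bot] at hw
      simp [hw]
  rw [bch_eq_add_bchTail B hc, (Submodule.mem_bot ℝ).1 h, add_zero, add_smul]

end Tail

/-! ### The group law given by the Baker–Campbell–Hausdorff series -/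

section GroupLaw

open IsNilpotent (exp exp_eq_sum exp_mul_exp_neg_self exp_neg_mul_exp_self)

/-- A faithful representation by nilpotent operators of an algebra with bracket `B`. -/
structure IsFaithfulNilRep {E A : Type*} [AddCommGroup E] [Module ℝ E] [Ring A] [Algebra ℝ A]
    (B : E →ₗ[ℝ] E →ₗ[ℝ] E) (c : ℕ) (ρ : E →ₗ[ℝ] A) (S : Submodule ℝ A) (m : ℕ) : Prop where
  injective : Function.Injective ρ
  map_bracket : ∀ x y, ρ (B x y) = commBracket A (ρ x) (ρ y)
  nilpotent : IsNilpotentSpace S (m + 1)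
  mem : ∀ x, ρ x ∈ S
  nested : ∀ l : List E, c < l.length → nestedBracket B l = 0

namespace IsFaithfulNilRep

variable {E A : Type*} [AddCommGroup E] [Module ℝ E] [Ring A] [Algebra ℝ A] [Module ℚ A]
  {B : E →ₗ[ℝ] E →ₗ[ℝ] E} {c : ℕ} {ρ : E →ₗ[ℝ] A} {S : Submodule ℝ A} {m : ℕ}

/-- Dynkin's formula is available for all large truncation orders, and long nested brackets vanish
in `E`, so the order `c` may be raised. The group laws then follow from injectivity of `exp ∘ ρ`. -/
theorem exp_bch (h : IsFaithfulNilRep B c ρ S m) (x y : E) :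
    exp (ρ (bch B c x y)) = exp (ρ x) * exp (ρ y) := by
  obtain ⟨M₀, hM₀⟩ := h.nilpotent.exists_bch_eq_nilLog (h.mem x) (h.mem y)
  rw [bch_eq_bch_of_le B (le_max_left c M₀) h.nested, map_bch ρ h.map_bracket,
    hM₀ _ (le_max_right c M₀), h.nilpotent.exp_nilLog (h.mem x) (h.mem y)]

theorem exp_injective (h : IsFaithfulNilRep B c ρ S m) {x y : E} (hxy : exp (ρ x) = exp (ρ y)) :
    x = y := by
  have key : ∀ z, nilLog (m + 1) (exp (ρ z) - 1) = ρ z := fun z =>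
    nilLog_exp (h.nilpotent.pow_eq_zero (h.mem z))
      (h.nilpotent.pow_eq_zero (h.nilpotent.exp_sub_one_mem (h.mem z)))
  refine h.injective ?_
  rw [← key x, ← key y, hxy]

theorem bch_assoc (h : IsFaithfulNilRep B c ρ S m) (x y z : E) :
    bch B c (bch B c x y) z = bch B c x (bch B c y z) :=
  h.exp_injective (by simp only [h.exp_bch, mul_assoc])

theorem bch_zero (h : IsFaithfulNilRep B c ρ S m) (x : E) : bch B c x 0 = x :=
  h.exp_injective (by simp [h.exp_bch])

theorem zero_bch (h : IsFaithfulNilRep B c ρ S m) (x : E) : bch B c 0 x = x :=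
  h.exp_injective (by simp [h.exp_bch])

theorem bch_neg_self (h : IsFaithfulNilRep B c ρ S m) (x : E) : bch B c x (-x) = 0 :=
  h.exp_injective (by
    rw [h.exp_bch, map_neg, exp_mul_exp_neg_self (h.nilpotent.isNilpotent (h.mem x)), map_zero,
      IsNilpotent.exp_zero])

theorem bch_neg_eq (h : IsFaithfulNilRep B c ρ S m) (x y : E) :
    -(bch B c x y) = bch B c (-y) (-x) := by
  have h1 : bch B c (bch B c (-y) (-x)) (bch B c x y) = 0 := by
    have h2 := h.bch_neg_self (-x)
    have h3 := h.bch_neg_self (-y)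
    rw [neg_neg] at h2 h3
    rw [h.bch_assoc, ← h.bch_assoc (-x), h2, h.zero_bch, h3]
  rw [← h.zero_bch (-(bch B c x y)), ← h1, h.bch_assoc, h.bch_neg_self, h.bch_zero]

theorem bch_smul_smul (h : IsFaithfulNilRep B c ρ S m) (s t : ℝ) (x : E) :
    bch B c (s • x) (t • x) = (s + t) • x :=
  h.exp_injective (by
    rw [h.exp_bch, ← IsNilpotent.exp_add_of_commute, ← map_add, ← add_smul]
    · simp only [map_smul]
      exact ((Commute.refl (ρ x)).smul_left s).smul_right t
    · exact h.nilpotent.isNilpotent (h.mem _)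
    · exact h.nilpotent.isNilpotent (h.mem _))

/-- Conjugation in the group is the exponential of the adjoint action. -/
theorem bch_conj (h : IsFaithfulNilRep B c ρ S m) (a b : E) :
    bch B c (bch B c a b) (-a) =
      ∑ k ∈ Finset.range (c + 1), ((k.factorial : ℝ)⁻¹) • ((B a : Module.End ℝ E) ^ k) b := by
  have ha := h.nilpotent.isNilpotent (h.mem a)
  have hpow : ∀ k, ρ (((B a : Module.End ℝ E) ^ k) b) =
      ((commBracket A (ρ a) : Module.End ℝ A) ^ k) (ρ b) := by
    intro k
    induction k with
    | zero => simp
    | succ k ih =>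
      rw [pow_succ', pow_succ', Module.End.mul_apply, Module.End.mul_apply, h.map_bracket, ih]
  have hvan : ∀ k, c < k + 1 → ((B a : Module.End ℝ E) ^ k) b = 0 := by
    intro k hk
    have := nestedBracket_replicate_append B a k (l := [b]) (by simp)
    rw [h.nested _ (by simpa using hk)] at this
    simpa [nestedBracket] using this.symm
  obtain ⟨M, hM⟩ := isNilpotent_commBracket ha
  have hρ : ρ (∑ k ∈ Finset.range (c + 1), ((k.factorial : ℝ)⁻¹) •
      ((B a : Module.End ℝ E) ^ k) b) = exp (ρ a) * ρ b * exp (-ρ a) := by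
    rw [← exp_commBracket_apply ha,
      exp_eq_sum (k := M + (c + 1)) (pow_eq_zero_of_le (Nat.le_add_right _ _) hM),
      LinearMap.sum_apply, map_sum]
    symm
    rw [← Finset.sum_subset (Finset.range_mono (Nat.le_add_left (c + 1) M))]
    · refine Finset.sum_congr rfl fun k _ => ?_
      rw [← Rat.cast_smul_eq_qsmul ℝ, LinearMap.smul_apply, ← hpow, map_smul]
      simp
    · intro k _ hk
      rw [← Rat.cast_smul_eq_qsmul ℝ, LinearMap.smul_apply, ← hpow,
        hvan k (by simp only [Finset.mem_range] at hk; omega), map_zero, smul_zero]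
  refine h.exp_injective ?_
  rw [h.exp_bch, h.exp_bch, hρ, map_neg]
  obtain ⟨n, hn⟩ := h.nilpotent.isNilpotent (h.mem b)
  have hconj : ∀ k, (exp (ρ a) * ρ b * exp (-ρ a)) ^ k = exp (ρ a) * ρ b ^ k * exp (-ρ a) := by
    intro k
    induction k with
    | zero => simp [exp_mul_exp_neg_self ha]
    | succ k ih =>
      rw [pow_succ, ih]
      calc _ = exp (ρ a) * ρ b ^ k * (exp (-ρ a) * exp (ρ a)) * ρ b * exp (-ρ a) := by
            simp only [mul_assoc]
        _ = _ := by rw [exp_neg_mul_exp_self ha, mul_one, pow_succ]; simp only [mul_assoc]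
  rw [exp_eq_sum hn, exp_eq_sum (a := exp (ρ a) * ρ b * exp (-ρ a)) (k := n)
    (by rw [hconj, hn]; simp), Finset.mul_sum, Finset.sum_mul]
  refine Finset.sum_congr rfl fun k _ => ?_
  rw [hconj, ← Rat.cast_smul_eq_qsmul ℝ, ← Rat.cast_smul_eq_qsmul ℝ, mul_smul_comm, smul_mul_assoc]

end IsFaithfulNilRep

end GroupLaw

theorem submodule_pow_le_of_mul_le {A : Type*} [Ring A] [Algebra ℝ A] (S : ℕ → Submodule ℝ A)
    (h₁ : 1 ≤ S 0) (hm : ∀ k, S k * S 1 ≤ S (k + 1)) (k : ℕ) : S 1 ^ k ≤ S k := by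
  induction k with
  | zero => rwa [pow_zero]
  | succ k ih =>
    rw [pow_succ]
    exact (mul_le_mul' ih le_rfl).trans (hm k)

/-! ### The Carnot group law via a faithful nilpotent representation. -/

namespace LCSSplitting

variable {𝔥 : Type*} [LieRing 𝔥] [LieAlgebra ℝ 𝔥] [LieRing.IsNilpotent 𝔥] (D : LCSSplitting 𝔥)

/-- The derivation of the graded Lie algebra multiplying `V i` by `i`. -/
def degree : 𝔥 →ₗ[ℝ] 𝔥 :=
  ∑ i ∈ Finset.Icc 1 (LieModule.nilpotencyLength 𝔥 𝔥), (i : ℝ) • D.proj i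

theorem degree_apply (x : 𝔥) : D.degree x =
    ∑ i ∈ Finset.Icc 1 (LieModule.nilpotencyLength 𝔥 𝔥), (i : ℝ) • D.proj i x := by
  simp [degree, LinearMap.sum_apply]

theorem proj_degree (i : ℕ) (x : 𝔥) : D.proj i (D.degree x) = (i : ℝ) • D.proj i x := by
  have : D.degree x = ∑ j ∈ Finset.Icc 1 (LieModule.nilpotencyLength 𝔥 𝔥),
      D.proj j ((j : ℝ) • x) := by simp [D.degree_apply]
  rw [this, D.proj_sum_proj]
  split_ifs with h
  · rw [map_smul]
  · rw [Finset.mem_Icc, not_and_or] at h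
    rcases h with h | h
    · rw [show i = 0 by omega, D.proj_zero, smul_zero]
    · rw [D.proj_eq_zero (by omega), smul_zero]

theorem degree_of_mem {i : ℕ} {x : 𝔥} (hx : x ∈ D.V i) : D.degree x = (i : ℝ) • x := by
  refine D.ext_proj fun j => ?_
  rw [proj_degree, map_smul]
  by_cases h : i = j
  · rw [h]
  · rw [D.proj_of_mem_ne h hx, smul_zero, smul_zero]

theorem degree_injective {x : 𝔥} (h : D.degree x = 0) : x = 0 := by
  refine D.ext_proj fun i => ?_
  rw [map_zero]
  rcases Nat.eq_zero_or_pos i with rfl | hi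
  · exact D.proj_zero x
  · have := D.proj_degree i x
    rw [h, map_zero, eq_comm, smul_eq_zero] at this
    exact this.resolve_left (by exact_mod_cast hi.ne')

theorem degree_gradedBracket (x y : 𝔥) : D.degree (D.gradedBracket x y) =
    D.gradedBracket (D.degree x) y + D.gradedBracket x (D.degree y) := by
  refine D.induction_on (p := fun x => D.degree (D.gradedBracket x y) =
    D.gradedBracket (D.degree x) y + D.gradedBracket x (D.degree y)) x ?_ ?_
  swap
  · intro a b ha hb
    simp only [map_add, LinearMap.add_apply, ha, hb]; abel
  intro i x hx
  refine D.induction_on (p := fun y => D.degree (D.gradedBracket x y) =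
    D.gradedBracket (D.degree x) y + D.gradedBracket x (D.degree y)) y ?_ ?_
  swap
  · intro a b ha hb
    simp only [map_add, ha, hb]; abel
  intro j y hy
  rw [D.degree_of_mem (D.gradedBracket_mem hx hy), D.degree_of_mem hx, D.degree_of_mem hy,
    map_smul, map_smul, LinearMap.smul_apply, ← add_smul]
  push_cast
  rfl

/-- The representation of the graded Lie algebra on `𝔥 × ℝ`, the adjoint representation of its
extension by the degree derivation. -/
def rep : 𝔥 →ₗ[ℝ] Module.End ℝ (𝔥 × ℝ) where
  toFun x := (LinearMap.inl ℝ 𝔥 ℝ) ∘ₗ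
    (D.gradedBracket x ∘ₗ LinearMap.fst ℝ 𝔥 ℝ - (LinearMap.snd ℝ 𝔥 ℝ).smulRight (D.degree x))
  map_add' x y := by ext <;> simp; abel
  map_smul' t x := by ext <;> simp

theorem rep_apply (x : 𝔥) (w : 𝔥 × ℝ) :
    D.rep x w = (D.gradedBracket x w.1 - w.2 • D.degree x, 0) := by
  simp [rep]

/-- The filtration of the representation space. -/
def repFil : ℕ → Submodule ℝ (𝔥 × ℝ)
  | 0 => ⊤
  | k + 1 => (D.fil (k + 1)).prod ⊥

theorem repFil_succ_le (k : ℕ) : D.repFil (k + 1) ≤ D.repFil k := by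
  rcases k with _ | k
  · exact le_top
  · exact Submodule.prod_mono (D.fil_anti (Nat.le_succ _)) le_rfl

/-- The operators raising the filtration by `l`. -/
def raising (l : ℕ) : Submodule ℝ (Module.End ℝ (𝔥 × ℝ)) where
  carrier := {T | ∀ k, ∀ w ∈ D.repFil k, T w ∈ D.repFil (k + l)}
  add_mem' h₁ h₂ k w hw := Submodule.add_mem _ (h₁ k w hw) (h₂ k w hw)
  zero_mem' _ _ _ := Submodule.zero_mem _
  smul_mem' t _ h k w hw := Submodule.smul_mem _ t (h k w hw)

theorem raising_mul_le (l l' : ℕ) : D.raising l * D.raising l' ≤ D.raising (l + l') := by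
  rw [Submodule.mul_le]
  intro T hT T' hT' k w hw
  rw [show k + (l + l') = k + l' + l by ring]
  exact hT _ _ (hT' _ _ hw)

theorem raising_one_pow_le (k : ℕ) : D.raising 1 ^ k ≤ D.raising k :=
  submodule_pow_le_of_mul_le D.raising (Submodule.one_le.2 fun _ _ hw => hw)
    (fun k => D.raising_mul_le k 1) k

theorem isNilpotentSpace_raising :
    IsNilpotentSpace (D.raising 1) (LieModule.nilpotencyLength 𝔥 𝔥 + 1) where
  mul_le := (D.raising_mul_le 1 1).trans fun _ hT k w hw => D.repFil_succ_le _ (hT k w hw)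
  pow_eq := by
    rw [eq_bot_iff]
    refine (D.raising_one_pow_le _).trans fun T hT => ?_
    rw [Submodule.mem_bot]
    refine LinearMap.ext fun w => ?_
    have := hT 0 w trivial
    rw [zero_add, repFil, D.fil_eq_bot (Nat.lt_succ_self _)] at this
    simpa using this

theorem isFaithfulNilRep : IsFaithfulNilRep D.gradedBracket (LieModule.nilpotencyLength 𝔥 𝔥)
    D.rep (D.raising 1) (LieModule.nilpotencyLength 𝔥 𝔥) where
  -- The adjoint representation alone can lose the centre. The extra coordinate repairs this: `(0,
  -- 1)` goes to `(-degree x, 0)`, and `degree` is injective because all degrees are positive.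
  injective := by
    rw [injective_iff_map_eq_zero]
    intro x hx
    have := congrArg (fun T : Module.End ℝ (𝔥 × ℝ) => (T (0, 1)).1) hx
    simp only [rep_apply, map_zero, one_smul, zero_sub, LinearMap.zero_apply, Prod.fst_zero,
      neg_eq_zero] at this
    exact D.degree_injective this
  map_bracket x y := by
    refine LinearMap.ext fun w => ?_
    simp only [commBracket_apply, LinearMap.sub_apply, Module.End.mul_apply, rep_apply, map_sub,
      map_smul, zero_smul, sub_zero, Prod.mk_sub_mk]
    rw [D.gradedBracket_leibniz x y, D.degree_gradedBracket, D.gradedBracket_swap (D.degree x) y]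
    congr 1
    rw [smul_add, smul_neg]
    abel
  nilpotent := D.isNilpotentSpace_raising
  mem x := by
    intro k w hw
    rw [rep_apply]
    rcases k with _ | k
    · exact ⟨D.mem_fil_one _, rfl⟩
    · have h2 : w.2 = 0 := hw.2
      rw [h2, zero_smul, sub_zero]
      refine ⟨?_, rfl⟩
      have := D.gradedBracket_mem_fil (D.mem_fil_one x) hw.1
      rwa [add_comm] at this
  nested l hl := by
    rw [← scaledBracket_zero]
    exact D.nestedBracket_eq_zero 0 hl

theorem star_assoc (x y z : 𝔥) : D.star (D.star x y) z = D.star x (D.star y z) := by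
  -- The nilpotent exponential has rational coefficients; the structure is restricted from `ℝ`.
  let : Module ℚ (Module.End ℝ (𝔥 × ℝ)) := Module.compHom _ (algebraMap ℚ ℝ)
  exact D.isFaithfulNilRep.bch_assoc x y z

theorem star_zero (x : 𝔥) : D.star x 0 = x := by
  let : Module ℚ (Module.End ℝ (𝔥 × ℝ)) := Module.compHom _ (algebraMap ℚ ℝ)
  exact D.isFaithfulNilRep.bch_zero x

theorem zero_star (x : 𝔥) : D.star 0 x = x := by
  let : Module ℚ (Module.End ℝ (𝔥 × ℝ)) := Module.compHom _ (algebraMap ℚ ℝ)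
  exact D.isFaithfulNilRep.zero_bch x

theorem star_smul_smul (s t : ℝ) (x : 𝔥) : D.star (s • x) (t • x) = (s + t) • x := by
  let : Module ℚ (Module.End ℝ (𝔥 × ℝ)) := Module.compHom _ (algebraMap ℚ ℝ)
  exact D.isFaithfulNilRep.bch_smul_smul s t x

theorem star_neg_self (x : 𝔥) : D.star x (-x) = 0 := by
  let : Module ℚ (Module.End ℝ (𝔥 × ℝ)) := Module.compHom _ (algebraMap ℚ ℝ)
  exact D.isFaithfulNilRep.bch_neg_self x

theorem neg_star_self (x : 𝔥) : D.star (-x) x = 0 := by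
  simpa using D.star_neg_self (-x)

theorem neg_star (x y : 𝔥) : -(D.star x y) = D.star (-y) (-x) := by
  let : Module ℚ (Module.End ℝ (𝔥 × ℝ)) := Module.compHom _ (algebraMap ℚ ℝ)
  exact D.isFaithfulNilRep.bch_neg_eq x y

theorem star_conj (a b : 𝔥) : D.star (D.star a b) (-a) =
    ∑ k ∈ Finset.range (LieModule.nilpotencyLength 𝔥 𝔥 + 1),
      ((k.factorial : ℝ)⁻¹) • ((D.gradedBracket a : Module.End ℝ 𝔥) ^ k) b := by
  let : Module ℚ (Module.End ℝ (𝔥 × ℝ)) := Module.compHom _ (algebraMap ℚ ℝ)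
  exact D.isFaithfulNilRep.bch_conj a b

theorem dilation_star (s : ℝ) (x y : 𝔥) :
    D.dilation s (D.star x y) = D.star (D.dilation s x) (D.dilation s y) :=
  map_bch (D.dilation s) (D.dilation_gradedBracket s) _ x y

end LCSSplitting

/-! ### Estimates for the Baker–Campbell–Hausdorff product -/

section CoordNorm

variable (E : Type*) [AddCommGroup E] [Module ℝ E] [FiniteDimensional ℝ E]

/-- The `ℓ¹` norm of the coordinates in a basis. -/
def coordNorm : Seminorm ℝ E :=
  ∑ i, (normSeminorm ℝ ℝ).comp ((Module.finBasis ℝ E).coord i)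

variable {E}

theorem coordNorm_apply (x : E) :
    coordNorm E x = ∑ i, |(Module.finBasis ℝ E).coord i x| := by
  have h := map_sum (FunLike.coeAddMonoidHom (Seminorm ℝ E) E ℝ)
    (fun i => (normSeminorm ℝ ℝ).comp ((Module.finBasis ℝ E).coord i)) Finset.univ
  have h' := congrFun h x
  rw [Finset.sum_apply] at h'
  exact h'

theorem abs_coord_le_coordNorm (x : E) (i : Fin (Module.finrank ℝ E)) :
    |(Module.finBasis ℝ E).coord i x| ≤ coordNorm E x := by
  rw [coordNorm_apply]
  exact Finset.single_le_sum (f := fun i => |(Module.finBasis ℝ E).coord i x|)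
    (fun _ _ => abs_nonneg _) (Finset.mem_univ i)

theorem seminorm_sum_le {E : Type*} [AddCommGroup E] [Module ℝ E] (q : Seminorm ℝ E) {κ : Type*}
    (s : Finset κ) (f : κ → E) : q (∑ i ∈ s, f i) ≤ ∑ i ∈ s, q (f i) :=
  Finset.le_sum_of_subadditive q (map_zero q).le (map_add_le_add q) s f

/-- Seminorms on a finite dimensional space are bounded by the coordinate norm. -/
theorem exists_seminorm_le_coordNorm (q : Seminorm ℝ E) :
    ∃ C, 0 ≤ C ∧ ∀ x, q x ≤ C * coordNorm E x := by
  refine ⟨∑ i, q (Module.finBasis ℝ E i), Finset.sum_nonneg fun _ _ => apply_nonneg _ _,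
    fun x => ?_⟩
  conv_lhs => rw [← (Module.finBasis ℝ E).sum_repr x]
  refine (seminorm_sum_le q _ _).trans ?_
  rw [Finset.sum_mul]
  refine Finset.sum_le_sum fun i _ => ?_
  rw [map_smul_eq_mul, mul_comm]
  exact mul_le_mul_of_nonneg_left (abs_coord_le_coordNorm x i) (apply_nonneg _ _)

theorem exists_linearMap_le_coordNorm {F : Type*} [AddCommGroup F] [Module ℝ F]
    (q : Seminorm ℝ F) (f : E →ₗ[ℝ] F) : ∃ C, 0 ≤ C ∧ ∀ x, q (f x) ≤ C * coordNorm E x :=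
  exists_seminorm_le_coordNorm (q.comp f)

theorem exists_bilin_le_coordNorm (B : E →ₗ[ℝ] E →ₗ[ℝ] E) :
    ∃ C, 0 ≤ C ∧ ∀ x y, coordNorm E (B x y) ≤ C * coordNorm E x * coordNorm E y := by
  choose C hC hCB using fun i =>
    exists_linearMap_le_coordNorm (coordNorm E) (B (Module.finBasis ℝ E i))
  refine ⟨∑ i, C i, Finset.sum_nonneg fun i _ => hC i, fun x y => ?_⟩
  have h : B x y = ∑ i, (Module.finBasis ℝ E).repr x i • B (Module.finBasis ℝ E i) y := by
    have h0 := congrArg (fun z => B z y) ((Module.finBasis ℝ E).sum_repr x).symm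
    simpa only [map_sum, LinearMap.sum_apply, map_smul, LinearMap.smul_apply] using h0
  rw [h]
  refine (seminorm_sum_le _ _ _).trans ?_
  rw [Finset.sum_mul, Finset.sum_mul]
  refine Finset.sum_le_sum fun i _ => ?_
  rw [map_smul_eq_mul]
  calc _ ≤ coordNorm E x * (C i * coordNorm E y) :=
        mul_le_mul (abs_coord_le_coordNorm x i) (hCB i y) (apply_nonneg _ _) (apply_nonneg _ _)
    _ = _ := by ring

end CoordNorm

/-! ### Boundedness and Lipschitz estimates for the series. -/

section BCHEstimates

variable {E : Type*} [AddCommGroup E] [Module ℝ E] (q : Seminorm ℝ E)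

theorem nestedBracket_le {B : E →ₗ[ℝ] E →ₗ[ℝ] E} {K R : ℝ} (hK : 1 ≤ K) (hR : 1 ≤ R)
    (hB : ∀ u v, q (B u v) ≤ K * q u * q v) {l : List E} (hl : ∀ z ∈ l, q z ≤ R) :
    q (nestedBracket B l) ≤ (K * R) ^ l.length := by
  have hKR : 1 ≤ K * R := one_le_mul_of_one_le_of_one_le hK hR
  induction l with
  | nil => simp [nestedBracket]
  | cons z l ih =>
    by_cases h : l = []
    · subst h
      simp only [nestedBracket, List.length_singleton, pow_one]
      exact (hl z (by simp)).trans (le_mul_of_one_le_left (by positivity) hK)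
    · rw [nestedBracket_cons B z h, List.length_cons, pow_succ']
      refine (hB _ _).trans ?_
      have h1 := ih fun w hw => hl w (List.mem_cons_of_mem _ hw)
      have h2 := hl z (by simp)
      gcongr

/-- Telescoping: at each level the bracket is exchanged at cost `κ`, the outer entry at cost `e`,
and the inner bracket by induction; every other factor is bounded by a power of `K * R`. -/
theorem nestedBracket_sub_le {B B' : E →ₗ[ℝ] E →ₗ[ℝ] E} {K R κ e : ℝ} (hK : 1 ≤ K) (hR : 1 ≤ R)
    (hκ : 0 ≤ κ) (he : 0 ≤ e)
    (hB : ∀ u v, q (B u v) ≤ K * q u * q v) (hB' : ∀ u v, q (B' u v) ≤ K * q u * q v)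
    (hBB' : ∀ u v, q (B u v - B' u v) ≤ κ * q u * q v) {l l' : List E}
    (hll' : List.Forall₂ (fun z z' => q z ≤ R ∧ q z' ≤ R ∧ q (z - z') ≤ e) l l') :
    q (nestedBracket B l - nestedBracket B' l') ≤ l.length * (K * R) ^ l.length * (e + κ) := by
  have hKR : 1 ≤ K * R := one_le_mul_of_one_le_of_one_le hK hR
  induction hll' with
  | nil => simp [nestedBracket]
  | @cons z z' l l' hz hl ih =>
    obtain ⟨hz1, hz2, hz3⟩ := hz
    by_cases h : l = []
    · subst h
      have : l' = [] := List.forall₂_nil_left_iff.1 hl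
      subst this
      simp only [nestedBracket, List.length_singleton, pow_one, Nat.cast_one, one_mul]
      nlinarith
    · have h' : l' ≠ [] := by
        intro h0; subst h0; exact h (List.forall₂_nil_right_iff.1 hl)
      rw [nestedBracket_cons B z h, nestedBracket_cons B' z' h']
      have hw : q (nestedBracket B l) ≤ (K * R) ^ l.length := by
        refine nestedBracket_le q hK hR hB fun w hw => ?_
        obtain ⟨i, hi, rfl⟩ := List.getElem_of_mem hw
        exact (hl.get hi (hl.length_eq ▸ hi)).1
      set w := nestedBracket B l
      set w' := nestedBracket B' l'
      have key : B z w - B' z' w' = (B z w - B' z w) + (B' (z - z') w + B' z' (w - w')) := by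
        simp only [map_sub, LinearMap.sub_apply]; abel
      rw [key]
      refine (map_add_le_add q _ _).trans ?_
      have h1 := hBB' z w
      have h2 := (map_add_le_add q (B' (z - z') w) (B' z' (w - w'))).trans
        (add_le_add (hB' _ _) (hB' _ _))
      set P := (K * R) ^ l.length with hP
      have hP1 : 1 ≤ P := one_le_pow₀ hKR
      have h3 : κ * q z * q w ≤ (K * R) * P * κ := by
        have : κ * q z * q w ≤ κ * R * P := by gcongr
        have h4 : κ * R * P ≤ κ * (K * R) * P := by
          gcongr
          exact le_mul_of_one_le_left (by positivity) hK
        nlinarith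
      have h4 : K * q (z - z') * q w ≤ (K * R) * P * e := by
        have : K * q (z - z') * q w ≤ K * e * P := by gcongr
        have h4 : K * e * P ≤ (K * R) * e * P := by
          gcongr
          exact le_mul_of_one_le_right (by positivity) hR
        nlinarith
      have h5 : K * q z' * q (w - w') ≤ K * R * (l.length * P * (e + κ)) := by gcongr
      simp only [List.length_cons, Nat.cast_add, Nat.cast_one, pow_succ', ← hP]
      nlinarith

theorem forall₂_bchWord {E F : Type*} {r : E → F → Prop} {x y : E} {x' y' : F} (hx : r x x')
    (hy : r y y') {n : ℕ} (p : Fin n → ℕ × ℕ) :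
    List.Forall₂ r (bchWord p x y) (bchWord p x' y') := by
  have hrep : ∀ {a : E} {b : F} (k : ℕ), r a b →
      List.Forall₂ r (List.replicate k a) (List.replicate k b) := by
    intro a b k h
    induction k with
    | zero => exact List.Forall₂.nil
    | succ k ih => exact List.Forall₂.cons h ih
  induction n with
  | zero => simp [bchWord]
  | succ n ih =>
    rw [← Fin.cons_self_tail p, bchWord_cons, bchWord_cons]
    exact List.rel_append (hrep _ hx) (List.rel_append (hrep _ hy) (ih (Fin.tail p)))

/-- The series `bch` is Lipschitz in the bracket and both arguments on bounded sets. -/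
theorem exists_bch_sub_le (c : ℕ) (K R : ℝ) : ∃ C, 0 ≤ C ∧
    ∀ (B B' : E →ₗ[ℝ] E →ₗ[ℝ] E) (κ e : ℝ) (x y x' y' : E), 0 ≤ κ → 0 ≤ e →
      (∀ u v, q (B u v) ≤ K * q u * q v) → (∀ u v, q (B' u v) ≤ K * q u * q v) →
      (∀ u v, q (B u v - B' u v) ≤ κ * q u * q v) →
      q x ≤ R → q y ≤ R → q x' ≤ R → q y' ≤ R → q (x - x') ≤ e → q (y - y') ≤ e →
      q (bch B c x y - bch B' c x' y') ≤ C * (e + κ) := by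
  set K' := max K 1
  set R' := max R 1
  refine ⟨∑ n ∈ Finset.Icc 1 c, |(-1 : ℝ) ^ (n - 1) / n| *
      ∑ p ∈ Fintype.piFinset fun _ : Fin n => bchExponents c,
        |(((∑ i, ((p i).1 + (p i).2) : ℕ) : ℝ) *
        ((∏ i, (p i).1.factorial * (p i).2.factorial : ℕ) : ℝ))⁻¹| *
        (((∑ i, ((p i).1 + (p i).2) : ℕ) : ℝ) * (K' * R') ^ (∑ i, ((p i).1 + (p i).2))), ?_, ?_⟩
  · have h1 : 0 ≤ K' * R' := mul_nonneg (by positivity) (by positivity)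
    positivity
  intro B B' κ e x y x' y' hκ he hB hB' hBB' hx hy hx' hy' hxx hyy
  rw [bch_eq, bch_eq, ← Finset.sum_sub_distrib, Finset.sum_mul]
  refine (seminorm_sum_le q _ _).trans (Finset.sum_le_sum fun n _ => ?_)
  rw [← smul_sub, map_smul_eq_mul, ← Finset.sum_sub_distrib, Real.norm_eq_abs, mul_assoc]
  refine mul_le_mul_of_nonneg_left ?_ (abs_nonneg _)
  rw [Finset.sum_mul]
  refine (seminorm_sum_le q _ _).trans (Finset.sum_le_sum fun p _ => ?_)
  rw [← smul_sub, map_smul_eq_mul, Real.norm_eq_abs, mul_assoc]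
  refine mul_le_mul_of_nonneg_left ?_ (abs_nonneg _)
  have hKK : ∀ u v, K * q u * q v ≤ K' * q u * q v := fun u v => by
    gcongr; exact le_max_left _ _
  have := nestedBracket_sub_le q (B := B) (B' := B') (K := K') (R := R') (κ := κ) (e := e)
    (le_max_right _ _) (le_max_right _ _) hκ he (fun u v => (hB u v).trans (hKK u v))
    (fun u v => (hB' u v).trans (hKK u v)) hBB'
    (forall₂_bchWord (x := x) (y := y) (x' := x') (y' := y')
      ⟨hx.trans (le_max_left _ _), hx'.trans (le_max_left _ _), hxx⟩
      ⟨hy.trans (le_max_left _ _), hy'.trans (le_max_left _ _), hyy⟩ p)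
  rwa [length_bchWord] at this

theorem bch_zero_zero (B : E →ₗ[ℝ] E →ₗ[ℝ] E) (c : ℕ) : bch B c 0 0 = 0 := by
  simpa using (map_bch (B := B) (B' := B) (0 : E →ₗ[ℝ] E) (by simp) c 0 0).symm

theorem exists_bch_le (c : ℕ) (K R : ℝ) : ∃ C, 0 ≤ C ∧
    ∀ (B : E →ₗ[ℝ] E →ₗ[ℝ] E) (x y : E), (∀ u v, q (B u v) ≤ K * q u * q v) →
      q x ≤ R → q y ≤ R → q (bch B c x y) ≤ C := by
  obtain ⟨C, hC, h⟩ := exists_bch_sub_le q c K R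
  refine ⟨C * (|R| + 0), by positivity, fun B x y hB hx hy => ?_⟩
  have hR : 0 ≤ R := (apply_nonneg q x).trans hx
  have := h B B 0 |R| x y 0 0 le_rfl (abs_nonneg _) hB hB (by simp) hx hy (by simpa) (by simpa)
    (by simpa using hx.trans (le_abs_self R)) (by simpa using hy.trans (le_abs_self R))
  rwa [bch_zero_zero, sub_zero] at this

end BCHEstimates

/-! ### Triangularity of the series with respect to degree, and the rescaled group law. -/

namespace LCSSplitting

variable {𝔥 : Type*} [LieRing 𝔥] [LieAlgebra ℝ 𝔥] [LieRing.IsNilpotent 𝔥] (D : LCSSplitting 𝔥)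

/-- Every bracketing raises degrees by at least one, so changing entries in degree `≥ i` affects a
genuine bracket only in degree `≥ i + 1`. The first half of the conjunction serves the induction,
where the inner list may be a single entry. -/
theorem nestedBracket_sub_mem_fil (t : ℝ) {i : ℕ} {l l' : List 𝔥}
    (h : List.Forall₂ (fun z z' => z - z' ∈ D.fil i) l l') :
    nestedBracket (D.scaledBracket t) l - nestedBracket (D.scaledBracket t) l' ∈ D.fil i ∧
    (2 ≤ l.length →
    nestedBracket (D.scaledBracket t) l - nestedBracket (D.scaledBracket t) l' ∈ D.fil (i + 1)) := by
  induction h with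
  | nil => simp [nestedBracket]
  | @cons z z' l l' hz hl ih =>
    by_cases hl0 : l = []
    · subst hl0
      have : l' = [] := List.forall₂_nil_left_iff.1 hl
      subst this
      exact ⟨hz, fun h => by simp at h⟩
    · have h' : l' ≠ [] := by
        intro h0; subst h0; exact hl0 (List.forall₂_nil_right_iff.1 hl)
      rw [nestedBracket_cons _ z hl0, nestedBracket_cons _ z' h']
      set w := nestedBracket (D.scaledBracket t) l
      set w' := nestedBracket (D.scaledBracket t) l'
      have key : D.scaledBracket t z w - D.scaledBracket t z' w' =
          D.scaledBracket t (z - z') w + D.scaledBracket t z' (w - w') := by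
        simp only [map_sub, LinearMap.sub_apply]; abel
      have hmem : D.scaledBracket t z w - D.scaledBracket t z' w' ∈ D.fil (i + 1) := by
        rw [key]
        refine Submodule.add_mem _ (D.scaledBracket_mem_fil t hz (D.mem_fil_one w)) ?_
        rw [add_comm i 1]
        exact D.scaledBracket_mem_fil t (D.mem_fil_one z') ih.1
      exact ⟨D.fil_anti (Nat.le_succ i) hmem, fun _ => hmem⟩

/-- The component of degree `i` of the terms of degree at least two of `bch x y` depends only on
the components of `x` and `y` of degree less than `i`. -/
theorem bchTail_sub_mem_fil (t : ℝ) {i : ℕ} {x y x' y' : 𝔥} (hx : x - x' ∈ D.fil i)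
    (hy : y - y' ∈ D.fil i) (c : ℕ) :
    bchTail (D.scaledBracket t) c x y - bchTail (D.scaledBracket t) c x' y' ∈ D.fil (i + 1) := by
  rw [bchTail, bchTail, ← Finset.sum_sub_distrib]
  refine Submodule.sum_mem _ fun n _ => ?_
  rw [← smul_sub, ← Finset.sum_sub_distrib]
  refine Submodule.smul_mem _ _ (Submodule.sum_mem _ fun p _ => ?_)
  rw [← smul_sub]
  refine Submodule.smul_mem _ _ ?_
  have h := D.nestedBracket_sub_mem_fil t (forall₂_bchWord (r := fun z z' => z - z' ∈ D.fil i)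
    hx hy p)
  have hlen : (bchWord p x' y').length = (bchWord p x y).length := by
    rw [length_bchWord, length_bchWord]
  rw [hlen]
  split_ifs with hl
  · exact h.2 hl
  · simp

/-- The components of degree less than `i`. -/
def trunc (i : ℕ) : 𝔥 →ₗ[ℝ] 𝔥 := ∑ j ∈ Finset.range i, D.proj j

theorem trunc_apply (i : ℕ) (x : 𝔥) : D.trunc i x = ∑ j ∈ Finset.range i, D.proj j x := by
  simp [trunc, LinearMap.sum_apply]

theorem sub_trunc_mem_fil (i : ℕ) (x : 𝔥) : x - D.trunc i x ∈ D.fil i := by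
  rw [mem_fil]
  intro j hj
  rw [map_sub, trunc_apply, D.proj_sum_proj (Finset.range i) j (fun _ => x),
    if_pos (Finset.mem_range.2 hj), sub_self]

theorem proj_bchTail_trunc (t : ℝ) (i : ℕ) (x y : 𝔥) (c : ℕ) :
    D.proj i (bchTail (D.scaledBracket t) c x y) =
      D.proj i (bchTail (D.scaledBracket t) c (D.trunc i x) (D.trunc i y)) := by
  have h := D.mem_fil.1 (D.bchTail_sub_mem_fil t (D.sub_trunc_mem_fil i x)
    (D.sub_trunc_mem_fil i y) c) i (Nat.lt_succ_self i)
  rwa [map_sub, sub_eq_zero] at h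

theorem bchTail_mem_fil_two (t : ℝ) (x y : 𝔥) (c : ℕ) :
    bchTail (D.scaledBracket t) c x y ∈ D.fil 2 :=
  bchTail_mem _ _ _ _ _ fun _ hl _ => D.fil_anti hl (D.nestedBracket_mem_fil t)

theorem scaledBracket_one : D.scaledBracket 1 =
    (LieModule.toEnd ℝ 𝔥 𝔥 : 𝔥 →ₗ[ℝ] 𝔥 →ₗ[ℝ] 𝔥) := by
  refine LinearMap.ext₂ fun x y => ?_
  have := D.dilation_scaledBracket (one_mul (1 : ℝ)) x y
  simpa [D.dilation_one] using this

theorem dilation_bch {s t : ℝ} (hst : s * t = 1) (x y : 𝔥) :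
    D.dilation s (bch (D.scaledBracket t) (LieModule.nilpotencyLength 𝔥 𝔥) x y) =
      lieMul (D.dilation s x) (D.dilation s y) :=
  map_bch (D.dilation s) (D.dilation_scaledBracket hst) _ x y

/-- The origin of `⋆`: in coordinates dilated by `t = 1/N` the product of `H` becomes the series of
`scaledBracket t`, which tends to the graded bracket as `t → 0`. -/
theorem dilation_lieMul {s t : ℝ} (hst : s * t = 1) (x y : 𝔥) :
    D.dilation t (lieMul x y) = bch (D.scaledBracket t) (LieModule.nilpotencyLength 𝔥 𝔥)
      (D.dilation t x) (D.dilation t y) := by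
  have h : ∀ z, D.dilation s (D.dilation t z) = z := fun z => by
    rw [D.dilation_dilation, hst, D.dilation_one]
  have := D.dilation_bch hst (D.dilation t x) (D.dilation t y)
  rw [h, h] at this
  rw [← this, D.dilation_dilation, mul_comm, hst, D.dilation_one]

/-- Brackets have no component of degree one. Hence the abelian coordinates of `α` form additive
real cocycles. -/
theorem proj_lieMul_one (x y : 𝔥) : D.proj 1 (lieMul x y) = D.proj 1 x + D.proj 1 y := by
  rcases Nat.eq_zero_or_pos (LieModule.nilpotencyLength 𝔥 𝔥) with h | h
  · have : ∀ z : 𝔥, D.proj 1 z = 0 := fun z => D.proj_eq_zero (by omega) z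
    simp [this]
  · rw [lieMul, ← D.scaledBracket_one, bch_eq_add_bchTail _ h, map_add, map_add,
      D.mem_fil.1 (D.bchTail_mem_fil_two 1 x y _) 1 (by norm_num), add_zero]

/-- An element commutes with itself, so its square is `2 x`. This gives `ι 1 = 0` without
establishing the group laws of `lieMul`. -/
theorem eq_zero_of_lieMul_self (D : LCSSplitting 𝔥) {x : 𝔥} (h : lieMul x x = x) : x = 0 := by
  rcases Nat.eq_zero_or_pos (LieModule.nilpotencyLength 𝔥 𝔥) with h0 | h0
  · rw [← D.sum_proj x, h0]; simp
  · have h1 := bch_smul_smul (B := D.scaledBracket 1) (D.scaledBracket_self 1) h0 1 1 x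
    rw [one_smul, D.scaledBracket_one] at h1
    rw [lieMul, h1, add_smul, one_smul] at h
    simpa using h

variable [FiniteDimensional ℝ 𝔥]

/-- For `0 ≤ t ≤ 1` each coefficient `t ^ (k - i - j)` is at most `1`, and differs from its value at
`t = 0` by at most `t`. -/
theorem exists_scaledBracket_le : ∃ K, 0 ≤ K ∧ ∀ t, 0 ≤ t → t ≤ 1 → ∀ x y : 𝔥,
    coordNorm 𝔥 (D.scaledBracket t x y) ≤ K * coordNorm 𝔥 x * coordNorm 𝔥 y ∧
    coordNorm 𝔥 (D.scaledBracket t x y - D.scaledBracket 0 x y) ≤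
      K * t * coordNorm 𝔥 x * coordNorm 𝔥 y := by
  choose C hC hCB using fun i j k : ℕ => exists_bilin_le_coordNorm
    (((LieModule.toEnd ℝ 𝔥 𝔥 : 𝔥 →ₗ[ℝ] 𝔥 →ₗ[ℝ] 𝔥).compl₁₂ (D.proj i) (D.proj j)).compr₂ (D.proj k))
  replace hCB : ∀ i j k x y, coordNorm 𝔥 (D.proj k ⁅D.proj i x, D.proj j y⁆) ≤
    C i j k * coordNorm 𝔥 x * coordNorm 𝔥 y := hCB
  set I := Finset.Icc 1 (LieModule.nilpotencyLength 𝔥 𝔥)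
  refine ⟨∑ i ∈ I, ∑ j ∈ I, ∑ k ∈ I, C i j k, Finset.sum_nonneg fun i _ =>
    Finset.sum_nonneg fun j _ => Finset.sum_nonneg fun k _ => hC i j k, fun t ht ht1 x y => ?_⟩
  constructor
  · rw [scaledBracket_apply, Finset.sum_mul, Finset.sum_mul]
    refine (seminorm_sum_le _ _ _).trans (Finset.sum_le_sum fun i _ => ?_)
    rw [Finset.sum_mul, Finset.sum_mul]
    refine (seminorm_sum_le _ _ _).trans (Finset.sum_le_sum fun j _ => ?_)
    rw [Finset.sum_mul, Finset.sum_mul]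
    refine (seminorm_sum_le _ _ _).trans (Finset.sum_le_sum fun k _ => ?_)
    rw [map_smul_eq_mul, Real.norm_eq_abs]
    refine le_trans ?_ (hCB i j k x y)
    refine mul_le_of_le_one_left (apply_nonneg _ _) ?_
    split_ifs
    · rw [abs_of_nonneg (by positivity)]; exact pow_le_one₀ ht ht1
    · simp
  · rw [scaledBracket_apply, scaledBracket_apply, Finset.sum_mul, Finset.sum_mul, Finset.sum_mul,
      ← Finset.sum_sub_distrib]
    refine (seminorm_sum_le _ _ _).trans (Finset.sum_le_sum fun i _ => ?_)
    rw [Finset.sum_mul, Finset.sum_mul, Finset.sum_mul, ← Finset.sum_sub_distrib]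
    refine (seminorm_sum_le _ _ _).trans (Finset.sum_le_sum fun j _ => ?_)
    rw [Finset.sum_mul, Finset.sum_mul, Finset.sum_mul, ← Finset.sum_sub_distrib]
    refine (seminorm_sum_le _ _ _).trans (Finset.sum_le_sum fun k _ => ?_)
    rw [← sub_smul, map_smul_eq_mul, Real.norm_eq_abs]
    have h1 : |(if i + j ≤ k then t ^ (k - (i + j)) else 0) -
        (if i + j ≤ k then (0 : ℝ) ^ (k - (i + j)) else 0)| ≤ t := by
      split_ifs with h
      · obtain ⟨m, rfl⟩ := Nat.exists_eq_add_of_le h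
        rw [Nat.add_sub_cancel_left]
        rcases m with _ | m
        · simpa using ht
        · rw [zero_pow (by omega), sub_zero, abs_of_nonneg (by positivity), pow_succ]
          exact mul_le_of_le_one_left ht (pow_le_one₀ ht ht1)
      · simpa using ht
    calc _ ≤ t * (C i j k * coordNorm 𝔥 x * coordNorm 𝔥 y) :=
          mul_le_mul h1 (hCB i j k x y) (apply_nonneg _ _) ht
      _ = _ := by ring

end LCSSplitting

/-! ### Growth of the components along words -/

theorem exists_list_length_eq_wordNorm {G : Type*} [Group G] {T : Set G}
    (hT : Subgroup.closure T = ⊤) (g : G) :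
    ∃ l : List G, l.length = wordNorm T g ∧ (∀ t ∈ l, t ∈ T ∨ t⁻¹ ∈ T) ∧ l.prod = g := by
  have hne : {n : ℕ | ∃ l : List G, l.length = n ∧ (∀ t ∈ l, t ∈ T ∨ t⁻¹ ∈ T) ∧
      l.prod = g}.Nonempty := by
    have hg : g ∈ (Subgroup.closure T).toSubmonoid := hT ▸ Subgroup.mem_top g
    rw [Subgroup.closure_toSubmonoid] at hg
    obtain ⟨l, hl, hg⟩ := Submonoid.exists_list_of_mem_closure hg
    exact ⟨l.length, l, rfl, fun t ht => by simpa using hl t ht, hg⟩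
  exact Nat.sInf_mem hne

theorem wordNorm_one {G : Type*} [Group G] (T : Set G) : wordNorm T (1 : G) = 0 :=
  Nat.sInf_eq_zero.2 (Or.inl ⟨[], by simp⟩)

theorem wordNorm_mul_le {G : Type*} [Group G] {T : Set G} (hT : Subgroup.closure T = ⊤)
    (g h : G) : wordNorm T (g * h) ≤ wordNorm T g + wordNorm T h := by
  obtain ⟨l, hl, hlT, rfl⟩ := exists_list_length_eq_wordNorm hT g
  obtain ⟨l', hl', hlT', rfl⟩ := exists_list_length_eq_wordNorm hT h
  refine Nat.sInf_le ⟨l ++ l', by rw [List.length_append, hl, hl'], fun t ht => ?_, by simp⟩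
  rcases List.mem_append.1 ht with h | h
  exacts [hlT t h, hlT' t h]

/-! ### Polynomial growth of the components in the word norm. -/

namespace LCSSplitting

variable {𝔥 : Type*} [LieRing 𝔥] [LieAlgebra ℝ 𝔥] [LieRing.IsNilpotent 𝔥] (D : LCSSplitting 𝔥)

/-- In each degree the product is the sum of the components plus a correction depending only on
lower degrees. This is the basis of the inductions on degree. -/
theorem proj_bch (t : ℝ) (hr : 1 ≤ LieModule.nilpotencyLength 𝔥 𝔥) (i : ℕ) (x y : 𝔥) :
    D.proj i (bch (D.scaledBracket t) (LieModule.nilpotencyLength 𝔥 𝔥) x y) =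
      D.proj i x + D.proj i y + D.proj i (bchTail (D.scaledBracket t)
        (LieModule.nilpotencyLength 𝔥 𝔥) (D.trunc i x) (D.trunc i y)) := by
  rw [bch_eq_add_bchTail _ hr, map_add, map_add, D.proj_bchTail_trunc]

variable [FiniteDimensional ℝ 𝔥]

theorem exists_proj_le (i : ℕ) :
    ∃ C, 0 ≤ C ∧ ∀ x, coordNorm 𝔥 (D.proj i x) ≤ C * coordNorm 𝔥 x :=
  exists_linearMap_le_coordNorm _ _

theorem exists_bchTail_sub_le (hr : 1 ≤ LieModule.nilpotencyLength 𝔥 𝔥) (R : ℝ) :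
    ∃ C, 0 ≤ C ∧ ∀ t : ℝ, 0 ≤ t → t ≤ 1 → ∀ (x y x' y' : 𝔥) (e : ℝ), 0 ≤ e →
      coordNorm 𝔥 x ≤ R → coordNorm 𝔥 y ≤ R → coordNorm 𝔥 x' ≤ R → coordNorm 𝔥 y' ≤ R →
      coordNorm 𝔥 (x - x') ≤ e → coordNorm 𝔥 (y - y') ≤ e →
      coordNorm 𝔥 (bchTail (D.scaledBracket t) (LieModule.nilpotencyLength 𝔥 𝔥) x y -
        bchTail (D.scaledBracket t) (LieModule.nilpotencyLength 𝔥 𝔥) x' y') ≤ C * e := by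
  obtain ⟨K, hK, hKB⟩ := D.exists_scaledBracket_le
  obtain ⟨C, hC, h⟩ := exists_bch_sub_le (coordNorm 𝔥) (LieModule.nilpotencyLength 𝔥 𝔥) K R
  refine ⟨C + 2, by positivity, fun t ht ht1 x y x' y' e he hx hy hx' hy' hxx hyy => ?_⟩
  have hB := fun u v => (hKB t ht ht1 u v).1
  have h1 := h _ _ 0 e x y x' y' le_rfl he hB hB (by simp) hx hy hx' hy' hxx hyy
  rw [bch_eq_add_bchTail _ hr, bch_eq_add_bchTail _ hr] at h1
  set a := bchTail (D.scaledBracket t) (LieModule.nilpotencyLength 𝔥 𝔥) x y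
  set b := bchTail (D.scaledBracket t) (LieModule.nilpotencyLength 𝔥 𝔥) x' y'
  have key : a - b = (x + y + a - (x' + y' + b)) - ((x - x') + (y - y')) := by abel
  rw [key]
  have h2 := map_sub_le_add (coordNorm 𝔥) (x + y + a - (x' + y' + b)) ((x - x') + (y - y'))
  have h3 := map_add_le_add (coordNorm 𝔥) (x - x') (y - y')
  linarith

theorem bchTail_smul_smul (hr : 1 ≤ LieModule.nilpotencyLength 𝔥 𝔥) (t a b : ℝ) (v : 𝔥) :
    bchTail (D.scaledBracket t) (LieModule.nilpotencyLength 𝔥 𝔥) (a • v) (b • v) = 0 := by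
  have h := bch_smul_smul (B := D.scaledBracket t) (D.scaledBracket_self t) hr a b v
  rw [bch_eq_add_bchTail _ hr, add_smul] at h
  simpa using h

theorem exists_bchTail_le (hr : 1 ≤ LieModule.nilpotencyLength 𝔥 𝔥) (R : ℝ) :
    ∃ C, 0 ≤ C ∧ ∀ t : ℝ, 0 ≤ t → t ≤ 1 → ∀ x y : 𝔥, coordNorm 𝔥 x ≤ R → coordNorm 𝔥 y ≤ R →
      coordNorm 𝔥 (bchTail (D.scaledBracket t) (LieModule.nilpotencyLength 𝔥 𝔥) x y) ≤ C := by
  obtain ⟨C, hC, h⟩ := D.exists_bchTail_sub_le hr R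
  refine ⟨C * |R|, by positivity, fun t ht ht1 x y hx hy => ?_⟩
  have hR : 0 ≤ R := (apply_nonneg _ x).trans hx
  have h0 := D.bchTail_smul_smul hr t 0 0 (0 : 𝔥)
  have := h t ht ht1 x y 0 0 |R| (abs_nonneg _) hx hy (by simpa) (by simpa)
    (by simpa using hx.trans (le_abs_self R)) (by simpa using hy.trans (le_abs_self R))
  rw [smul_zero] at h0
  rwa [h0, sub_zero] at this

theorem coordNorm_trunc_le (i : ℕ) (x : 𝔥) :
    coordNorm 𝔥 (D.trunc i x) ≤ ∑ j ∈ Finset.range i, coordNorm 𝔥 (D.proj j x) := by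
  rw [trunc_apply]; exact seminorm_sum_le _ _ _

theorem coordNorm_proj_dilation (i : ℕ) {t : ℝ} (ht : 0 ≤ t) (x : 𝔥) :
    coordNorm 𝔥 (D.proj i (D.dilation t x)) = t ^ i * coordNorm 𝔥 (D.proj i x) := by
  rw [proj_dilation, map_smul_eq_mul, Real.norm_eq_abs, abs_of_nonneg (by positivity)]

variable {Λ : Type*} [Group Λ] {ι : Λ → 𝔥}

theorem map_one_eq_zero (D : LCSSplitting 𝔥)
    (hι : ∀ a b, ι (a * b) = lieMul (ι a) (ι b)) : ι 1 = 0 :=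
  D.eq_zero_of_lieMul_self (by rw [← hι, one_mul])

/-- Doubling: cut a word of length at most `2^(k+1)` in two and rescale by `2^(k+1)`. Each half
contributes at most `C / 2^i`, and the correction is bounded because lower degrees are controlled by
induction. For `i ≥ 2` the halves use up at most `C / 2`, leaving room for the correction; for `i =
1` there is no room, but also no correction. -/
theorem exists_proj_list_le (hι : ∀ a b, ι (a * b) = lieMul (ι a) (ι b))
    {T : Set Λ} (hT : T.Finite) (i : ℕ) : ∃ C, 0 ≤ C ∧ ∀ (k : ℕ)
    (l : List Λ), l.length ≤ 2 ^ k → (∀ t ∈ l, t ∈ T ∨ t⁻¹ ∈ T) →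
      coordNorm 𝔥 (D.proj i (ι l.prod)) ≤ C * ((2 : ℝ) ^ k) ^ i := by
  induction i using Nat.strong_induction_on with
  | _ i ih =>
  by_cases hi : i = 0
  · subst hi
    exact ⟨0, le_rfl, fun k l _ _ => by rw [D.proj_zero]; simp⟩
  by_cases hir : LieModule.nilpotencyLength 𝔥 𝔥 < i
  · exact ⟨0, le_rfl, fun k l _ _ => by rw [D.proj_eq_zero hir]; simp⟩
  have hr : 1 ≤ LieModule.nilpotencyLength 𝔥 𝔥 := by omega
  have ih' : ∀ j, ∃ C, 0 ≤ C ∧ (j < i → ∀ (k : ℕ)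
    (l : List Λ), l.length ≤ 2 ^ k → (∀ t ∈ l, t ∈ T ∨ t⁻¹ ∈ T) →
      coordNorm 𝔥 (D.proj j (ι l.prod)) ≤ C * ((2 : ℝ) ^ k) ^ j) := by
    intro j
    by_cases hj : j < i
    · obtain ⟨C, hC, h⟩ := ih j hj
      exact ⟨C, hC, fun _ => h⟩
    · exact ⟨0, le_rfl, fun h => absurd h hj⟩
  choose Cj hCj hCjb using ih'
  obtain ⟨P, hP, hPb⟩ := D.exists_proj_le i
  obtain ⟨A, hA, hAb⟩ := D.exists_bchTail_le hr (∑ j ∈ Finset.range i, Cj j)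
  obtain ⟨M, hM⟩ : ∃ M, ∀ t ∈ T ∪ T⁻¹, coordNorm 𝔥 (D.proj i (ι t)) ≤ M := by
    obtain ⟨M, hM⟩ := ((hT.union hT.inv).image fun t => coordNorm 𝔥 (D.proj i (ι t))).bddAbove
    exact ⟨M, fun t ht => hM ⟨t, ht, rfl⟩⟩
  -- `M` serves words of length at most one, and `2 * (P * A)` makes the correction `P * A` at most
  -- `C / 2`.
  refine ⟨max M 0 + 2 * (P * A), by positivity, fun k => ?_⟩
  set C := max M 0 + 2 * (P * A) with hCdef
  have hC0 : 0 ≤ C := by positivity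
  induction k with
  | zero =>
    intro l hl hlT
    simp only [pow_zero, one_pow, mul_one]
    rw [pow_zero] at hl
    match l, hl, hlT with
    | [], _, _ => rw [List.prod_nil, D.map_one_eq_zero hι]; simpa using hC0
    | [t], _, hlT =>
      rw [List.prod_singleton]
      refine (hM t ?_).trans ((le_max_left _ _).trans (le_add_of_nonneg_right (by positivity)))
      simpa using hlT t (by simp)
  | succ k ihk =>
    intro l hl hlT
    have hl1 : (l.take (2 ^ k)).length ≤ 2 ^ k := List.length_take_le _ _
    have hl2 : (l.drop (2 ^ k)).length ≤ 2 ^ k := by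
      rw [List.length_drop]; rw [pow_succ] at hl; omega
    have hT1 : ∀ t ∈ l.take (2 ^ k), t ∈ T ∨ t⁻¹ ∈ T := fun t ht => hlT t (List.mem_of_mem_take ht)
    have hT2 : ∀ t ∈ l.drop (2 ^ k), t ∈ T ∨ t⁻¹ ∈ T := fun t ht => hlT t (List.mem_of_mem_drop ht)
    have hprod : ι l.prod = lieMul (ι (l.take (2 ^ k)).prod) (ι (l.drop (2 ^ k)).prod) := by
      rw [← hι, List.prod_take_mul_prod_drop]
    set x := ι (l.take (2 ^ k)).prod
    set y := ι (l.drop (2 ^ k)).prod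
    set s : ℝ := 2 ^ (k + 1)
    have hs : 0 < s := by positivity
    have hs1 : s⁻¹ ≤ 1 := inv_le_one_of_one_le₀ (one_le_pow₀ (by norm_num))
    have hsk : (2 : ℝ) ^ k * s⁻¹ = 2⁻¹ := by
      simp only [s, pow_succ]; field_simp
    have bd : ∀ (j : ℕ) (z : 𝔥) (c : ℝ), 0 ≤ c → coordNorm 𝔥 (D.proj j z) ≤ c * ((2 : ℝ) ^ k) ^ j →
        coordNorm 𝔥 (D.proj j (D.dilation s⁻¹ z)) ≤ c * 2⁻¹ ^ j := by
      intro j z c hc h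
      rw [D.coordNorm_proj_dilation j (by positivity)]
      calc _ ≤ s⁻¹ ^ j * (c * ((2 : ℝ) ^ k) ^ j) := by gcongr
        _ = c * ((2 : ℝ) ^ k * s⁻¹) ^ j := by rw [mul_pow]; ring
        _ = _ := by rw [hsk]
    have bd' : ∀ l' : List Λ, l'.length ≤ 2 ^ k → (∀ t ∈ l', t ∈ T ∨ t⁻¹ ∈ T) →
        coordNorm 𝔥 (D.trunc i (D.dilation s⁻¹ (ι l'.prod))) ≤ ∑ j ∈ Finset.range i, Cj j := by
      intro l' hl' hlT'
      refine (D.coordNorm_trunc_le i _).trans (Finset.sum_le_sum fun j hj => ?_)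
      refine (bd j _ _ (hCj j) (hCjb j (Finset.mem_range.1 hj) k l' hl' hlT')).trans ?_
      exact mul_le_of_le_one_right (hCj j) (pow_le_one₀ (by norm_num) (by norm_num))
    have key := D.proj_bch s⁻¹ hr i (D.dilation s⁻¹ x) (D.dilation s⁻¹ y)
    rw [← D.dilation_lieMul (mul_inv_cancel₀ hs.ne'), ← hprod] at key
    have hx := bd i x C hC0 (ihk _ hl1 hT1)
    have hy := bd i y C hC0 (ihk _ hl2 hT2)
    set tl := D.proj i (bchTail (D.scaledBracket s⁻¹) (LieModule.nilpotencyLength 𝔥 𝔥)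
      (D.trunc i (D.dilation s⁻¹ x)) (D.trunc i (D.dilation s⁻¹ y))) with htl
    have hfin : coordNorm 𝔥 (D.proj i (D.dilation s⁻¹ (ι l.prod))) ≤ C := by
      rw [key]
      refine (map_add_le_add _ _ _).trans ?_
      have h1 := map_add_le_add (coordNorm 𝔥) (D.proj i (D.dilation s⁻¹ x))
        (D.proj i (D.dilation s⁻¹ y))
      by_cases hi1 : i = 1
      · have : tl = 0 := by
          rw [htl, hi1]
          exact D.mem_fil.1 (D.bchTail_mem_fil_two _ _ _ _) 1 (by norm_num)
        rw [this, map_zero]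
        rw [hi1, pow_one] at hx hy
        rw [hi1] at h1 ⊢
        linarith
      · have h2 : coordNorm 𝔥 tl ≤ P * A := by
          refine (hPb _).trans (mul_le_mul_of_nonneg_left ?_ hP)
          exact hAb s⁻¹ (by positivity) hs1 _ _ (bd' _ hl1 hT1) (bd' _ hl2 hT2)
        have h3 : (2 : ℝ)⁻¹ ^ i ≤ 2⁻¹ ^ 2 := pow_le_pow_of_le_one (by norm_num) (by norm_num)
          (by omega)
        have h4 : C * 2⁻¹ ^ i ≤ C * (1 / 4) := by
          gcongr; exact h3.trans (by norm_num)
        have h5 : 0 ≤ max M 0 := le_max_right _ _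
        linarith
    rw [D.coordNorm_proj_dilation i (by positivity)] at hfin
    rw [inv_pow, inv_mul_le_iff₀ (by positivity)] at hfin
    linarith

/-- The component of degree `i` grows at most like the `i`-th power of the word norm. -/
theorem exists_proj_le_wordNorm (hι : ∀ a b, ι (a * b) = lieMul (ι a) (ι b))
    {T : Set Λ} (hT : T.Finite) (hgen : Subgroup.closure T = ⊤)
    (i : ℕ) : ∃ C, 0 ≤ C ∧ ∀ g : Λ,
      coordNorm 𝔥 (D.proj i (ι g)) ≤ C * (wordNorm T g : ℝ) ^ i := by
  obtain ⟨C, hC, h⟩ := D.exists_proj_list_le hι hT i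
  refine ⟨C * 2 ^ i, by positivity, fun g => ?_⟩
  obtain ⟨l, hl, hlT, rfl⟩ := exists_list_length_eq_wordNorm hgen g
  rw [← hl]
  -- For the empty word the comparison `2 ^ clog ≤ 2 * length` would fail, but then the component is
  -- zero.
  by_cases h0 : l.length = 0
  · rw [List.length_eq_zero_iff.1 h0, List.prod_nil, D.map_one_eq_zero hι, map_zero, map_zero]
    positivity
  refine (h (Nat.clog 2 l.length) l (Nat.le_pow_clog (by norm_num) _) hlT).trans ?_
  rw [mul_assoc, ← mul_pow]
  gcongr
  have h2 : 2 ^ Nat.clog 2 l.length ≤ 2 * l.length := by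
    by_cases h1 : l.length = 1
    · simp [h1]
    have := Nat.pow_pred_clog_lt_self (b := 2) (by norm_num) (x := l.length) (by omega)
    have hpos : 0 < Nat.clog 2 l.length := Nat.clog_pos (by norm_num) (by omega)
    obtain ⟨m, hm⟩ := Nat.exists_eq_succ_of_ne_zero hpos.ne'
    rw [hm] at this ⊢
    simp only [Nat.pred_eq_sub_one, Nat.succ_eq_add_one, Nat.add_sub_cancel] at this
    rw [Nat.succ_eq_add_one, pow_succ]
    omega
  exact_mod_cast h2

end LCSSplitting

/-! ### Short products of horizontal vectors -/

namespace LCSSplitting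

variable {𝔥 : Type*} [LieRing 𝔥] [LieAlgebra ℝ 𝔥] [LieRing.IsNilpotent 𝔥] (D : LCSSplitting 𝔥)

/-- The product of a list of elements of `V 1` in the Carnot group. -/
def starProd (l : List (D.V 1)) : 𝔥 := l.foldr (fun v x => D.star v x) 0

theorem starProd_nil : D.starProd [] = 0 := rfl

theorem starProd_cons (v : D.V 1) (l : List (D.V 1)) :
    D.starProd (v :: l) = D.star v (D.starProd l) := rfl

theorem starProd_singleton (v : D.V 1) : D.starProd [v] = v := by
  rw [starProd_cons, starProd_nil, D.star_zero]

theorem starProd_append (l l' : List (D.V 1)) :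
    D.starProd (l ++ l') = D.star (D.starProd l) (D.starProd l') := by
  induction l with
  | nil => rw [List.nil_append, starProd_nil, D.zero_star]
  | cons v l ih => rw [List.cons_append, starProd_cons, ih, starProd_cons, D.star_assoc]

theorem starProd_reverse_neg (l : List (D.V 1)) :
    D.starProd (l.map (- ·)).reverse = -D.starProd l := by
  induction l with
  | nil => simp [starProd_nil]
  | cons v l ih =>
    rw [List.map_cons, List.reverse_cons, starProd_append, ih, starProd_singleton, starProd_cons,
      D.neg_star]
    rfl

theorem sum_map_reverse_neg (N : Seminorm ℝ (D.V 1)) (l : List (D.V 1)) :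
    ((l.map (- ·)).reverse.map N).sum = (l.map N).sum := by
  rw [List.map_reverse, List.sum_reverse, List.map_map]
  congr 1
  exact List.map_congr_left fun v _ => map_neg_eq_map N v

theorem dilation_starProd (t : ℝ) (l : List (D.V 1)) :
    D.dilation t (D.starProd l) = D.starProd (l.map (t • ·)) := by
  induction l with
  | nil => simp [starProd_nil]
  | cons v l ih =>
    rw [starProd_cons, D.dilation_star, ih, List.map_cons, starProd_cons,
      D.dilation_of_mem_V_one t v.2]
    rfl

theorem star_sub_mem_fil {i : ℕ} (hi : 1 ≤ i) {x y : 𝔥} (hx : x ∈ D.fil i) (hy : y ∈ D.fil i) :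
    D.star x y - (x + y) ∈ D.fil (i + 1) := by
  rcases Nat.eq_zero_or_pos (LieModule.nilpotencyLength 𝔥 𝔥) with h | h
  · have h1 := D.mem_fil_one (D.star x y - (x + y))
    rw [D.fil_eq_bot (by omega), Submodule.mem_bot] at h1
    rw [h1]; exact zero_mem _
  · rw [star, bch_eq_add_bchTail _ h, add_sub_cancel_left]
    refine bchTail_mem _ _ _ _ _ fun l hl hs => ?_
    refine nestedBracket_mem_of_pair (s := (D.fil i : Set 𝔥)) ?_ ?_ hl ?_
    · intro z hz w hw
      exact D.fil_anti (by omega) (D.gradedBracket_mem_fil hz hw)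
    · intro z _ w hw
      have := D.gradedBracket_mem_fil (D.mem_fil_one z) hw
      exact D.fil_anti (by omega) this
    · intro z hz
      rcases hs z hz with rfl | rfl
      exacts [hx, hy]

theorem pow_gradedBracket_mem_fil (a : 𝔥) {i : ℕ} {b : 𝔥} (hb : b ∈ D.fil i) (k : ℕ) :
    (D.gradedBracket a ^ k) b ∈ D.fil (i + k) := by
  induction k with
  | zero => simpa using hb
  | succ k ih =>
    rw [pow_succ', Module.End.mul_apply]
    exact D.fil_anti (by omega) (D.gradedBracket_mem_fil (D.mem_fil_one a) ih)

theorem star_conj_sub_mem_fil (a : 𝔥) {i : ℕ} {b : 𝔥} (hb : b ∈ D.fil i) :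
    D.star (D.star a b) (-a) - (b + D.gradedBracket a b) ∈ D.fil (i + 2) := by
  rw [D.star_conj]
  rcases Nat.eq_zero_or_pos (LieModule.nilpotencyLength 𝔥 𝔥) with h | h
  · have h1 : ∀ z : 𝔥, z = 0 := fun z => by
      have h1 := D.mem_fil_one z
      rwa [D.fil_eq_bot (by omega), Submodule.mem_bot] at h1
    rw [h1 (_ - _)]; exact zero_mem _
  obtain ⟨r, hr⟩ := Nat.exists_eq_add_of_le' h
  rw [hr, Finset.sum_range_succ', Finset.sum_range_succ']
  simp only [zero_add, Nat.factorial_one, Nat.cast_one, inv_one, pow_one, one_smul,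
    Nat.factorial_zero, pow_zero, Module.End.one_apply]
  rw [add_assoc, add_comm (D.gradedBracket a b), add_sub_cancel_right]
  refine Submodule.sum_mem _ fun k _ => Submodule.smul_mem _ _ ?_
  exact D.fil_anti (by omega) (D.pow_gradedBracket_mem_fil a hb (k + 1 + 1))

/-- The conjugate `b'` of `b` is `b + [a, b]` up to degree `i + 2`. Multiplying by `-b` only adds
brackets built from `[b', b] = [b' - b, b]`, of degree at least `2 i + 1 ≥ i + 2`. -/
theorem commutator_sub_mem_fil (a : 𝔥) {i : ℕ} (hi : 1 ≤ i) {b : 𝔥} (hb : b ∈ D.fil i) :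
    D.star (D.star (D.star a b) (-a)) (-b) - D.gradedBracket a b ∈ D.fil (i + 2) := by
  rcases Nat.eq_zero_or_pos (LieModule.nilpotencyLength 𝔥 𝔥) with h | h
  · have h1 : ∀ z : 𝔥, z = 0 := fun z => by
      have h1 := D.mem_fil_one z
      rwa [D.fil_eq_bot (by omega), Submodule.mem_bot] at h1
    rw [h1 (_ - _)]; exact zero_mem _
  have h1 := D.star_conj_sub_mem_fil a hb
  set b' := D.star (D.star a b) (-a)
  have hab : D.gradedBracket a b ∈ D.fil (i + 1) :=
    D.fil_anti (by omega) (D.gradedBracket_mem_fil (D.mem_fil_one a) hb)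
  have h2 : b' - b ∈ D.fil (i + 1) := by
    have h3 := add_mem (D.fil_anti (Nat.le_succ (i + 1)) h1) hab
    convert h3 using 1
    abel
  have hbb : D.gradedBracket b' b ∈ D.fil (i + 2) := by
    have h3 := D.gradedBracket_mem_fil h2 hb
    rw [map_sub, LinearMap.sub_apply, D.gradedBracket_self, sub_zero] at h3
    exact D.fil_anti (by omega) h3
  have htail : bchTail D.gradedBracket (LieModule.nilpotencyLength 𝔥 𝔥) b' (-b) ∈
      D.fil (i + 2) := by
    refine bchTail_mem _ _ _ _ _ fun l hl hs => ?_
    refine nestedBracket_mem_of_pair (s := {z | z = b' ∨ z = -b}) ?_ ?_ hl hs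
    · rintro z (rfl | rfl) w (rfl | rfl)
      · rw [D.gradedBracket_self]; exact zero_mem _
      · rw [map_neg]; exact neg_mem hbb
      · rw [D.gradedBracket_swap, map_neg, neg_neg]; exact hbb
      · rw [D.gradedBracket_self]; exact zero_mem _
    · intro z _ w hw
      exact D.fil_anti (by omega) (D.gradedBracket_mem_fil (D.mem_fil_one z) hw)
  rw [star, bch_eq_add_bchTail _ h]
  have h4 := add_mem h1 htail
  convert h4 using 1
  abel

variable [FiniteDimensional ℝ 𝔥]

theorem exists_star_sub_le (R : ℝ) : ∃ C, 0 ≤ C ∧ ∀ (x y x' y' : 𝔥) (e : ℝ), 0 ≤ e →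
    coordNorm 𝔥 x ≤ R → coordNorm 𝔥 y ≤ R → coordNorm 𝔥 x' ≤ R → coordNorm 𝔥 y' ≤ R →
    coordNorm 𝔥 (x - x') ≤ e → coordNorm 𝔥 (y - y') ≤ e →
    coordNorm 𝔥 (D.star x y - D.star x' y') ≤ C * e := by
  obtain ⟨K, _, hK⟩ := exists_bilin_le_coordNorm D.gradedBracket
  obtain ⟨C, hC, h⟩ := exists_bch_sub_le (coordNorm 𝔥) (LieModule.nilpotencyLength 𝔥 𝔥) K R
  refine ⟨C, hC, fun x y x' y' e he hx hy hx' hy' hxx hyy => ?_⟩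
  simpa [star] using h _ _ 0 e x y x' y' le_rfl he hK hK (by simp) hx hy hx' hy' hxx hyy

theorem exists_coordNorm_star_lt {ε : ℝ} (hε : 0 < ε) : ∃ η, 0 < η ∧ ∀ x y : 𝔥,
    coordNorm 𝔥 x < η → coordNorm 𝔥 y < η → coordNorm 𝔥 (D.star x y) < ε := by
  obtain ⟨C, hC, h⟩ := D.exists_star_sub_le 1
  refine ⟨min 1 (ε / (C + 1) / 2), by positivity, fun x y hx hy => ?_⟩
  have hx1 := hx.le.trans (min_le_left _ _)
  have hy1 := hy.le.trans (min_le_left _ _)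
  have hx2 := hx.le.trans (min_le_right _ _)
  have hy2 := hy.le.trans (min_le_right _ _)
  have := h x y 0 0 (ε / (C + 1) / 2) (by positivity) hx1 hy1 (by simp) (by simp) (by simpa)
    (by simpa)
  rw [D.star_zero, sub_zero] at this
  refine this.trans_lt ?_
  rw [div_div, mul_div_assoc', div_lt_iff₀ (by positivity)]
  nlinarith

variable (N : Seminorm ℝ (D.V 1))

/-- `x` agrees modulo components of degree greater than `i` with a small product of horizontal
vectors of total length less than `ε`. -/
def IsApprox (i : ℕ) (x : 𝔥) (ε : ℝ) : Prop :=
  ∃ l : List (D.V 1), (l.map N).sum < ε ∧ coordNorm 𝔥 (D.starProd l) < ε ∧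
    D.starProd l - x ∈ D.fil (i + 1)

theorem isApprox_zero (i : ℕ) {ε : ℝ} (hε : 0 < ε) : D.IsApprox N i 0 ε :=
  ⟨[], by simpa, by simpa [starProd_nil], by simp [starProd_nil]⟩

theorem exists_isApprox_add {i : ℕ} (hi : 1 ≤ i) {ε : ℝ} (hε : 0 < ε) : ∃ η, 0 < η ∧
    ∀ x ∈ D.fil i, ∀ y ∈ D.fil i, D.IsApprox N i x η → D.IsApprox N i y η →
      D.IsApprox N i (x + y) ε := by
  obtain ⟨η, hη, h⟩ := D.exists_coordNorm_star_lt hε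
  refine ⟨min η (ε / 2), by positivity, ?_⟩
  rintro x hx y hy ⟨l, hl1, hl2, hl3⟩ ⟨l', hl1', hl2', hl3'⟩
  refine ⟨l ++ l', ?_, ?_, ?_⟩
  · rw [List.map_append, List.sum_append]
    have := min_le_right η (ε / 2)
    linarith
  · rw [starProd_append]
    exact h _ _ (hl2.trans_le (min_le_left _ _)) (hl2'.trans_le (min_le_left _ _))
  · rw [starProd_append]
    have hlx : D.starProd l ∈ D.fil i := by
      simpa using add_mem (D.fil_anti (Nat.le_succ i) hl3) hx
    have hly : D.starProd l' ∈ D.fil i := by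
      simpa using add_mem (D.fil_anti (Nat.le_succ i) hl3') hy
    have h1 := D.star_sub_mem_fil hi hlx hly
    have h2 := add_mem h1 (add_mem hl3 hl3')
    convert h2 using 1
    abel

/-- The vectors of `V i` all of whose small multiples are approximable. -/
def approxSubmodule (i : ℕ) (hi : 1 ≤ i) : Submodule ℝ 𝔥 where
  carrier := {x | x ∈ D.V i ∧ ∀ ε > 0, ∀ᶠ s : ℝ in 𝓝 0, D.IsApprox N i (s • x) ε}
  zero_mem' := ⟨zero_mem _, fun ε hε => Eventually.of_forall fun s => by
    rw [smul_zero]; exact D.isApprox_zero N i hε⟩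
  add_mem' := by
    rintro x y ⟨hx, hx'⟩ ⟨hy, hy'⟩
    refine ⟨add_mem hx hy, fun ε hε => ?_⟩
    obtain ⟨η, hη, h⟩ := D.exists_isApprox_add N hi hε
    filter_upwards [hx' η hη, hy' η hη] with s h1 h2
    rw [smul_add]
    exact h _ (D.V_le_fil i (Submodule.smul_mem _ s hx)) _
      (D.V_le_fil i (Submodule.smul_mem _ s hy)) h1 h2
  smul_mem' := by
    rintro c x ⟨hx, hx'⟩
    refine ⟨Submodule.smul_mem _ c hx, fun ε hε => ?_⟩
    have ht : Tendsto (fun s : ℝ => s * c) (𝓝 0) (𝓝 0) := by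
      have h : Continuous fun s : ℝ => s * c := by fun_prop
      simpa using h.tendsto 0
    filter_upwards [ht.eventually (hx' ε hε)] with s hs
    rwa [smul_smul]

theorem eventually_smul_lt {E : Type*} [AddCommGroup E] [Module ℝ E] (p : Seminorm ℝ E) (v : E)
    {ε : ℝ} (hε : 0 < ε) : ∀ᶠ s : ℝ in 𝓝 0, p (s • v) < ε := by
  have : Tendsto (fun s : ℝ => p (s • v)) (𝓝 0) (𝓝 0) := by
    have h : Continuous fun s : ℝ => |s| * p v := by fun_prop
    have h' := h.tendsto 0
    simp only [abs_zero, zero_mul] at h'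
    refine h'.congr fun s => ?_
    rw [map_smul_eq_mul, Real.norm_eq_abs]
  exact this.eventually_lt_const hε

/-- To reach `s • [v, y]`, take the group commutator of the vector `√|s| • v` with a short
horizontal product following `sign s * √|s| • y`. Its length is twice the sum of the two lengths,
and the errors have degree at least `i + 2`. -/
theorem gradedBracket_mem_approxSubmodule {i : ℕ} (hi : 1 ≤ i) (v : D.V 1) {y : 𝔥}
    (hy : y ∈ D.approxSubmodule N i hi) :
    D.gradedBracket v y ∈ D.approxSubmodule N (i + 1) (by omega) := by
  obtain ⟨hyV, hy'⟩ := hy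
  refine ⟨?_, fun ε hε => ?_⟩
  · rw [add_comm i 1]; exact D.gradedBracket_mem v.2 hyV
  -- The commutator has four factors, so continuity of `⋆` at the origin is used three times; the
  -- bound `ε / 4` controls the total length.
  obtain ⟨η₃, hη₃, h3⟩ := D.exists_coordNorm_star_lt hε
  obtain ⟨η₂, hη₂, h2⟩ := D.exists_coordNorm_star_lt hη₃
  obtain ⟨η₁, hη₁, h1⟩ := D.exists_coordNorm_star_lt hη₂
  set η := min (min η₁ η₂) (min η₃ (ε / 4)) with hη
  have hη0 : 0 < η := by positivity
  have e1 : η ≤ η₁ := (min_le_left _ _).trans (min_le_left _ _)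
  have e2 : η ≤ η₂ := (min_le_left _ _).trans (min_le_right _ _)
  have e3 : η ≤ η₃ := (min_le_right _ _).trans (min_le_left _ _)
  have e4 : η ≤ ε / 4 := (min_le_right _ _).trans (min_le_right _ _)
  have hsq : Tendsto (fun s : ℝ => √|s|) (𝓝 0) (𝓝 0) := by
    have h : Continuous fun s : ℝ => √|s| := by fun_prop
    simpa using h.tendsto 0
  -- The sign is carried by `y` alone, so that the product of the two coefficients is `s` also for
  -- negative `s`.
  have hsq' : Tendsto (fun s : ℝ => SignType.sign s * √|s|) (𝓝 0) (𝓝 0) := by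
    refine squeeze_zero_norm (fun s => ?_) hsq
    rw [Real.norm_eq_abs, abs_mul, abs_of_nonneg (Real.sqrt_nonneg |s|)]
    refine mul_le_of_le_one_left (Real.sqrt_nonneg _) ?_
    rcases lt_trichotomy s 0 with h | h | h <;> simp [h]
  filter_upwards [hsq.eventually (eventually_smul_lt N v hη0),
    hsq.eventually (eventually_smul_lt (coordNorm 𝔥) (v : 𝔥) hη0),
    hsq'.eventually (hy' η hη0)] with s hs1 hs2 ⟨l, hl1, hl2, hl3⟩
  set a : D.V 1 := √|s| • v with ha
  have hl4 : D.starProd l ∈ D.fil i := by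
    have := add_mem (D.fil_anti (Nat.le_succ i) hl3)
      (D.V_le_fil i (Submodule.smul_mem _ (SignType.sign s * √|s|) hyV))
    simpa using this
  refine ⟨[a] ++ l ++ [-a] ++ (l.map (- ·)).reverse, ?_, ?_, ?_⟩
  · simp only [List.map_append, List.sum_append, D.sum_map_reverse_neg, List.map_cons,
      List.map_nil, List.sum_cons, List.sum_nil, map_neg_eq_map]
    linarith
  · simp only [starProd_append, starProd_singleton, D.starProd_reverse_neg]
    refine h3 _ _ (h2 _ _ (h1 _ _ ?_ ?_) ?_) ?_
    · exact hs2.trans_le e1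
    · exact hl2.trans_le e1
    · rw [Submodule.coe_neg, map_neg_eq_map]; exact hs2.trans_le e2
    · rw [map_neg_eq_map]; exact hl2.trans_le e3
  · simp only [starProd_append, starProd_singleton, D.starProd_reverse_neg]
    have h4 := D.commutator_sub_mem_fil (a : 𝔥) hi hl4
    have h5 := D.gradedBracket_mem_fil (D.mem_fil_one (a : 𝔥)) hl3
    have h6 : D.gradedBracket (a : 𝔥) ((SignType.sign s * √|s|) • y) =
        s • D.gradedBracket (v : 𝔥) y := by
      rw [ha, Submodule.coe_smul, map_smul, map_smul, LinearMap.smul_apply, smul_smul]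
      congr 1
      rw [mul_assoc, Real.mul_self_sqrt (abs_nonneg s), sign_mul_abs]
    rw [map_sub, h6] at h5
    have h7 := add_mem h4 (D.fil_anti (show i + 2 ≤ 1 + (i + 1) by omega) h5)
    rw [Submodule.coe_neg]
    convert h7 using 1
    abel

theorem V_le_approxSubmodule {i : ℕ} (hi : 1 ≤ i) : D.V i ≤ D.approxSubmodule N i hi := by
  induction i, hi using Nat.le_induction with
  | base =>
    intro x hx
    refine ⟨hx, fun ε hε => ?_⟩
    filter_upwards [eventually_smul_lt N ⟨x, hx⟩ hε, eventually_smul_lt (coordNorm 𝔥) x hε]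
      with s h1 h2
    exact ⟨[s • ⟨x, hx⟩], by simpa using h1, by rw [starProd_singleton]; exact h2, by
      rw [starProd_singleton]; simp⟩
  | succ i hi ih =>
    refine (D.V_succ_le_span hi).trans (Submodule.span_le.2 ?_)
    rintro z ⟨v, hv, w, hw, rfl⟩
    exact D.gradedBracket_mem_approxSubmodule N hi ⟨v, hv⟩ (ih hw)

/-- Passes from small multiples of one vector to a full neighbourhood in `V i`, adding up the
coordinates in a basis one at a time. -/
theorem exists_isApprox_of_coordNorm_lt {i : ℕ} (hi : 1 ≤ i) {ε : ℝ} (hε : 0 < ε) :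
    ∃ δ, 0 < δ ∧ ∀ x ∈ D.V i, coordNorm 𝔥 x < δ → D.IsApprox N i x ε := by
  set b := Module.finBasis ℝ (D.V i)
  have key : ∀ (t : Finset (Fin (Module.finrank ℝ (D.V i)))) (ε : ℝ), 0 < ε → ∃ δ, 0 < δ ∧
      ∀ c : Fin (Module.finrank ℝ (D.V i)) → ℝ, (∀ j ∈ t, |c j| < δ) →
        D.IsApprox N i (∑ j ∈ t, c j • (b j : 𝔥)) ε := by
    classical
    intro t
    induction t using Finset.induction_on with
    | empty => exact fun ε hε => ⟨1, one_pos, fun c _ => by simpa using D.isApprox_zero N i hε⟩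
    | insert j t hj ih =>
      intro ε hε
      obtain ⟨η, hη, h⟩ := D.exists_isApprox_add N hi hε
      obtain ⟨δ, hδ, h1⟩ := ih η hη
      obtain ⟨δ', hδ', h2⟩ := Metric.eventually_nhds_iff.1
        ((D.V_le_approxSubmodule N hi (b j).2).2 η hη)
      refine ⟨min δ δ', lt_min hδ hδ', fun c hc => ?_⟩
      rw [Finset.sum_insert hj]
      refine h _ (D.V_le_fil i (Submodule.smul_mem _ _ (b j).2)) _
        (Submodule.sum_mem _ fun k _ => D.V_le_fil i (Submodule.smul_mem _ _ (b k).2))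
        (h2 ?_) (h1 c fun k hk => ?_)
      · rw [Real.dist_eq, sub_zero]
        exact (hc j (Finset.mem_insert_self _ _)).trans_le (min_le_right _ _)
      · exact (hc k (Finset.mem_insert_of_mem hk)).trans_le (min_le_left _ _)
  obtain ⟨δ, hδ, h⟩ := key Finset.univ ε hε
  choose C hC hCb using fun j => exists_linearMap_le_coordNorm (normSeminorm ℝ ℝ)
    (b.coord j ∘ₗ (D.proj i).codRestrict (D.V i) (D.proj_mem i))
  refine ⟨δ / (1 + ∑ j, C j), div_pos hδ
    (add_pos_of_pos_of_nonneg one_pos (Finset.sum_nonneg fun j _ => hC j)), fun x hx hxδ => ?_⟩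
  have hpos : 0 < 1 + ∑ j, C j :=
    add_pos_of_pos_of_nonneg one_pos (Finset.sum_nonneg fun j _ => hC j)
  have hcod : (D.proj i).codRestrict (D.V i) (D.proj_mem i) x = ⟨x, hx⟩ :=
    Subtype.ext (D.proj_of_mem hx)
  have h1 := h (fun j => b.repr ⟨x, hx⟩ j) fun j _ => by
    have h2 := hCb j x
    rw [LinearMap.comp_apply, hcod] at h2
    refine lt_of_le_of_lt h2 ?_
    have h3 : C j ≤ 1 + ∑ j, C j := by
      have := Finset.single_le_sum (f := C) (fun j _ => hC j) (Finset.mem_univ j)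
      linarith
    rw [lt_div_iff₀ hpos] at hxδ
    have := apply_nonneg (coordNorm 𝔥) x
    nlinarith
  have h4 : ∑ j, b.repr ⟨x, hx⟩ j • (b j : 𝔥) = x := by
    have := congrArg (D.V i).subtype (b.sum_repr ⟨x, hx⟩)
    rw [map_sum] at this
    simpa using this
  rwa [h4] at h1

/-- Small elements of the Carnot group are products of horizontal vectors of small total
length. -/
theorem exists_starProd_eq_of_mem_fil (i : ℕ) (hi : 1 ≤ i) {ε : ℝ} (hε : 0 < ε) :
    ∃ δ, 0 < δ ∧ ∀ w ∈ D.fil i, coordNorm 𝔥 w < δ →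
      ∃ l : List (D.V 1), D.starProd l = w ∧ (l.map N).sum < ε := by
  -- Descending induction on `i`, starting where `fil i` is trivial: divide `w` on the left by a
  -- short product `l` with the same component of degree `i`, and treat the quotient, which lies in
  -- `fil (i + 1)`.
  induction hn : LieModule.nilpotencyLength 𝔥 𝔥 + 1 - i generalizing i ε with
  | zero =>
    refine ⟨1, one_pos, fun w hw _ => ⟨[], ?_, by simpa⟩⟩
    rw [D.fil_eq_bot (by omega), Submodule.mem_bot] at hw
    rw [hw, starProd_nil]
  | succ n ih =>
    obtain ⟨δ₁, hδ₁, h1⟩ := ih (i + 1) (by omega) (half_pos hε) (by omega)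
    obtain ⟨η, hη, h2⟩ := D.exists_coordNorm_star_lt hδ₁
    obtain ⟨δ₂, hδ₂, h3⟩ := D.exists_isApprox_of_coordNorm_lt N hi
      (lt_min hη (half_pos hε))
    obtain ⟨P, hP, hPb⟩ := D.exists_proj_le i
    refine ⟨min η (δ₂ / (P + 1)), by positivity, fun w hw hwδ => ?_⟩
    obtain ⟨l, hl1, hl2, hl3⟩ := h3 (D.proj i w) (D.proj_mem i w) (by
      have h4 := hwδ.trans_le (min_le_right _ _)
      rw [lt_div_iff₀ (by positivity)] at h4
      have := hPb w
      have := apply_nonneg (coordNorm 𝔥) w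
      nlinarith)
    have hwp : w - D.proj i w ∈ D.fil (i + 1) := by
      rw [mem_fil]
      intro j hj
      rcases Nat.lt_succ_iff_lt_or_eq.1 hj with hj | rfl
      · rw [map_sub, D.mem_fil.1 hw j hj, D.proj_proj_of_ne (by omega), sub_zero]
      · rw [map_sub, D.proj_proj_self, sub_self]
    have hl4 : D.starProd l ∈ D.fil i := by
      simpa using add_mem (D.fil_anti (Nat.le_succ i) hl3) (D.V_le_fil i (D.proj_mem i w))
    have h5 : D.star (-D.starProd l) w ∈ D.fil (i + 1) := by
      have h6 := D.star_sub_mem_fil hi (neg_mem hl4) hw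
      have h7 := add_mem h6 (sub_mem hwp hl3)
      convert h7 using 1
      abel
    obtain ⟨l', hl', hl1'⟩ := h1 _ h5 (h2 _ _
      (by rw [map_neg_eq_map]; exact hl2.trans_le (min_le_left _ _))
      (hwδ.trans_le (min_le_left _ _)))
    refine ⟨l ++ l', ?_, ?_⟩
    · rw [starProd_append, hl', ← D.star_assoc, D.star_neg_self, D.zero_star]
    · rw [List.map_append, List.sum_append]
      have := min_le_right η (ε / 2)
      linarith

end LCSSplitting

/-! ### Horizontal polygons -/

namespace LCSSplitting

variable {𝔥 : Type*} [LieRing 𝔥] [LieAlgebra ℝ 𝔥] [LieRing.IsNilpotent 𝔥] (D : LCSSplitting 𝔥)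

/-- The path which follows the one-parameter groups of the successive vectors of the list, each
for unit time. -/
def polygon : List (D.V 1) → ℝ → 𝔥
  | [], _ => 0
  | v :: l, s => D.star (max 0 (min 1 s) • (v : 𝔥)) (polygon l (s - 1))

theorem polygon_of_nonpos (l : List (D.V 1)) {s : ℝ} (hs : s ≤ 0) : D.polygon l s = 0 := by
  induction l generalizing s with
  | nil => rfl
  | cons v l ih =>
    rw [polygon, ih (by linarith), min_eq_right (by linarith), max_eq_left hs, zero_smul,
      D.star_zero]

theorem polygon_of_length_le (l : List (D.V 1)) {s : ℝ} (hs : l.length ≤ s) :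
    D.polygon l s = D.starProd l := by
  induction l generalizing s with
  | nil => rfl
  | cons v l ih =>
    rw [List.length_cons, Nat.cast_add, Nat.cast_one] at hs
    have : (0 : ℝ) ≤ l.length := Nat.cast_nonneg _
    rw [polygon, ih (by linarith), min_eq_left (by linarith), max_eq_right zero_le_one, one_smul,
      starProd_cons]

/-- Away from integer times only the current factor moves; the completed ones cancel in the
quotient. Past the end of the list the velocity is the default `0`. -/
theorem eventually_star_polygon (l : List (D.V 1)) {s : ℝ} (hs0 : 0 < s) (hs : ∀ k : ℕ, s ≠ k) :
    ∀ᶠ τ : ℝ in 𝓝 0, D.star (-D.polygon l s) (D.polygon l (s + τ)) =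
      τ • ((l.getD ⌊s⌋₊ 0 : D.V 1) : 𝔥) := by
  induction l generalizing s with
  | nil =>
    refine Eventually.of_forall fun τ => ?_
    simp [polygon, D.star_zero]
  | cons v l ih =>
    rcases lt_or_gt_of_ne (by simpa using hs 1 : s ≠ 1) with h1 | h1
    · have e1 : ∀ᶠ τ : ℝ in 𝓝 0, s + τ < 1 := by
        have : Tendsto (fun τ : ℝ => s + τ) (𝓝 0) (𝓝 (s + 0)) :=
          tendsto_const_nhds.add tendsto_id
        exact this.eventually_lt_const (by simpa using h1)
      have e2 : ∀ᶠ τ : ℝ in 𝓝 0, 0 < s + τ := by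
        have : Tendsto (fun τ : ℝ => s + τ) (𝓝 0) (𝓝 (s + 0)) :=
          tendsto_const_nhds.add tendsto_id
        exact this.eventually_const_lt (by simpa using hs0)
      filter_upwards [e1, e2] with τ h2 h3
      have hf : ⌊s⌋₊ = 0 := Nat.floor_eq_zero.2 h1
      rw [polygon, polygon, D.polygon_of_nonpos l (sub_nonpos.2 h1.le),
        D.polygon_of_nonpos l (sub_nonpos.2 h2.le), D.star_zero, D.star_zero, min_eq_right h1.le, min_eq_right h2.le, max_eq_right hs0.le,
        max_eq_right h3.le, ← neg_smul, D.star_smul_smul, hf, List.getD_cons_zero]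
      congr 1
      ring
    · have e1 : ∀ᶠ τ : ℝ in 𝓝 0, 1 < s + τ := by
        have : Tendsto (fun τ : ℝ => s + τ) (𝓝 0) (𝓝 (s + 0)) :=
          tendsto_const_nhds.add tendsto_id
        exact this.eventually_const_lt (by simpa using h1)
      have hs' : ∀ k : ℕ, s - 1 ≠ k := fun k hk => hs (k + 1) (by push_cast; linarith)
      have hf : ⌊s⌋₊ = ⌊s - 1⌋₊ + 1 := by
        rw [← Nat.floor_add_one (by linarith), sub_add_cancel]
      filter_upwards [e1, ih (sub_pos.2 h1) hs'] with τ h2 h3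
      rw [polygon, polygon, min_eq_left h1.le, min_eq_left h2.le, max_eq_right zero_le_one,
        one_smul, D.neg_star, D.star_assoc, ← D.star_assoc (-(v : 𝔥)), D.neg_star_self,
        D.zero_star, hf, List.getD_cons_succ, ← h3, show s + τ - 1 = s - 1 + τ by ring]

variable [FiniteDimensional ℝ 𝔥]

theorem exists_polygon_lipschitz (l : List (D.V 1)) : ∃ R L : ℝ, 0 ≤ L ∧
    (∀ s, coordNorm 𝔥 (D.polygon l s) ≤ R) ∧
    ∀ s s', coordNorm 𝔥 (D.polygon l s - D.polygon l s') ≤ L * |s - s'| := by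
  induction l with
  | nil => exact ⟨0, 0, le_rfl, by simp [polygon], by simp [polygon]⟩
  | cons v l ih =>
    obtain ⟨R, L, hL, hR, hRL⟩ := ih
    set R' := max R (coordNorm 𝔥 (v : 𝔥))
    obtain ⟨C, hC, h⟩ := D.exists_star_sub_le R'
    have hv : ∀ s : ℝ, coordNorm 𝔥 (max 0 (min 1 s) • (v : 𝔥)) ≤ R' := fun s => by
      rw [map_smul_eq_mul, Real.norm_eq_abs, abs_of_nonneg (le_max_left _ _)]
      refine (mul_le_of_le_one_left (apply_nonneg _ _) ?_).trans (le_max_right _ _)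
      exact max_le zero_le_one (min_le_left _ _)
    have hl : ∀ s, coordNorm 𝔥 (D.polygon l s) ≤ R' := fun s => (hR s).trans (le_max_left _ _)
    have hR0 : 0 ≤ R' := (apply_nonneg _ _).trans (hl 0)
    refine ⟨C * R', C * (L + coordNorm 𝔥 (v : 𝔥)), by positivity, fun s => ?_, fun s s' => ?_⟩
    · have := h _ _ 0 0 R' hR0 (hv s) (hl (s - 1)) (by simpa) (by simpa)
        (by simpa using hv s) (by simpa using hl (s - 1))
      rwa [D.star_zero, sub_zero] at this
    · have h0 : 0 ≤ coordNorm 𝔥 (v : 𝔥) := apply_nonneg _ _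
      rw [mul_assoc]
      refine h _ _ _ _ _ (by positivity) (hv s) (hl _) (hv s') (hl _) ?_ ?_
      · rw [← sub_smul, map_smul_eq_mul, Real.norm_eq_abs]
        have h1 : |max 0 (min 1 s) - max 0 (min 1 s')| ≤ |s - s'| := by
          rw [max_comm 0, max_comm 0]
          refine (abs_max_sub_max_le_abs _ _ _).trans ?_
          exact (abs_min_sub_min_le_max 1 s 1 s').trans (by simp)
        nlinarith [abs_nonneg (s - s')]
      · refine (hRL _ _).trans ?_
        rw [show s - 1 - (s' - 1) = s - s' by ring]
        nlinarith [abs_nonneg (s - s')]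

theorem isHorizontal_polygon (g : 𝔥) (l : List (D.V 1)) :
    D.IsHorizontal (fun t => D.star g (D.polygon l (l.length * t)))
      (fun t => (l.length : ℝ) • l.getD ⌊l.length * t⌋₊ 0) where
  absolutelyContinuous φ := by
    obtain ⟨R, L, hL, hR, hRL⟩ := D.exists_polygon_lipschitz l
    obtain ⟨C, hC, h⟩ := D.exists_star_sub_le (max R (coordNorm 𝔥 g))
    obtain ⟨P, hP, hPb⟩ := exists_linearMap_le_coordNorm (normSeminorm ℝ ℝ) φ
    have h0 : 0 ≤ P * (C * (L * l.length)) := by positivity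
    refine LipschitzOnWith.absolutelyContinuousOnInterval (K := ⟨_, h0⟩)
      (LipschitzWith.lipschitzOnWith (LipschitzWith.of_dist_le_mul fun s s' => ?_))
    rw [Real.dist_eq, Real.dist_eq, ← map_sub]
    refine (hPb _).trans ?_
    change _ ≤ P * (C * (L * l.length)) * |s - s'|
    rw [mul_assoc]
    refine mul_le_mul_of_nonneg_left ?_ hP
    rw [mul_assoc]
    refine h _ _ _ _ _ (by positivity) (le_max_right _ _) ((hR _).trans (le_max_left _ _))
      (le_max_right _ _) ((hR _).trans (le_max_left _ _)) ?_ ?_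
    · rw [sub_self, map_zero]; positivity
    · refine (hRL _ _).trans ?_
      rw [← mul_sub, abs_mul, Nat.abs_cast, mul_assoc]
  velocity φ := by
    by_cases hl : l.length = 0
    · have : l = [] := List.length_eq_zero_iff.1 hl
      subst this
      refine Eventually.of_forall fun t => ?_
      simpa [polygon, D.star_zero, D.neg_star_self] using hasDerivAt_const (0 : ℝ) (φ 0)
    have hpos : (0 : ℝ) < l.length := by exact_mod_cast Nat.pos_of_ne_zero hl
    -- The corners of the reparametrised polygon occur at times `k / length`, a null set.
    have hcount : ∀ᵐ t ∂(volume : Measure ℝ), t ∉ Set.range fun k : ℕ => (k : ℝ) / l.length :=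
      measure_eq_zero_iff_ae_notMem.1 ((Set.countable_range _).measure_zero volume)
    filter_upwards [ae_restrict_of_ae hcount, ae_restrict_mem measurableSet_Icc] with t ht htI
    have hne : ∀ k : ℕ, (l.length : ℝ) * t ≠ k := fun k hk => ht ⟨k, by
      simp only; rw [← hk]; field_simp⟩
    have h0 : 0 < (l.length : ℝ) * t :=
      lt_of_le_of_ne (mul_nonneg hpos.le htI.1) fun h => hne 0 (by simpa using h.symm)
    have h1 := D.eventually_star_polygon l h0 hne
    have htend : Tendsto (fun τ : ℝ => (l.length : ℝ) * τ) (𝓝 0) (𝓝 0) := by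
      have h : Continuous fun τ : ℝ => (l.length : ℝ) * τ := by fun_prop
      simpa using h.tendsto 0
    set v := l.getD ⌊l.length * t⌋₊ 0
    have h2 : HasDerivAt (fun τ : ℝ => τ * φ ((l.length : ℝ) • (v : 𝔥)))
        (φ ((l.length : ℝ) • (v : 𝔥))) 0 := by
      simpa using (hasDerivAt_id (0 : ℝ)).mul_const (φ ((l.length : ℝ) • (v : 𝔥)))
    refine h2.congr_of_eventuallyEq ?_
    filter_upwards [htend.eventually h1] with τ hτ
    rw [D.neg_star, D.star_assoc, ← D.star_assoc (-g), D.neg_star_self, D.zero_star, mul_add, hτ,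
      mul_smul, smul_comm, map_smul, smul_eq_mul]

theorem ccDist_star_starProd_le (N : Seminorm ℝ (D.V 1)) (g : 𝔥) (l : List (D.V 1)) :
    D.ccDist N g (D.star g (D.starProd l)) ≤ ENNReal.ofReal (l.map N).sum := by
  have hends : D.star g (D.polygon l (l.length * 0)) = g ∧
      D.star g (D.polygon l (l.length * 1)) = D.star g (D.starProd l) := by
    rw [mul_zero, mul_one, D.polygon_of_nonpos l le_rfl, D.star_zero,
      D.polygon_of_length_le l le_rfl]
    exact ⟨rfl, rfl⟩
  refine (iInf₂_le_of_le _ _ (iInf_le _ ⟨D.isHorizontal_polygon g l, hends⟩)).trans ?_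
  by_cases hl : l.length = 0
  · simp [hl]
  have hpos : (0 : ℝ) < l.length := by exact_mod_cast Nat.pos_of_ne_zero hl
  set m := l.length
  calc _ ≤ ∫⁻ t : ℝ in Set.Icc 0 1, ∑ j : Fin m,
        (Set.Ico ((j : ℝ) / m) (((j : ℝ) + 1) / m)).indicator
          (fun _ => ENNReal.ofReal (m * N (l.get j))) t := by
        refine setLIntegral_mono' measurableSet_Icc fun t ht => ?_
        by_cases hj : ⌊(m : ℝ) * t⌋₊ < m
        · refine le_trans ?_ (Finset.single_le_sum (fun _ _ => zero_le)
            (Finset.mem_univ (⟨⌊(m : ℝ) * t⌋₊, hj⟩ : Fin m)))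
          rw [Set.indicator_of_mem, List.getD_eq_getElem _ _ hj, map_smul_eq_mul,
            Real.norm_of_nonneg hpos.le]
          · rfl
          · have h1 := Nat.floor_le (mul_nonneg hpos.le ht.1)
            have h2 := Nat.lt_floor_add_one ((m : ℝ) * t)
            constructor
            · rw [div_le_iff₀ hpos, mul_comm t]; exact h1
            · rw [lt_div_iff₀ hpos, mul_comm t]; exact h2
        · rw [List.getD_eq_default _ _ (not_lt.1 hj)]
          simp
    _ ≤ ∫⁻ t : ℝ, ∑ j : Fin m,
        (Set.Ico ((j : ℝ) / m) (((j : ℝ) + 1) / m)).indicator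
          (fun _ => ENNReal.ofReal (m * N (l.get j))) t := setLIntegral_le_lintegral _ _
    _ = ∑ j : Fin m, ENNReal.ofReal (N (l.get j)) := by
        rw [lintegral_finsetSum _ fun j _ => measurable_const.indicator measurableSet_Ico]
        refine Finset.sum_congr rfl fun j _ => ?_
        rw [lintegral_indicator_const measurableSet_Ico, Real.volume_Ico,
          ← ENNReal.ofReal_mul (mul_nonneg hpos.le (apply_nonneg _ _))]
        congr 1
        field_simp
        ring
    _ = _ := by
        rw [← ENNReal.ofReal_sum_of_nonneg fun _ _ => apply_nonneg _ _]
        congr 1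
        rw [← List.sum_ofFn, ← Function.comp_def (fun x => N x), ← List.map_ofFn, List.ofFn_get]

/-- Bounded elements which are close in coordinates are close in the Carnot–Carathéodory distance,
after dilation. -/
theorem exists_ccDist_dilation_le (N : Seminorm ℝ (D.V 1)) (R : ℝ) {ε : ℝ} (hε : 0 < ε) :
    ∃ δ, 0 < δ ∧ ∀ u w : 𝔥, coordNorm 𝔥 u ≤ R → coordNorm 𝔥 w ≤ R → coordNorm 𝔥 (u - w) < δ →
      ∀ t : ℝ, 0 ≤ t → D.ccDist N (D.dilation t u) (D.dilation t w) ≤ ENNReal.ofReal (t * ε) := by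
  obtain ⟨η, hη, h⟩ := D.exists_starProd_eq_of_mem_fil N 1 le_rfl hε
  obtain ⟨C, hC, h1⟩ := D.exists_star_sub_le R
  refine ⟨η / (C + 1), by positivity, fun u w hu hw huw t ht => ?_⟩
  -- The quotient `(-u) ⋆ w` is compared with `(-u) ⋆ u = 0`, so it is small by the Lipschitz
  -- estimate.
  have h2 := h1 (-u) w (-u) u (coordNorm 𝔥 (u - w)) (apply_nonneg _ _)
    (by rwa [map_neg_eq_map]) hw (by rwa [map_neg_eq_map]) hu (by simp) (map_sub_rev _ _ _).le
  rw [D.neg_star_self, sub_zero] at h2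
  rw [lt_div_iff₀ (by positivity)] at huw
  obtain ⟨l, hl, hlN⟩ := h (D.star (-u) w) (D.mem_fil_one _) (by
    have := apply_nonneg (coordNorm 𝔥) (u - w)
    nlinarith)
  have hw' : D.star u (D.starProd l) = w := by
    rw [hl, ← D.star_assoc, D.star_neg_self, D.zero_star]
  rw [← hw', D.dilation_star, D.dilation_starProd]
  refine (D.ccDist_star_starProd_le N _ _).trans (ENNReal.ofReal_le_ofReal ?_)
  have : ((l.map (t • ·)).map N).sum = t * (l.map N).sum := by
    rw [List.map_map, ← List.sum_map_mul_left]
    congr 1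
    refine List.map_congr_left fun v _ => ?_
    rw [Function.comp_apply, map_smul_eq_mul, Real.norm_of_nonneg ht]
  rw [this]
  exact mul_le_mul_of_nonneg_left hlN.le ht

end LCSSplitting

/-! ### Asymptotics of cocycles with values in a Banach space -/

section NormedCocycle

variable {Γ V : Type*} [Group Γ] [NormedAddCommGroup V] [NormedSpace ℝ V]

/-- `b` is a cocycle for the isometric right action `U` of `Γ`, with linear growth rates `F`, and
invariant vectors of every subgroup are normed by functionals invariant under the subgroup. -/
structure IsNormedCocycle (U : Γ → V →L[ℝ] V) (b F : Γ → V) : Prop where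
  norm_map : ∀ g w, ‖U g w‖ = ‖w‖
  map_mul : ∀ g h w, U (g * h) w = U h (U g w)
  map_one : ∀ w, U 1 w = w
  cocycle : ∀ g h, b (g * h) = U h (b g) + b h
  tendsto : ∀ g, Tendsto (fun n : ℕ => (n : ℝ)⁻¹ • b (g ^ n)) atTop (𝓝 (F g))
  exists_functional : ∀ (Z : Subgroup Γ) (w : V), (∀ n ∈ Z, U n w = w) →
    ∃ φ : V →L[ℝ] ℝ, (∀ n ∈ Z, ∀ v, φ (U n v) = φ v) ∧ φ w = ‖w‖

theorem eq_of_tendsto_inv_smul_sub_bounded {u v : ℕ → V} {a c : V} {M : ℝ}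
    (hu : Tendsto (fun n : ℕ => (n : ℝ)⁻¹ • u n) atTop (𝓝 a))
    (hv : Tendsto (fun n : ℕ => (n : ℝ)⁻¹ • v n) atTop (𝓝 c)) (hM : ∀ n, ‖u n - v n‖ ≤ M) :
    a = c := by
  have h0 : Tendsto (fun n : ℕ => (n : ℝ)⁻¹ • u n - (n : ℝ)⁻¹ • v n) atTop (𝓝 0) := by
    refine squeeze_zero_norm (a := fun n : ℕ => (n : ℝ)⁻¹ * M) (fun n => ?_) ?_
    · rw [← smul_sub, norm_smul, norm_inv, Real.norm_natCast]
      gcongr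
      exact hM n
    · simpa using (tendsto_inv_atTop_nhds_zero_nat (𝕜 := ℝ)).mul_const M
  exact sub_eq_zero.1 (tendsto_nhds_unique (hu.sub hv) h0)

/-! ### Invariance of the growth rates of a cocycle of a nilpotent group. -/

namespace IsNormedCocycle

variable {U : Γ → V →L[ℝ] V} {b F : Γ → V}

/-- By the cocycle identity `b (g⁻¹ sⁿ g)` and `U g (b (sⁿ))` differ by two vectors whose norms do
not depend on `n`, because `U` is isometric. -/
theorem map_rate (h : IsNormedCocycle U b F) (g s : Γ) : U g (F s) = F (g⁻¹ * s * g) := by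
  have h1 : Tendsto (fun n : ℕ => (n : ℝ)⁻¹ • U g (b (s ^ n))) atTop (𝓝 (U g (F s))) := by
    refine (((U g).continuous.tendsto _).comp (h.tendsto s)).congr fun n => ?_
    simp
  refine eq_of_tendsto_inv_smul_sub_bounded h1 (h.tendsto (g⁻¹ * s * g)) (M := ‖b g⁻¹‖ + ‖b g‖)
    fun n => ?_
  have h2 : b ((g⁻¹ * s * g) ^ n) = U g (U (s ^ n) (b g⁻¹)) + U g (b (s ^ n)) + b g := by
    have h3 : (g⁻¹ * s * g) ^ n = g⁻¹ * s ^ n * g := by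
      have := conj_pow (i := n) (a := g⁻¹) (b := s)
      rwa [inv_inv] at this
    rw [h3, h.cocycle, h.cocycle, _root_.map_add]
  have h4 : U g (b (s ^ n)) - b ((g⁻¹ * s * g) ^ n) = -(U g (U (s ^ n) (b g⁻¹)) + b g) := by
    rw [h2]; abel
  rw [h4, norm_neg]
  refine (norm_add_le _ _).trans ?_
  rw [h.norm_map, h.norm_map]

/-- The iterates of `w` under `U g` are `w + n y`, of constant norm; this is impossible for large
`n` unless `y = 0`. -/
theorem eq_zero_of_map_eq_add (h : IsNormedCocycle U b F) {g : Γ} {w y : V} (hw : U g w = w + y)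
    (hy : U g y = y) : y = 0 := by
  have h1 : ∀ n : ℕ, ∃ w', ‖w'‖ = ‖w‖ ∧ w' = w + (n : ℝ) • y := by
    intro n
    induction n with
    | zero => exact ⟨w, rfl, by simp⟩
    | succ n ih =>
      obtain ⟨w', hw', rfl⟩ := ih
      refine ⟨U g (w + (n : ℝ) • y), by rw [h.norm_map, hw'], ?_⟩
      rw [_root_.map_add, hw, map_smul, hy]
      push_cast
      module
  by_contra hne
  obtain ⟨n, hn⟩ := exists_nat_gt (2 * ‖w‖ / ‖y‖)
  obtain ⟨w', hw', hww⟩ := h1 n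
  rw [div_lt_iff₀ (norm_pos_iff.2 hne)] at hn
  have h2 : (n : ℝ) • y = w' - w := by rw [hww]; abel
  have h3 : ‖(n : ℝ) • y‖ ≤ ‖w'‖ + ‖w‖ := by rw [h2]; exact norm_sub_le _ _
  rw [norm_smul, Real.norm_natCast] at h3
  linarith

/-- A functional invariant under `Z` does not see the action of `y ∈ Z`, so each `y` contributes `φ
(F y)` separately. The induction runs over all invariant functionals, as it replaces `φ` by `φ ∘ U
g`, which is again invariant because `Z` is normal. -/
theorem functional_pow (h : IsNormedCocycle U b F) {Z : Subgroup Γ} (g y : Γ)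
    (hZ : Z.Normal) (hy : y ∈ Z) (n : ℕ) : ∀ φ : V →L[ℝ] ℝ, (∀ n ∈ Z, ∀ v, φ (U n v) = φ v) →
      (∀ g, U g (F y) = F y) → φ (b ((g * y) ^ n)) = φ (b (g ^ n)) + n * φ (F y) := by
  have hb1 : b 1 = 0 := by
    have := h.cocycle 1 1
    rw [mul_one, h.map_one] at this
    simpa using this
  have hFy : ∀ φ : V →L[ℝ] ℝ, (∀ n ∈ Z, ∀ v, φ (U n v) = φ v) → φ (b y) = φ (F y) := by
    intro φ hφ
    have h1 : ∀ n : ℕ, φ (b (y ^ n)) = n * φ (b y) := by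
      intro n
      induction n with
      | zero => simp [hb1]
      | succ n ih =>
        rw [pow_succ, h.cocycle, _root_.map_add, hφ y hy, ih]; push_cast; ring
    have h2 : Tendsto (fun n : ℕ => (n : ℝ)⁻¹ * φ (b (y ^ n))) atTop (𝓝 (φ (F y))) := by
      refine ((φ.continuous.tendsto _).comp (h.tendsto y)).congr fun n => ?_
      simp
    refine tendsto_nhds_unique (tendsto_const_nhds.congr' ?_) h2
    filter_upwards [eventually_ne_atTop 0] with n hn
    rw [h1]
    field_simp
  induction n with
  | zero => intro φ _ _; simp [hb1]
  | succ n ih =>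
    intro φ hφ hinv
    have h1 : ∀ m ∈ Z, ∀ v, (φ ∘L U g) (U m v) = (φ ∘L U g) v := by
      intro m hm v
      have h2 : U g (U m v) = U (g⁻¹ * m * g) (U g v) := by
        rw [← h.map_mul, ← h.map_mul]
        congr 2
        group
      have h3 : g⁻¹ * m * g ∈ Z := by
        have := hZ.conj_mem m hm g⁻¹
        rwa [inv_inv] at this
      simp only [ContinuousLinearMap.comp_apply]
      rw [h2, hφ _ h3]
    have h2 := ih (φ ∘L U g) h1 hinv
    simp only [ContinuousLinearMap.comp_apply] at h2
    rw [pow_succ, h.cocycle, h.map_mul, h.cocycle g y, _root_.map_add, _root_.map_add, hφ y hy,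
      hφ y hy, h2, hinv, hFy φ hφ, pow_succ, h.cocycle, _root_.map_add]
    push_cast
    ring

/-- The defect of additivity is fixed by `Z`, hence normed by a `Z`-invariant functional, and such
functionals vanish on it by `functional_pow`. -/
theorem rate_mul (h : IsNormedCocycle U b F) {Z : Subgroup Γ} (g y : Γ) (hZ : Z.Normal)
    (hy : y ∈ Z) (hinv : ∀ g, U g (F y) = F y) (hZF : ∀ n ∈ Z, ∀ s, U n (F s) = F s) :
    F (g * y) = F g + F y := by
  obtain ⟨φ, hφ, hφw⟩ := h.exists_functional Z (F (g * y) - F g - F y) fun n hn => by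
    rw [_root_.map_sub, _root_.map_sub, hZF n hn, hZF n hn, hZF n hn]
  have h1 : ∀ s, Tendsto (fun n : ℕ => (n : ℝ)⁻¹ * φ (b (s ^ n))) atTop (𝓝 (φ (F s))) := by
    intro s
    refine ((φ.continuous.tendsto _).comp (h.tendsto s)).congr fun n => ?_
    simp
  have h2 : φ (F (g * y)) = φ (F g) + φ (F y) := by
    refine tendsto_nhds_unique (h1 (g * y)) (((h1 g).add_const (φ (F y))).congr' ?_)
    filter_upwards [eventually_ne_atTop 0] with n hn
    rw [h.functional_pow g y hZ hy n φ hφ hinv]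
    field_simp
  rw [_root_.map_sub, _root_.map_sub, h2, add_sub_cancel_left, sub_self] at hφw
  have h3 := norm_eq_zero.1 hφw.symm
  rw [sub_sub, sub_eq_zero] at h3
  exact h3

open scoped commutatorElement in
/-- The growth rates of a cocycle of a nilpotent group are invariant vectors. -/
theorem map_rate_eq [Group.IsNilpotent Γ] (h : IsNormedCocycle U b F) (g s : Γ) :
    U g (F s) = F s := by
  -- Ascend the upper central series with either `g` or `s` in its `i`-th term. Conjugation gives `U
  -- g (F s) = F (s c)` with a commutator `c` one term lower, so `F (s c) = F s + F c` with `F c`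
  -- fixed by `g`; boundedness of the orbit then forces `F c = 0`.
  have key : ∀ i : ℕ, ∀ g s : Γ, g ∈ Subgroup.upperCentralSeries Γ i ∨
      s ∈ Subgroup.upperCentralSeries Γ i → U g (F s) = F s := by
    intro i
    induction i with
    | zero =>
      have hb1 : b 1 = 0 := by
        have := h.cocycle 1 1
        rw [mul_one, h.map_one] at this
        simpa using this
      intro g s hgs
      rw [Subgroup.upperCentralSeries_zero, Subgroup.mem_bot, Subgroup.mem_bot] at hgs
      rcases hgs with rfl | rfl
      · exact h.map_one _
      · have : F 1 = 0 := tendsto_nhds_unique (h.tendsto 1) (by simp [hb1])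
        rw [this, _root_.map_zero]
    | succ i ih =>
      intro g s hgs
      have hy : ⁅s⁻¹, g⁻¹⁆ ∈ Subgroup.upperCentralSeries Γ i := by
        rcases hgs with hg | hs
        · rw [← commutatorElement_inv]
          exact inv_mem (Subgroup.mem_upperCentralSeries_succ_iff.1 (inv_mem hg) s⁻¹)
        · exact Subgroup.mem_upperCentralSeries_succ_iff.1 (inv_mem hs) g⁻¹
      have h1 : U g (F s) = F s + F ⁅s⁻¹, g⁻¹⁆ := by
        rw [h.map_rate, ← h.rate_mul (Z := Subgroup.upperCentralSeries Γ i) s _ inferInstance hy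
          (fun g' => ih g' _ (Or.inr hy)) (fun n hn s' => ih n s' (Or.inl hn))]
        congr 1
        rw [commutatorElement_def]
        group
      have h2 := h.eq_zero_of_map_eq_add h1 (ih g _ (Or.inr hy))
      rw [h1, h2, add_zero]
  obtain ⟨n, hn⟩ := Group.IsNilpotent.nilpotent Γ
  exact key n g s (Or.inl (hn ▸ Subgroup.mem_top g))

end IsNormedCocycle

end NormedCocycle

/-! ### Integrable real cocycles of nilpotent groups -/

section MeanErgodic

variable {Γ X : Type*} [Group Γ] [MeasurableSpace X] [MulAction Γ X] [MeasurableConstSMul Γ X]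
  (μ : Measure X) [SMulInvariantMeasure Γ X μ]

/-- The isometry of `L^p` given by composition with an element of the group. -/
def koopman (p : ENNReal) [Fact (1 ≤ p)] (g : Γ) : Lp ℝ p μ →ₗᵢ[ℝ] Lp ℝ p μ :=
  Lp.compMeasurePreservingₗᵢ ℝ (g • ·) (measurePreserving_smul g μ)

variable {μ} in
theorem coeFn_koopman (p : ENNReal) [Fact (1 ≤ p)] (g : Γ) (w : Lp ℝ p μ) :
    koopman μ p g w =ᵐ[μ] fun x => w (g • x) :=
  Lp.coeFn_compMeasurePreserving w (measurePreserving_smul g μ)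

theorem ae_smul (g : Γ) {p : X → Prop} (h : ∀ᵐ x ∂μ, p x) : ∀ᵐ x ∂μ, p (g • x) :=
  (measurePreserving_smul g μ).quasiMeasurePreserving.ae h

variable [IsProbabilityMeasure μ]

/-- The inclusion of `L²` in `L¹`. -/
def lpTwoToOne : Lp ℝ 2 μ →ₗ[ℝ] Lp ℝ 1 μ where
  toFun v := ((Lp.memLp v).mono_exponent (by norm_num)).toLp v
  map_add' v w := by
    refine Lp.ext ?_
    filter_upwards [MemLp.coeFn_toLp ((Lp.memLp (v + w)).mono_exponent (p := 1) (by norm_num)),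
      MemLp.coeFn_toLp ((Lp.memLp v).mono_exponent (p := 1) (by norm_num)),
      MemLp.coeFn_toLp ((Lp.memLp w).mono_exponent (p := 1) (by norm_num)), Lp.coeFn_add v w,
      Lp.coeFn_add (((Lp.memLp v).mono_exponent (p := 1) (by norm_num)).toLp v)
        (((Lp.memLp w).mono_exponent (p := 1) (by norm_num)).toLp w)] with x h1 h2 h3 h4 h5
    rw [h1, h4, h5, Pi.add_apply, Pi.add_apply, h2, h3]
  map_smul' c v := by
    refine Lp.ext ?_
    filter_upwards [MemLp.coeFn_toLp ((Lp.memLp (c • v)).mono_exponent (p := 1) (by norm_num)),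
      MemLp.coeFn_toLp ((Lp.memLp v).mono_exponent (p := 1) (by norm_num)), Lp.coeFn_smul c v,
      Lp.coeFn_smul c (((Lp.memLp v).mono_exponent (p := 1) (by norm_num)).toLp v)]
      with x h1 h2 h4 h5
    rw [h1, h4, RingHom.id_apply, h5, Pi.smul_apply, Pi.smul_apply, h2]

variable {μ} in
theorem coeFn_lpTwoToOne (v : Lp ℝ 2 μ) : lpTwoToOne μ v =ᵐ[μ] v :=
  MemLp.coeFn_toLp ((Lp.memLp v).mono_exponent (by norm_num))

theorem norm_lpTwoToOne_le (v : Lp ℝ 2 μ) : ‖lpTwoToOne μ v‖ ≤ ‖v‖ := by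
  rw [Lp.norm_def, Lp.norm_def, eLpNorm_congr_ae (coeFn_lpTwoToOne v)]
  refine ENNReal.toReal_mono (Lp.memLp v).2.ne ?_
  exact eLpNorm_le_eLpNorm_of_exponent_le (by norm_num) (Lp.memLp v).1

theorem lpTwoToOne_koopman (g : Γ) (v : Lp ℝ 2 μ) :
    lpTwoToOne μ (koopman μ 2 g v) = koopman μ 1 g (lpTwoToOne μ v) := by
  refine Lp.ext ?_
  filter_upwards [coeFn_lpTwoToOne (koopman μ 2 g v), coeFn_koopman 2 g v,
    coeFn_koopman 1 g (lpTwoToOne μ v), ae_smul μ g (coeFn_lpTwoToOne v)] with x h1 h2 h3 h4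
  rw [h1, h2, h3, h4]

theorem norm_birkhoffAverage_sub_le {V : Type*} [NormedAddCommGroup V] [NormedSpace ℝ V]
    (U : V →ₗᵢ[ℝ] V) (n : ℕ) (v w : V) :
    dist (birkhoffAverage ℝ U _root_.id n v) (birkhoffAverage ℝ U _root_.id n w) ≤ dist v w := by
  refine (dist_birkhoffAverage_birkhoffAverage_le ℝ U _root_.id n v w).trans ?_
  have h : ∀ k, dist (U^[k] v) (U^[k] w) = dist v w := fun k => by
    induction k with
    | zero => rfl
    | succ k ih => rw [Function.iterate_succ_apply', Function.iterate_succ_apply', U.dist_map, ih]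
  simp only [id_eq, h, Finset.sum_const, Finset.card_range, nsmul_eq_mul]
  rcases Nat.eq_zero_or_pos n with rfl | hn
  · simp
  · rw [mul_div_cancel_left₀ _ (by positivity)]

/-- The mean ergodic theorem in `L¹`. -/
theorem exists_tendsto_birkhoffAverage_koopman (g : Γ) (w : Lp ℝ 1 μ) :
    ∃ l, Tendsto (fun n => birkhoffAverage ℝ (koopman μ 1 g) _root_.id n w) atTop (𝓝 l) := by
  -- Indicators lie in `L²`, where von Neumann's theorem applies and transfers to `L¹`. The property
  -- passes to sums, and to limits because all averages are `1`-Lipschitz.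
  refine Lp.induction ENNReal.one_ne_top (motive := fun w => ∃ l, Tendsto
    (fun n => birkhoffAverage ℝ (koopman μ 1 g) _root_.id n w) atTop (𝓝 l)) ?_ ?_ ?_ w
  · intro c s hs hμs
    set v : Lp ℝ 2 μ := indicatorConstLp 2 hs hμs.ne c
    have hv : lpTwoToOne μ v = indicatorConstLp 1 hs hμs.ne c := by
      refine Lp.ext ?_
      filter_upwards [coeFn_lpTwoToOne v, indicatorConstLp_coeFn (p := 2) (hs := hs) (hμs := hμs.ne)
        (c := c), indicatorConstLp_coeFn (p := 1) (hs := hs) (hμs := hμs.ne) (c := c)]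
        with x h1 h2 h3
      rw [h1, h3, h2]
    rw [Lp.simpleFunc.coe_indicatorConst, ← hv]
    have h1 := ContinuousLinearMap.tendsto_birkhoffAverage_orthogonalProjection
      (koopman μ 2 g).toContinuousLinearMap (LinearIsometry.norm_toContinuousLinearMap_le _) v
    set J := LinearMap.mkContinuous (lpTwoToOne μ) 1 fun v => by
      rw [one_mul]; exact norm_lpTwoToOne_le μ v
    refine ⟨_, ((J.continuous.tendsto _).comp h1).congr fun n => ?_⟩
    have hsemi : Function.Semiconj J (koopman μ 2 g) (koopman μ 1 g) :=
      fun v => lpTwoToOne_koopman μ g v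
    simp only [Function.comp_apply, birkhoffAverage, birkhoffSum, id_eq, map_smul, map_sum]
    congr 1
    refine Finset.sum_congr rfl fun k _ => ?_
    exact (hsemi.iterate_right k).eq v
  · intro f f' hf hg _ hf' hg'
    obtain ⟨l, hl⟩ := hf'
    obtain ⟨l', hl'⟩ := hg'
    refine ⟨l + l', (hl.add hl').congr fun n => ?_⟩
    have : ∀ k a b, (koopman μ 1 g)^[k] (a + b) =
        (koopman μ 1 g)^[k] a + (koopman μ 1 g)^[k] b := fun k a b => iterate_map_add _ k a b
    simp only [birkhoffAverage, birkhoffSum, id_eq, this, Finset.sum_add_distrib, smul_add]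
  · refine isClosed_of_closure_subset fun w hw => ?_
    refine cauchySeq_tendsto_of_complete ?_
    rw [Metric.cauchySeq_iff']
    intro ε hε
    obtain ⟨v, ⟨l, hl⟩, hvw⟩ := Metric.mem_closure_iff.1 hw (ε / 3) (by positivity)
    obtain ⟨n₀, hn₀⟩ := Metric.cauchySeq_iff'.1 hl.cauchySeq (ε / 3) (by positivity)
    refine ⟨n₀, fun n hn => ?_⟩
    have h1 := norm_birkhoffAverage_sub_le (koopman μ 1 g) n w v
    have h2 := norm_birkhoffAverage_sub_le (koopman μ 1 g) n₀ v w
    have h3 := hn₀ n hn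
    rw [dist_comm v w] at h2
    have h4 := dist_triangle4 (birkhoffAverage ℝ (koopman μ 1 g) _root_.id n w)
      (birkhoffAverage ℝ (koopman μ 1 g) _root_.id n v)
      (birkhoffAverage ℝ (koopman μ 1 g) _root_.id n₀ v)
      (birkhoffAverage ℝ (koopman μ 1 g) _root_.id n₀ w)
    linarith

/-- Integration against the sign of `w` norms `w`, and inherits the invariance of `w` since the
action preserves the measure. -/
theorem exists_invariant_functional (Z : Set Γ) (w : Lp ℝ 1 μ)
    (hw : ∀ n ∈ Z, koopman μ 1 n w = w) : ∃ φ : Lp ℝ 1 μ →L[ℝ] ℝ,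
      (∀ n ∈ Z, ∀ v, φ (koopman μ 1 n v) = φ v) ∧ φ w = ‖w‖ := by
  set σ : ℝ → ℝ := fun t => if 0 ≤ t then 1 else -1 with hσ
  have hσm : Measurable σ := Measurable.ite measurableSet_Ici measurable_const measurable_const
  have hσ1 : ∀ t, ‖σ t‖ ≤ 1 := fun t => by simp only [hσ]; split_ifs <;> simp
  have hσm' : AEStronglyMeasurable (fun x => σ (w x)) μ :=
    (hσm.comp (Lp.stronglyMeasurable w).measurable).aestronglyMeasurable
  have hInt : ∀ v : Lp ℝ 1 μ, Integrable (fun x => σ (w x) * v x) μ := fun v =>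
    (L1.integrable_coeFn v).bdd_mul hσm' (Eventually.of_forall fun x => hσ1 _)
  let φ₀ : Lp ℝ 1 μ →ₗ[ℝ] ℝ :=
    { toFun := fun v => ∫ x, σ (w x) * v x ∂μ
      map_add' := fun v v' => by
        rw [← integral_add (hInt v) (hInt v')]
        refine integral_congr_ae ?_
        filter_upwards [Lp.coeFn_add v v'] with x hx
        rw [hx, Pi.add_apply, mul_add]
      map_smul' := fun c v => by
        rw [RingHom.id_apply, smul_eq_mul, ← integral_const_mul]
        refine integral_congr_ae ?_
        filter_upwards [Lp.coeFn_smul c v] with x hx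
        rw [hx, Pi.smul_apply, smul_eq_mul]
        ring }
  refine ⟨φ₀.mkContinuous 1 fun v => ?_, fun n hn v => ?_, ?_⟩
  · rw [one_mul, L1.norm_eq_integral_norm]
    refine norm_integral_le_of_norm_le (L1.integrable_coeFn v).norm (Eventually.of_forall fun x => ?_)
    rw [norm_mul]
    exact mul_le_of_le_one_left (norm_nonneg _) (hσ1 _)
  · change ∫ x, σ (w x) * koopman μ 1 n v x ∂μ = ∫ x, σ (w x) * v x ∂μ
    rw [← integral_smul_eq_self (fun x => σ (w x) * v x) (g := n)]
    refine integral_congr_ae ?_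
    have h1 := coeFn_koopman 1 n w
    rw [hw n hn] at h1
    filter_upwards [h1, coeFn_koopman 1 n v] with x h2 h3
    rw [h2, h3]
  · change ∫ x, σ (w x) * w x ∂μ = ‖w‖
    rw [L1.norm_eq_integral_norm]
    refine integral_congr_ae (Eventually.of_forall fun x => ?_)
    simp only [hσ, Real.norm_eq_abs]
    split_ifs with h
    · rw [one_mul, abs_of_nonneg h]
    · rw [abs_of_neg (not_le.1 h)]; ring

end MeanErgodic

/-! ### From invariant growth rates to constants. -/

section ErgodicCocycle

variable {Γ X : Type*} [Group Γ] [MeasurableSpace X] [MulAction Γ X] [MeasurableConstSMul Γ X]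
  (μ : Measure X) [IsProbabilityMeasure μ] [ErgodicSMul Γ X μ]

theorem exists_ae_eq_const_of_koopman_eq (w : Lp ℝ 1 μ) (hw : ∀ g : Γ, koopman μ 1 g w = w) :
    ∃ c : ℝ, w =ᵐ[μ] fun _ => c := by
  have hwm := (Lp.stronglyMeasurable w).measurable
  refine exists_eventuallyEq_const_of_forall_separating MeasurableSet fun A hA => ?_
  have h := aeconst_of_forall_preimage_smul_ae_eq Γ (μ := μ) (hwm hA).nullMeasurableSet fun g => by
    have h1 := coeFn_koopman 1 g w
    rw [hw g] at h1
    filter_upwards [h1] with x hx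
    change (w (g • x) ∈ A) = (w x ∈ A)
    rw [← hx]
  rw [eventuallyConst_set] at h
  exact h

/-- The averages of an integrable real cocycle of a nilpotent group along powers converge in mean
to the integral. -/
theorem tendsto_integral_abs_cocycle_sub [Group.IsNilpotent Γ] (f : Γ → X → ℝ)
    (hInt : ∀ g, Integrable (f g) μ)
    (hf : ∀ g h : Γ, ∀ᵐ x ∂μ, f (g * h) x = f g (h • x) + f h x) (s : Γ) :
    Tendsto (fun n : ℕ => ∫ x, |(n : ℝ)⁻¹ * f (s ^ n) x - ∫ y, f s y ∂μ| ∂μ) atTop (𝓝 0) := by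
  set b : Γ → Lp ℝ 1 μ := fun g => (hInt g).toL1 (f g) with hbdef
  have hb : ∀ g, b g =ᵐ[μ] f g := fun g => Integrable.coeFn_toL1 (hInt g)
  set U : Γ → Lp ℝ 1 μ →L[ℝ] Lp ℝ 1 μ := fun g => (koopman μ 1 g).toContinuousLinearMap
  have hU : ∀ g w, U g w = koopman μ 1 g w := fun _ _ => rfl
  have hcoc : ∀ g h, b (g * h) = U h (b g) + b h := by
    intro g h
    refine Lp.ext ?_
    filter_upwards [hb (g * h), hb h, ae_smul μ h (hb g), coeFn_koopman 1 h (b g),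
      Lp.coeFn_add (U h (b g)) (b h), hf g h] with x h1 h2 h3 h4 h5 h6
    rw [h5, Pi.add_apply, hU, h4, h3, h2, h1, h6]
  have hmul : ∀ g h w, U (g * h) w = U h (U g w) := by
    intro g h w
    refine Lp.ext ?_
    filter_upwards [coeFn_koopman 1 (g * h) w, coeFn_koopman 1 h (koopman μ 1 g w),
      ae_smul μ h (coeFn_koopman 1 g w)] with x h1 h2 h3
    rw [hU, hU, hU, h1, h2, h3, mul_smul]
  have hone : ∀ w, U 1 w = w := by
    intro w
    refine Lp.ext ?_
    filter_upwards [coeFn_koopman (Γ := Γ) 1 1 w] with x h1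
    rw [hU, h1, one_smul]
  have hb1 : b 1 = 0 := by
    have := hcoc 1 1
    rw [mul_one, hone] at this
    simpa using this
  have hsum : ∀ g (n : ℕ), b (g ^ n) = birkhoffSum (koopman μ 1 g) _root_.id n (b g) := by
    intro g n
    induction n with
    | zero => simp [hb1]
    | succ n ih =>
      rw [pow_succ, hcoc, ih, hU]
      simp only [birkhoffSum, id_eq, map_sum]
      rw [Finset.sum_range_succ']
      simp only [Function.iterate_succ_apply', Function.iterate_zero, id_eq]
  choose F hF using fun g => exists_tendsto_birkhoffAverage_koopman μ g (b g)
  have hFt : ∀ g, Tendsto (fun n : ℕ => (n : ℝ)⁻¹ • b (g ^ n)) atTop (𝓝 (F g)) := fun g =>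
    (hF g).congr fun n => by rw [birkhoffAverage, hsum]
  have hN : IsNormedCocycle U b F :=
    { norm_map := fun g w => (koopman μ 1 g).norm_map w
      map_mul := hmul
      map_one := hone
      cocycle := hcoc
      tendsto := hFt
      exists_functional := fun Z w hw => exists_invariant_functional μ (Z : Set Γ) w hw }
  -- Here nilpotency replaces ergodicity of the single element `s`: the limit is fixed by all of
  -- `Γ`, and `Γ` acts ergodically.
  obtain ⟨c, hc⟩ := exists_ae_eq_const_of_koopman_eq μ (F s) fun g : Γ => hN.map_rate_eq g s
  have hlim : Tendsto (fun n : ℕ => ∫ x, |(n : ℝ)⁻¹ * f (s ^ n) x - c| ∂μ) atTop (𝓝 0) := by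
    refine (tendsto_iff_norm_sub_tendsto_zero.1 (hFt s)).congr fun n => ?_
    rw [L1.norm_eq_integral_norm]
    refine integral_congr_ae ?_
    filter_upwards [Lp.coeFn_sub ((n : ℝ)⁻¹ • b (s ^ n)) (F s), Lp.coeFn_smul (n : ℝ)⁻¹ (b (s ^ n)),
      hb (s ^ n), hc] with x h1 h2 h3 h4
    rw [h1, Pi.sub_apply, h2, Pi.smul_apply, h3, h4, smul_eq_mul, Real.norm_eq_abs]
  have hmean : ∀ n : ℕ, ∫ x, f (s ^ n) x ∂μ = n * ∫ x, f s x ∂μ := by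
    intro n
    induction n with
    | zero =>
      have : f 1 =ᵐ[μ] 0 := by
        have h := hb 1
        rw [hb1] at h
        exact h.symm.trans (Lp.coeFn_zero ℝ 1 μ)
      rw [pow_zero, integral_congr_ae this]; simp
    | succ n ih =>
      have h1 : Integrable (fun x => f (s ^ n) (s • x)) μ :=
        (measurePreserving_smul s μ).integrable_comp_of_integrable (hInt _)
      rw [pow_succ, integral_congr_ae (hf (s ^ n) s), integral_add h1 (hInt s),
        integral_smul_eq_self (fun x => f (s ^ n) x), ih]
      push_cast
      ring
  -- Convergence in `L¹` preserves integrals, and every normalised average has integral `∫ f s`.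
  have hcm : ∫ y, f s y ∂μ = c := by
    have h1 : Tendsto (fun _ : ℕ => |∫ y, f s y ∂μ - c|) atTop (𝓝 0) := by
      refine squeeze_zero' (Eventually.of_forall fun _ => abs_nonneg _) ?_ hlim
      filter_upwards [eventually_ne_atTop 0] with n hn
      have h2 : ∫ x, ((n : ℝ)⁻¹ * f (s ^ n) x - c) ∂μ = ∫ y, f s y ∂μ - c := by
        rw [integral_sub ((hInt _).const_mul _) (integrable_const c), integral_const_mul, hmean]
        simp only [integral_const, probReal_univ, one_smul]
        field_simp
      rw [← h2]
      exact abs_integral_le_integral_abs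
    have h2 := tendsto_nhds_unique h1 tendsto_const_nhds
    exact sub_eq_zero.1 (abs_eq_zero.1 h2.symm)
  rw [hcm]
  exact hlim

end ErgodicCocycle

/-! ### Integrable cocycles along powers of one element -/

theorem countable_of_closure_eq_top {G : Type*} [Group G] {T : Set G} (hT : T.Finite)
    (hgen : Subgroup.closure T = ⊤) : Countable G := by
  have : Countable (T ∪ T⁻¹ : Set G) := (hT.union hT.inv).countable
  refine Function.Surjective.countable (f := fun l : List (T ∪ T⁻¹ : Set G) =>
    (l.map Subtype.val).prod) fun g => ?_
  obtain ⟨l, _, hl, rfl⟩ := exists_list_length_eq_wordNorm hgen g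
  have hl' : ∀ t ∈ l, t ∈ (T ∪ T⁻¹ : Set G) := fun t ht => by simpa using hl t ht
  lift l to List (T ∪ T⁻¹ : Set G) using hl'
  exact ⟨l, rfl⟩

section Probability

variable {Γ X : Type*} [Group Γ] [MeasurableSpace X] {μ : Measure X} [IsProbabilityMeasure μ]

theorem measureReal_le_of_ae_imp {s t : Set X} (h : ∀ᵐ x ∂μ, x ∈ s → x ∈ t) :
    μ.real s ≤ μ.real t :=
  ENNReal.toReal_mono (measure_ne_top μ t) (measure_mono_ae h)

theorem measureReal_ge_le_div {f : X → ℝ} (hf : ∀ x, 0 ≤ f x) (hInt : Integrable f μ) {θ ε : ℝ}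
    (hθ : ∫ x, f x ∂μ ≤ θ) (hε : 0 < ε) : μ.real {x | ε ≤ f x} ≤ θ / ε := by
  rw [le_div_iff₀ hε, mul_comm]
  exact (mul_meas_ge_le_integral_of_nonneg (Eventually.of_forall hf) hInt ε).trans hθ

theorem exists_integral_tail_le {f : X → ℝ} (hf : ∀ x, 0 ≤ f x) (hInt : Integrable f μ) {θ : ℝ}
    (hθ : 0 < θ) : ∃ K : ℝ, 0 ≤ K ∧ ∃ g : X → ℝ, Integrable g μ ∧ (∀ x, 0 ≤ g x) ∧
      (∀ x, f x ≤ K + g x) ∧ ∫ x, g x ∂μ ≤ θ := by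
  have hg : ∀ n : ℕ, Integrable (fun x => max (f x - n) 0) μ := fun n =>
    (hInt.sub (integrable_const _)).pos_part
  have h := tendsto_integral_of_dominated_convergence (F := fun (n : ℕ) x => max (f x - n) 0)
    (f := fun _ => 0) (μ := μ) f (fun n => (hg n).1) hInt
    (fun n => Eventually.of_forall fun x => by
      rw [Real.norm_of_nonneg (le_max_right _ _)]
      exact max_le (by linarith [(Nat.cast_nonneg n : (0 : ℝ) ≤ n)]) (hf x))
    (Eventually.of_forall fun x => by
      refine tendsto_const_nhds.congr' ?_
      obtain ⟨k, hk⟩ := exists_nat_ge (f x)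
      filter_upwards [eventually_ge_atTop k] with n hn
      have : (k : ℝ) ≤ n := Nat.cast_le.2 hn
      rw [max_eq_right (by linarith)])
  rw [integral_zero] at h
  obtain ⟨n, hn⟩ := (h.eventually_lt_const hθ).exists
  refine ⟨n, Nat.cast_nonneg n, _, hg n, fun x => le_max_right _ _, fun x => ?_, hn.le⟩
  have := le_max_left (f x - n) 0
  linarith

variable [MulAction Γ X] [MeasurableConstSMul Γ X] [SMulInvariantMeasure Γ X μ]

theorem measureReal_setOf_smul (g : Γ) (p : X → Prop) :
    μ.real {x | p (g • x)} = μ.real {x | p x} :=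
  congrArg ENNReal.toReal (measure_preimage_smul μ g {x | p x})

/-- Markov's inequality for ergodic averages. -/
theorem measureReal_average_ge_le (s : Γ) {g : X → ℝ} (hg : ∀ x, 0 ≤ g x) (hInt : Integrable g μ)
    {θ ε : ℝ} (hθ : ∫ x, g x ∂μ ≤ θ) (hε : 0 < ε) {n : ℕ} (hn : n ≠ 0) :
    μ.real {x | ε ≤ (n : ℝ)⁻¹ * ∑ k ∈ Finset.range n, g (s ^ k • x)} ≤ θ / ε := by
  have h1 : ∀ k, Integrable (fun x => g (s ^ k • x)) μ := fun k =>
    (measurePreserving_smul (s ^ k) μ).integrable_comp_of_integrable hInt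
  refine measureReal_ge_le_div (fun x => mul_nonneg (by positivity)
    (Finset.sum_nonneg fun k _ => hg _))
    ((integrable_finsetSum _ fun k _ => h1 k).const_mul _) ?_ hε
  rw [integral_const_mul, integral_finsetSum _ fun k _ => h1 k]
  simp only [integral_smul_eq_self g, Finset.sum_const, Finset.card_range, nsmul_eq_mul]
  rw [← mul_assoc, inv_mul_cancel₀ (by exact_mod_cast hn), one_mul]
  exact hθ

/-- The functions `Z N t` are small with large probability, uniformly in `t ≤ N`, for large
`N`. -/
def UniformlySmall (μ : Measure X) (Z : ℕ → ℕ → X → ℝ) : Prop :=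
  ∀ ε > 0, ∀ η > 0, ∃ N₀, ∀ N ≥ N₀, ∀ t ≤ N, μ.real {x | ε ≤ Z N t x} ≤ η

theorem UniformlySmall.mono {Z Z' : ℕ → ℕ → X → ℝ} (h : UniformlySmall μ Z')
    (hZ : ∀ N t x, Z N t x ≤ Z' N t x) : UniformlySmall μ Z := by
  intro ε hε η hη
  obtain ⟨N₀, hN⟩ := h ε hε η hη
  exact ⟨N₀, fun N hN' t ht => (measureReal_mono fun x hx => hx.trans (hZ N t x)).trans
    (hN N hN' t ht)⟩

theorem UniformlySmall.sum {κ : Type*} (s : Finset κ) {Z : κ → ℕ → ℕ → X → ℝ}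
    (h : ∀ l ∈ s, UniformlySmall μ (Z l)) :
    UniformlySmall μ fun N t x => ∑ l ∈ s, Z l N t x := by
  classical
  induction s using Finset.induction_on with
  | empty =>
    intro ε hε η hη
    refine ⟨0, fun N _ t _ => ?_⟩
    have : {x : X | ε ≤ ∑ l ∈ (∅ : Finset κ), Z l N t x} = ∅ := by
      ext x; simpa using hε
    rw [this]
    simpa using hη.le
  | insert l s hl ih =>
    intro ε hε η hη
    obtain ⟨N₁, h1⟩ := h l (Finset.mem_insert_self _ _) (ε / 2) (half_pos hε) (η / 2) (half_pos hη)
    obtain ⟨N₂, h2⟩ := ih (fun l hl => h l (Finset.mem_insert_of_mem hl)) (ε / 2) (half_pos hε)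
      (η / 2) (half_pos hη)
    refine ⟨max N₁ N₂, fun N hN t ht => ?_⟩
    have h3 := h1 N ((le_max_left _ _).trans hN) t ht
    have h4 := h2 N ((le_max_right _ _).trans hN) t ht
    have hsub : {x : X | ε ≤ ∑ l ∈ insert l s, Z l N t x} ⊆
        {x | ε / 2 ≤ Z l N t x} ∪ {x | ε / 2 ≤ ∑ l ∈ s, Z l N t x} := by
      intro x hx
      simp only [Set.mem_ofPred_eq, Finset.sum_insert hl] at hx
      by_contra hcon
      simp only [Set.mem_union, Set.mem_ofPred_eq, not_or, not_le] at hcon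
      linarith
    have := (measureReal_mono hsub (μ := μ)).trans (measureReal_union_le _ _)
    linarith

end Probability

namespace IsIntegrableCocycle

variable {Γ Λ X : Type*} [Group Γ] [Group Λ] [MeasurableSpace X] {μ : Measure X}
  [IsProbabilityMeasure μ] [MulAction Γ X] [MeasurableConstSMul Γ X] [SMulInvariantMeasure Γ X μ]
  {T : Set Λ} {α : Γ → X → Λ}

theorem ae_one (hα : IsIntegrableCocycle T μ α) : ∀ᵐ x ∂μ, α 1 x = 1 := by
  filter_upwards [hα.cocycle 1 1] with x hx
  rw [one_smul, mul_one] at hx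
  exact left_eq_mul.1 hx

theorem ae_wordNorm_pow_le (hα : IsIntegrableCocycle T μ α) (hT : Subgroup.closure T = ⊤) (s : Γ)
    (n : ℕ) : ∀ᵐ x ∂μ, (wordNorm T (α (s ^ n) x) : ℝ) ≤
      ∑ k ∈ Finset.range n, (wordNorm T (α s (s ^ k • x)) : ℝ) := by
  induction n with
  | zero =>
    filter_upwards [hα.ae_one] with x hx
    rw [pow_zero, hx, wordNorm_one]
    simp
  | succ n ih =>
    filter_upwards [ih, hα.cocycle s (s ^ n)] with x h1 h2
    rw [pow_succ', h2, Finset.sum_range_succ]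
    have : (wordNorm T (α s (s ^ n • x) * α (s ^ n) x) : ℝ) ≤
        wordNorm T (α s (s ^ n • x)) + wordNorm T (α (s ^ n) x) := by
      exact_mod_cast wordNorm_mul_le hT _ _
    linarith

theorem exists_measureReal_wordNorm_ge_le (hα : IsIntegrableCocycle T μ α) (g : Γ) {η : ℝ}
    (hη : 0 < η) : ∃ R : ℝ, 0 < R ∧ μ.real {x | R ≤ (wordNorm T (α g x) : ℝ)} ≤ η := by
  set L := ∫ x, (wordNorm T (α g x) : ℝ) ∂μ
  have hL : 0 ≤ L := integral_nonneg fun x => Nat.cast_nonneg _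
  refine ⟨(L + 1) / η, by positivity, ?_⟩
  refine (measureReal_ge_le_div (θ := L + 1) (fun x => Nat.cast_nonneg _) (hα.integrable g)
    (by linarith) (by positivity)).trans (le_of_eq ?_)
  field_simp

theorem measurable_comp (hα : IsIntegrableCocycle T μ α) (hT : T.Finite)
    (hgen : Subgroup.closure T = ⊤) (g : Γ) (φ : Λ → ℝ) : Measurable fun x => φ (α g x) := by
  have := countable_of_closure_eq_top hT hgen
  intro A _
  have h : (fun x => φ (α g x)) ⁻¹' A = ⋃ l ∈ φ ⁻¹' A, α g ⁻¹' {l} := by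
    ext x; simp
  rw [h]
  exact MeasurableSet.biUnion (Set.to_countable _) fun l _ => hα.measurable g l

end IsIntegrableCocycle

/-! ### The component recursion along nearly proportional factors. -/

namespace LCSSplitting

variable {Γ Λ X 𝔥 : Type*} [Group Γ] [Group Λ] [MeasurableSpace X] {μ : Measure X}
  [IsProbabilityMeasure μ] [MulAction Γ X] [MeasurableConstSMul Γ X]
  {T : Set Λ} {α : Γ → X → Λ} [LieRing 𝔥] [LieAlgebra ℝ 𝔥] [LieRing.IsNilpotent 𝔥]
  [FiniteDimensional ℝ 𝔥] (D : LCSSplitting 𝔥) {ι : Λ → 𝔥}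

theorem abMean_mem (μ : Measure X) (ι : Λ → 𝔥) (α : Γ → X → Λ) (g : Γ)
    (hInt : ∀ i, Integrable (fun x => (Module.finBasis ℝ 𝔥).coord i (D.proj 1 (ι (α g x)))) μ) :
    D.proj 1 (D.abMean μ ι α g) = D.abMean μ ι α g := by
  set b := Module.finBasis ℝ 𝔥
  have h : ∀ φ : 𝔥 →ₗ[ℝ] ℝ, φ (D.abMean μ ι α g) = ∫ x, φ (D.proj 1 (ι (α g x))) ∂μ := by
    intro φ
    have h1 : ∀ z, φ z = ∑ i, b.coord i z * φ (b i) := fun z => by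
      have h0 := congrArg φ (b.sum_repr z).symm
      simpa only [map_sum, map_smul, smul_eq_mul, Module.Basis.coord_apply] using h0
    rw [abMean, map_sum]
    simp only [h1 (D.proj 1 _)]
    rw [integral_finsetSum _ fun i _ => (hInt i).mul_const _]
    refine Finset.sum_congr rfl fun i _ => ?_
    rw [map_smul, smul_eq_mul, integral_mul_const]
  refine b.ext_elem_iff.2 fun i => ?_
  have h1 := h (b.coord i ∘ₗ D.proj 1)
  have h2 := h (b.coord i)
  simp only [LinearMap.comp_apply, D.proj_proj_self] at h1
  rw [Module.Basis.coord_apply] at h1 h2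
  rw [h1, h2]

/-- The nonlinear part vanishes on multiples of one vector `v`. If in degrees below `i` both factors
are within `e` of such multiples, each multiplication therefore perturbs additivity in degree `i` by
`O(e)` only. -/
theorem exists_proj_recursion_le (hr : 1 ≤ LieModule.nilpotencyLength 𝔥 𝔥) (i : ℕ) (v : 𝔥) :
    ∃ C, 0 ≤ C ∧ ∀ (t e : ℝ), 0 ≤ t → t ≤ 1 → 0 ≤ e → e ≤ 1 → ∀ (h w : ℕ → 𝔥) (a b : ℕ → ℝ)
      (m : ℕ), h 0 = 0 →
      (∀ j < m, h (j + 1) = bch (D.scaledBracket t) (LieModule.nilpotencyLength 𝔥 𝔥)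
        (w j) (h j)) →
      (∀ j < m, 0 ≤ a j ∧ a j ≤ 1 ∧ coordNorm 𝔥 (D.trunc i (w j) - a j • v) ≤ e) →
      (∀ j < m, 0 ≤ b j ∧ b j ≤ 1 ∧ coordNorm 𝔥 (D.trunc i (h j) - b j • v) ≤ e) →
      coordNorm 𝔥 (D.proj i (h m)) ≤
        ∑ j ∈ Finset.range m, coordNorm 𝔥 (D.proj i (w j)) + m * (C * e) := by
  obtain ⟨C, hC, hCb⟩ := D.exists_bchTail_sub_le hr (coordNorm 𝔥 v + 1)
  obtain ⟨P, hP, hPb⟩ := D.exists_proj_le i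
  refine ⟨P * C, by positivity, fun t e ht ht1 he he1 h w a b m h0 => ?_⟩
  have hv : 0 ≤ coordNorm 𝔥 v := apply_nonneg _ _
  have hav : ∀ a : ℝ, 0 ≤ a → a ≤ 1 → coordNorm 𝔥 (a • v) ≤ coordNorm 𝔥 v := fun a ha ha1 => by
    rw [map_smul_eq_mul, Real.norm_of_nonneg ha]
    exact mul_le_of_le_one_left hv ha1
  have hbd : ∀ (a : ℝ) (z : 𝔥), 0 ≤ a → a ≤ 1 → coordNorm 𝔥 (z - a • v) ≤ e →
      coordNorm 𝔥 z ≤ coordNorm 𝔥 v + 1 := fun a z ha ha1 hz => by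
    have h1 := map_add_le_add (coordNorm 𝔥) (z - a • v) (a • v)
    rw [sub_add_cancel] at h1
    linarith [hav a ha ha1]
  induction m with
  | zero => intro _ _ _; simp [h0]
  | succ m ih =>
    intro hrec hw hh
    have ih' := ih (fun j hj => hrec j (by omega)) (fun j hj => hw j (by omega))
      (fun j hj => hh j (by omega))
    obtain ⟨ha, ha1, haw⟩ := hw m (Nat.lt_succ_self m)
    obtain ⟨hb, hb1, hbh⟩ := hh m (Nat.lt_succ_self m)
    rw [hrec m (Nat.lt_succ_self m), D.proj_bch t hr, Finset.sum_range_succ]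
    have h1 := hCb t ht ht1 _ _ _ _ e he (hbd _ _ ha ha1 haw) (hbd _ _ hb hb1 hbh)
      ((hav _ ha ha1).trans (by linarith)) ((hav _ hb hb1).trans (by linarith)) haw hbh
    rw [D.bchTail_smul_smul hr, sub_zero] at h1
    have h2 := (hPb _).trans (mul_le_mul_of_nonneg_left h1 hP)
    have h3 := map_add_le_add (coordNorm 𝔥) (D.proj i (w m) + D.proj i (h m))
      (D.proj i (bchTail (D.scaledBracket t) (LieModule.nilpotencyLength 𝔥 𝔥)
        (D.trunc i (w m)) (D.trunc i (h m))))
    have h4 := map_add_le_add (coordNorm 𝔥) (D.proj i (w m)) (D.proj i (h m))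
    push_cast
    linarith

end LCSSplitting

/-! ### Induction on the degree along powers of one element. -/

namespace LCSSplitting

variable {Γ Λ X 𝔥 : Type*} [Group Γ] [Group Λ] [MeasurableSpace X] {μ : Measure X}
  [IsProbabilityMeasure μ] [MulAction Γ X] [MeasurableConstSMul Γ X]
  {T : Set Λ} {α : Γ → X → Λ} [LieRing 𝔥] [LieAlgebra ℝ 𝔥] [LieRing.IsNilpotent 𝔥]
  [FiniteDimensional ℝ 𝔥] (D : LCSSplitting 𝔥) {ι : Λ → 𝔥}

section Invariant

variable [SMulInvariantMeasure Γ X μ]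

theorem integrable_coord (hι : ∀ a b, ι (a * b) = lieMul (ι a) (ι b)) (hT : T.Finite)
    (hgen : Subgroup.closure T = ⊤) (hα : IsIntegrableCocycle T μ α) (g : Γ)
    (φ : 𝔥 →ₗ[ℝ] ℝ) : Integrable (fun x => φ (D.proj 1 (ι (α g x)))) μ := by
  obtain ⟨C, hC, hCb⟩ := D.exists_proj_le_wordNorm hι hT hgen 1
  obtain ⟨P, hP, hPb⟩ := exists_linearMap_le_coordNorm (normSeminorm ℝ ℝ) φ
  refine ((hα.integrable g).const_mul (P * C)).mono'
    (hα.measurable_comp hT hgen g fun l => φ (D.proj 1 (ι l))).aestronglyMeasurable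
    (Eventually.of_forall fun x => ?_)
  refine (hPb _).trans ?_
  rw [mul_assoc]
  refine mul_le_mul_of_nonneg_left ?_ hP
  simpa using hCb (α g x)

/-- If the component of degree `i` converges along powers of `s`, it does so uniformly at all
smaller scales. -/
theorem uniformlySmall_proj (hι : ∀ a b, ι (a * b) = lieMul (ι a) (ι b)) (hT : T.Finite)
    (hgen : Subgroup.closure T = ⊤) (hα : IsIntegrableCocycle T μ α) (s : Γ) {v : 𝔥}
    (hv : v ∈ D.V 1) (i : ℕ)
    (h : ∀ ε > 0, Tendsto (fun n : ℕ => μ.real {x | ε ≤ coordNorm 𝔥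
      (D.proj i (D.dilation (n : ℝ)⁻¹ (ι (α (s ^ n) x)) - v))}) atTop (𝓝 0)) :
    UniformlySmall μ fun N t x => coordNorm 𝔥 (D.proj i (D.dilation (N : ℝ)⁻¹ (ι (α (s ^ t) x)) -
      ((t : ℝ) / N) • v)) := by
  intro ε hε η hη
  rcases Nat.eq_zero_or_pos i with rfl | hi
  · refine ⟨0, fun N _ t _ => ?_⟩
    have : {x : X | ε ≤ coordNorm 𝔥 (D.proj 0 (D.dilation (N : ℝ)⁻¹ (ι (α (s ^ t) x)) -
      ((t : ℝ) / N) • v))} = ∅ := by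
      ext x
      simp only [D.proj_zero, map_zero, Set.mem_ofPred_eq, Set.mem_empty_iff_false, iff_false]
      linarith
    rw [this]
    simpa using hη.le
  obtain ⟨t₀, ht₀⟩ := eventually_atTop.1 ((h ε hε).eventually_le_const hη)
  obtain ⟨C, hC, hCb⟩ := D.exists_proj_le_wordNorm hι hT hgen i
  choose R hR hRb using fun t : ℕ => hα.exists_measureReal_wordNorm_ge_le (s ^ t) hη
  set Q : ℕ → ℝ := fun t => C * R t ^ i + coordNorm 𝔥 (D.proj i (D.dilation t v)) with hQ
  have hQ0 : ∀ t, 0 ≤ Q t := fun t => add_nonneg (mul_nonneg hC (pow_nonneg (hR t).le _))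
    (apply_nonneg _ _)
  obtain ⟨N₁, hN₁⟩ := exists_nat_gt ((∑ t ∈ Finset.range (t₀ + 1), Q t) / ε)
  refine ⟨max N₁ 1, fun N hN t htN => ?_⟩
  have hN0 : (0 : ℝ) < N := by
    have := (le_max_right N₁ 1).trans hN
    exact_mod_cast this
  -- For large `t` the estimate at scale `t` is dilated by `t / N ≤ 1`. For the remaining `t` the
  -- bound `Q t` is divided by `N ^ i ≥ N`.
  by_cases ht : t₀ < t
  · refine le_trans (measureReal_mono ?_) (ht₀ t ht.le)
    intro x hx
    simp only [Set.mem_ofPred_eq] at hx ⊢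
    refine hx.trans ?_
    have ht0 : (0 : ℝ) < t := by exact_mod_cast (Nat.zero_le _).trans_lt ht
    have h1 : D.dilation (N : ℝ)⁻¹ (ι (α (s ^ t) x)) - ((t : ℝ) / N) • v =
        D.dilation ((t : ℝ) / N) (D.dilation (t : ℝ)⁻¹ (ι (α (s ^ t) x)) - v) := by
      rw [map_sub, D.dilation_dilation, D.dilation_of_mem_V_one _ hv]
      congr 3
      field_simp
    rw [h1, D.coordNorm_proj_dilation i (by positivity)]
    refine mul_le_of_le_one_left (apply_nonneg _ _) (pow_le_one₀ (by positivity) ?_)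
    rw [div_le_one hN0]
    exact_mod_cast htN
  · refine le_trans (measureReal_mono ?_) (hRb t)
    intro x hx
    simp only [Set.mem_ofPred_eq] at hx ⊢
    by_contra hcon
    rw [not_le] at hcon
    have h1 : D.dilation (N : ℝ)⁻¹ (ι (α (s ^ t) x)) - ((t : ℝ) / N) • v =
        D.dilation (N : ℝ)⁻¹ (ι (α (s ^ t) x) - D.dilation t v) := by
      rw [map_sub, D.dilation_dilation, D.dilation_of_mem_V_one _ hv]
      congr 2
      field_simp
    rw [h1, D.coordNorm_proj_dilation i (by positivity), map_sub] at hx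
    have h2 : coordNorm 𝔥 (D.proj i (ι (α (s ^ t) x)) - D.proj i (D.dilation t v)) ≤ Q t := by
      refine (map_sub_le_add _ _ _).trans (add_le_add ((hCb _).trans ?_) le_rfl)
      gcongr
    have h3 : Q t ≤ ∑ t ∈ Finset.range (t₀ + 1), Q t :=
      Finset.single_le_sum (fun t _ => hQ0 t) (Finset.mem_range.2 (by omega))
    have h4 : ((N : ℝ)⁻¹) ^ i ≤ (N : ℝ)⁻¹ := by
      refine pow_le_of_le_one (by positivity) (inv_le_one_of_one_le₀ ?_) hi.ne'
      exact_mod_cast (le_max_right N₁ 1).trans hN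
    have h5 : (∑ t ∈ Finset.range (t₀ + 1), Q t) < N * ε := by
      rw [div_lt_iff₀ hε] at hN₁
      refine hN₁.trans_le ?_
      gcongr
      exact (le_max_left N₁ 1).trans hN
    have h6 : (N : ℝ)⁻¹ ^ i * coordNorm 𝔥 (D.proj i (ι (α (s ^ t) x)) - D.proj i (D.dilation t v)) ≤
        (N : ℝ)⁻¹ * ∑ t ∈ Finset.range (t₀ + 1), Q t :=
      mul_le_mul h4 (h2.trans h3) (apply_nonneg _ _) (by positivity)
    have h7 : (N : ℝ)⁻¹ * ∑ t ∈ Finset.range (t₀ + 1), Q t < ε := by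
      rw [inv_mul_lt_iff₀ hN0]; exact h5
    linarith

theorem uniformlySmall_trunc (s : Γ) (v : 𝔥) (i : ℕ)
    (h : ∀ l < i, UniformlySmall μ fun N t x => coordNorm 𝔥 (D.proj l
      (D.dilation (N : ℝ)⁻¹ (ι (α (s ^ t) x)) - ((t : ℝ) / N) • v))) :
    UniformlySmall μ fun N t x => coordNorm 𝔥 (D.trunc i
      (D.dilation (N : ℝ)⁻¹ (ι (α (s ^ t) x)) - ((t : ℝ) / N) • v)) :=
  (UniformlySmall.sum (Finset.range i) fun l hl => h l (Finset.mem_range.1 hl)).mono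
    fun _ _ _ => D.coordNorm_trunc_le i _

/-- The components of degree at least two are negligible once those of smaller degree
converge. -/
theorem tendsto_proj_of_uniformlySmall (hι : ∀ a b, ι (a * b) = lieMul (ι a) (ι b)) (hT : T.Finite)
    (hgen : Subgroup.closure T = ⊤) (hα : IsIntegrableCocycle T μ α) (s : Γ) {v : 𝔥}
    (hv : v ∈ D.V 1) {i : ℕ} (hi : 2 ≤ i)
    (h : UniformlySmall μ fun N t x => coordNorm 𝔥 (D.trunc i
      (D.dilation (N : ℝ)⁻¹ (ι (α (s ^ t) x)) - ((t : ℝ) / N) • v))) {ε : ℝ} (hε : 0 < ε) :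
    Tendsto (fun n : ℕ => μ.real {x | ε ≤ coordNorm 𝔥
      (D.proj i (D.dilation (n : ℝ)⁻¹ (ι (α (s ^ n) x)) - v))}) atTop (𝓝 0) := by
  have hvi : D.proj i v = 0 := D.proj_of_mem_ne (by omega) hv
  simp only [map_sub, hvi, sub_zero]
  by_cases hir : LieModule.nilpotencyLength 𝔥 𝔥 < i
  · refine tendsto_const_nhds.congr fun n => ?_
    have : {x : X | ε ≤ coordNorm 𝔥 (D.proj i (D.dilation (n : ℝ)⁻¹ (ι (α (s ^ n) x))))} = ∅ := by
      ext x
      simp only [D.proj_eq_zero hir, map_zero, Set.mem_ofPred_eq, Set.mem_empty_iff_false,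
        iff_false]
      linarith
    rw [this]
    simp
  have hr : 1 ≤ LieModule.nilpotencyLength 𝔥 𝔥 := by omega
  have htv : D.trunc i v = v := by
    rw [trunc_apply, Finset.sum_eq_single 1, D.proj_of_mem hv]
    · intro j _ hj; exact D.proj_of_mem_ne hj.symm hv
    · intro h1; exact absurd (Finset.mem_range.2 (by omega)) h1
  obtain ⟨A, hA, hAb⟩ := D.exists_proj_le_wordNorm hι hT hgen i
  obtain ⟨C, hC, hCb⟩ := D.exists_proj_recursion_le hr i v
  rw [Metric.tendsto_atTop]
  intro η hη
  -- The factor `2 ^ i` comes from separating the bounded part and the tail in the `i`-th power of a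
  -- sum. The parameters are chosen in the order `η₀`, `K`, `m`, `e`, `N₀`, each depending on the
  -- earlier ones, and the three errors get `ε / 4` each.
  set A' := A * 2 ^ i with hA'
  have hA'0 : 0 ≤ A' := by positivity
  set η₀ := min 1 (ε / (4 * (A' + 1))) with hη₀
  have hη₀0 : 0 < η₀ := by positivity
  have hη₀1 : η₀ ≤ 1 := min_le_left _ _
  have hη₀A : A' * η₀ ≤ ε / 4 := by
    have h1 : η₀ ≤ ε / (4 * (A' + 1)) := min_le_right _ _
    rw [le_div_iff₀ (by positivity)] at h1
    nlinarith
  -- The word norm is split as `K + g`; the bound on `∫ g` makes Markov's inequality at level `η₀`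
  -- cost probability `η / 4`.
  obtain ⟨K, hK, g, hgint, hg0, hgK, hgθ⟩ := exists_integral_tail_le (μ := μ)
    (f := fun x => (wordNorm T (α s x) : ℝ)) (fun x => Nat.cast_nonneg _) (hα.integrable s)
    (θ := η / 4 * η₀) (by positivity)
  -- The number of blocks: their bounded parts add up to at most `m A' (2K)^i / m²`, and `i ≥ 2` is
  -- what makes this small.
  obtain ⟨m, hm⟩ := exists_nat_gt (max 1 (A' * (2 * K) ^ i / (ε / 4)))
  have hm1 : (1 : ℝ) < m := (le_max_left _ _).trans_lt hm
  have hm0 : (0 : ℝ) < m := by linarith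
  have hmA : A' * (2 * K) ^ i < m * (ε / 4) := by
    have := (le_max_right _ _).trans_lt hm
    rwa [div_lt_iff₀ (by positivity)] at this
  -- The recursion error accumulates over the blocks, hence the factor `m` in the denominator; `e ≤
  -- 1` keeps all vectors in a fixed bounded set.
  set e := min 1 (ε / (4 * (m * C + 1))) with he
  have he0 : 0 < e := by positivity
  have heC : m * (C * e) ≤ ε / 4 := by
    have h1 : e ≤ ε / (4 * (m * C + 1)) := min_le_right _ _
    rw [le_div_iff₀ (by positivity)] at h1
    nlinarith
  obtain ⟨N₀, hN₀⟩ := h e he0 (η / (8 * m)) (by positivity)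
  refine ⟨max N₀ m, fun N hN => ?_⟩
  have hNN₀ : N₀ ≤ N := (le_max_left _ _).trans hN
  have hNm : m ≤ N := (le_max_right _ _).trans hN
  have hmpos : 0 < m := by exact_mod_cast hm0
  have hNpos : 0 < N := hmpos.trans_le hNm
  have hN0 : (0 : ℝ) < N := by exact_mod_cast hNpos
  have hNmR : (m : ℝ) ≤ N := by exact_mod_cast hNm
  -- Rounding up makes `m` blocks cover `[0, N]`, with the last cut points capped at `N`. As `m ≤
  -- N`, a block still has length at most `2 N / m`.
  set p := N / m + 1 with hp
  set τ : ℕ → ℕ := fun j => min N (j * p) with hτ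
  have hτN : ∀ j, τ j ≤ N := fun j => min_le_left _ _
  have hτ0 : τ 0 = 0 := by simp [hτ]
  have hτmono : ∀ j, τ j ≤ τ (j + 1) := fun j =>
    min_le_min le_rfl (Nat.mul_le_mul_right _ (Nat.le_succ j))
  have hτm : τ m = N := by
    refine min_eq_left ?_
    have h1 := Nat.div_add_mod N m
    have h2 := Nat.mod_lt N hmpos
    rw [hp, mul_add, mul_one]
    omega
  set ν : ℕ → ℕ := fun j => τ (j + 1) - τ j with hν
  have hντ : ∀ j, ν j + τ j = τ (j + 1) := fun j => Nat.sub_add_cancel (hτmono j)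
  have hνN : ∀ j, ν j ≤ N := fun j => (Nat.sub_le _ _).trans (hτN _)
  have hνp : ∀ j, ν j ≤ p := fun j => by
    have aux : ∀ a b c : ℕ, min a (b + c) - min a b ≤ c := fun a b c => by omega
    simp only [hν, hτ, add_mul, one_mul]
    exact aux _ _ _
  have hpN : (p : ℝ) / N ≤ 2 / m := by
    rw [div_le_div_iff₀ hN0 hm0, hp]
    push_cast
    have h1 : ((N / m : ℕ) : ℝ) ≤ (N : ℝ) / m := Nat.cast_div_le
    rw [le_div_iff₀ hm0] at h1
    nlinarith
  set B₁ : ℕ → Set X := fun j => {x | e ≤ coordNorm 𝔥 (D.trunc i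
      (D.dilation (N : ℝ)⁻¹ (ι (α (s ^ ν j) (s ^ τ j • x))) - ((ν j : ℝ) / N) • v))} with hB₁
  set B₂ : ℕ → Set X := fun j => {x | e ≤ coordNorm 𝔥 (D.trunc i
      (D.dilation (N : ℝ)⁻¹ (ι (α (s ^ τ j) x)) - ((τ j : ℝ) / N) • v))} with hB₂
  set B₃ : Set X := {x | η₀ ≤ (N : ℝ)⁻¹ * ∑ k ∈ Finset.range N, g (s ^ k • x)} with hB₃
  -- A block starting at time `τ j` is a power of `s` evaluated at `s ^ τ j • x`, and the measure is
  -- invariant under that translation.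
  have hB₁m : ∀ j, μ.real (B₁ j) ≤ η / (8 * m) := fun j => by
    rw [hB₁, measureReal_setOf_smul (μ := μ) (s ^ τ j) (fun x => e ≤ coordNorm 𝔥 (D.trunc i
      (D.dilation (N : ℝ)⁻¹ (ι (α (s ^ ν j) x)) - ((ν j : ℝ) / N) • v)))]
    exact hN₀ N hNN₀ _ (hνN j)
  have hB₂m : ∀ j, μ.real (B₂ j) ≤ η / (8 * m) := fun j => hN₀ N hNN₀ _ (hτN j)
  have hB₃m : μ.real B₃ ≤ η / 4 := by
    have := measureReal_average_ge_le (μ := μ) s hg0 hgint hgθ hη₀0 hNpos.ne'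
    rwa [mul_div_assoc, div_self hη₀0.ne', mul_one] at this
  have hcoc : ∀ᵐ x ∂μ, ∀ j, α (s ^ τ (j + 1)) x = α (s ^ ν j) (s ^ τ j • x) * α (s ^ τ j) x := by
    rw [ae_all_iff]
    intro j
    have := hα.cocycle (s ^ ν j) (s ^ τ j)
    rwa [← pow_add, hντ] at this
  have hword : ∀ᵐ x ∂μ, ∀ j, (wordNorm T (α (s ^ ν j) (s ^ τ j • x)) : ℝ) ≤
      ∑ k ∈ Finset.range (ν j), (wordNorm T (α s (s ^ (τ j + k) • x)) : ℝ) := by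
    rw [ae_all_iff]
    intro j
    filter_upwards [ae_smul μ (s ^ τ j) (hα.ae_wordNorm_pow_le hgen s (ν j))] with x hx
    refine hx.trans (le_of_eq (Finset.sum_congr rfl fun k _ => ?_))
    rw [smul_smul, ← pow_add, add_comm]
  -- Off the bad events the blocks and partial products are nearly proportional to `v` below degree
  -- `i`, and the tail averages less than `η₀`. The recursion then bounds the component by `3 ε /
  -- 4`.
  have hincl : ∀ᵐ x ∂μ, x ∈ {x : X | ε ≤ coordNorm 𝔥
      (D.proj i (D.dilation (N : ℝ)⁻¹ (ι (α (s ^ N) x))))} →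
      x ∈ ((⋃ j ∈ Finset.range m, B₁ j) ∪ ⋃ j ∈ Finset.range m, B₂ j) ∪ B₃ := by
    filter_upwards [hcoc, hword, hα.ae_one] with x hx1 hx2 hx3 hx
    by_contra hcon
    simp only [Set.mem_union, Set.mem_iUnion, not_or, not_exists, Finset.mem_range] at hcon
    obtain ⟨⟨hc1, hc2⟩, hc3⟩ := hcon
    simp only [hB₁, hB₂, hB₃, Set.mem_ofPred_eq, not_le] at hc1 hc2 hc3 hx
    have hrat : ∀ n : ℕ, n ≤ N → (0 : ℝ) ≤ (n : ℝ) / N ∧ (n : ℝ) / N ≤ 1 := fun n hn =>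
      ⟨by positivity, by rw [div_le_one hN0]; exact_mod_cast hn⟩
    have key := hCb (N : ℝ)⁻¹ e (by positivity)
      (inv_le_one_of_one_le₀ (by exact_mod_cast hNpos)) he0.le (min_le_left _ _)
      (fun j => D.dilation (N : ℝ)⁻¹ (ι (α (s ^ τ j) x)))
      (fun j => D.dilation (N : ℝ)⁻¹ (ι (α (s ^ ν j) (s ^ τ j • x))))
      (fun j => (ν j : ℝ) / N) (fun j => (τ j : ℝ) / N) m
      (by simp only [hτ0, pow_zero, hx3, D.map_one_eq_zero hι, map_zero])
      (fun j _ => by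
        rw [hx1 j, hι, D.dilation_lieMul (mul_inv_cancel₀ hN0.ne')])
      (fun j hj => by
        have h1 := (hc1 j hj).le
        rw [map_sub, map_smul, htv] at h1
        exact ⟨(hrat _ (hνN j)).1, (hrat _ (hνN j)).2, h1⟩)
      (fun j hj => by
        have h1 := (hc2 j hj).le
        rw [map_sub, map_smul, htv] at h1
        exact ⟨(hrat _ (hτN j)).1, (hrat _ (hτN j)).2, h1⟩)
    simp only [hτm] at key
    set W : ℕ → ℝ := fun j => (N : ℝ)⁻¹ * ∑ k ∈ Finset.range (ν j), g (s ^ (τ j + k) • x) with hW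
    have hW0 : ∀ j, 0 ≤ W j := fun j =>
      mul_nonneg (by positivity) (Finset.sum_nonneg fun k _ => hg0 _)
    have hWsum : ∑ j ∈ Finset.range m, W j = (N : ℝ)⁻¹ * ∑ k ∈ Finset.range N, g (s ^ k • x) := by
      rw [← Finset.mul_sum]
      congr 1
      have h1 : ∀ j, ∑ l ∈ Finset.range j, ∑ k ∈ Finset.range (ν l), g (s ^ (τ l + k) • x) =
          ∑ k ∈ Finset.range (τ j), g (s ^ k • x) := by
        intro j
        induction j with
        | zero => simp [hτ0]
        | succ j ih =>
          rw [Finset.sum_range_succ, ih, ← hντ j, add_comm (ν j),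
            Finset.sum_range_add (fun k => g (s ^ k • x))]
      rw [h1, hτm]
    have hWlt : ∑ j ∈ Finset.range m, W j < η₀ := by rw [hWsum]; exact hc3
    have hW1 : ∀ j ∈ Finset.range m, W j ≤ 1 := fun j hj =>
      ((Finset.single_le_sum (fun l _ => hW0 l) hj).trans hWlt.le).trans hη₀1
    have hterm : ∀ j ∈ Finset.range m, coordNorm 𝔥 (D.proj i
        (D.dilation (N : ℝ)⁻¹ (ι (α (s ^ ν j) (s ^ τ j • x))))) ≤
        A' * ((2 * K) ^ i / m ^ 2) + A' * W j := by
      intro j hj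
      rw [D.coordNorm_proj_dilation i (by positivity)]
      have h1 : (N : ℝ)⁻¹ * (wordNorm T (α (s ^ ν j) (s ^ τ j • x)) : ℝ) ≤ 2 * K / m + W j := by
        have h2 : (wordNorm T (α (s ^ ν j) (s ^ τ j • x)) : ℝ) ≤
            ν j * K + ∑ k ∈ Finset.range (ν j), g (s ^ (τ j + k) • x) := by
          refine (hx2 j).trans ((Finset.sum_le_sum fun k _ => hgK _).trans (le_of_eq ?_))
          rw [Finset.sum_add_distrib, Finset.sum_const, Finset.card_range, nsmul_eq_mul]
        have h3 : (ν j : ℝ) / N ≤ 2 / m := by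
          refine le_trans ?_ hpN
          gcongr
          exact hνp j
        calc _ ≤ (N : ℝ)⁻¹ * (ν j * K + ∑ k ∈ Finset.range (ν j), g (s ^ (τ j + k) • x)) := by
              gcongr
          _ = ((ν j : ℝ) / N) * K + W j := by rw [hW]; ring
          _ ≤ (2 / m) * K + W j := by gcongr
          _ = _ := by ring
      have h4 : (2 * K / m) ^ i ≤ (2 * K) ^ i / m ^ 2 := by
        rw [div_pow]
        gcongr
        exact hm1.le
      calc _ ≤ (N : ℝ)⁻¹ ^ i * (A * (wordNorm T (α (s ^ ν j) (s ^ τ j • x)) : ℝ) ^ i) := by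
            gcongr
            exact hAb _
        _ = A * ((N : ℝ)⁻¹ * (wordNorm T (α (s ^ ν j) (s ^ τ j • x)) : ℝ)) ^ i := by
            rw [mul_pow]; ring
        _ ≤ A * (2 * K / m + W j) ^ i := by gcongr
        _ ≤ A * (2 ^ (i - 1) * ((2 * K / m) ^ i + W j ^ i)) := by
            gcongr
            exact add_pow_le (by positivity) (hW0 j) i
        _ ≤ A * (2 ^ i * ((2 * K) ^ i / m ^ 2 + W j)) := by
            have := hW0 j
            -- Since `W j ≤ 1` the power may be dropped, so that the tails of the blocks add up
            -- linearly to the total average.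
            have h5 : W j ^ i ≤ W j := pow_le_of_le_one (hW0 j) (hW1 j hj) (by omega)
            gcongr
            · norm_num
            · omega
        _ = _ := by rw [hA']; ring
    have htot := key.trans (add_le_add (Finset.sum_le_sum hterm) heC)
    rw [Finset.sum_add_distrib, Finset.sum_const, Finset.card_range, nsmul_eq_mul,
      ← Finset.mul_sum] at htot
    have h6 : (m : ℝ) * (A' * ((2 * K) ^ i / m ^ 2)) ≤ ε / 4 := by
      have h7 : (m : ℝ) * (A' * ((2 * K) ^ i / m ^ 2)) = A' * (2 * K) ^ i / m := by
        field_simp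
      rw [h7, div_le_iff₀ hm0]
      linarith
    have h8 : A' * ∑ j ∈ Finset.range m, W j ≤ ε / 4 :=
      (mul_le_mul_of_nonneg_left hWlt.le hA'0).trans hη₀A
    linarith
  have hunion : ∀ B : ℕ → Set X, (∀ j, μ.real (B j) ≤ η / (8 * m)) →
      μ.real (⋃ j ∈ Finset.range m, B j) ≤ η / 8 := by
    intro B hB
    refine (measureReal_biUnion_finset_le _ _).trans ((Finset.sum_le_sum fun j _ => hB j).trans ?_)
    rw [Finset.sum_const, Finset.card_range, nsmul_eq_mul]
    refine le_of_eq ?_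
    field_simp
  have hfin := (measureReal_le_of_ae_imp hincl).trans ((measureReal_union_le _ _).trans
    (add_le_add ((measureReal_union_le _ _).trans (add_le_add (hunion B₁ hB₁m) (hunion B₂ hB₂m)))
      hB₃m))
  rw [Real.dist_eq, sub_zero, abs_of_nonneg measureReal_nonneg]
  linarith

end Invariant

end LCSSplitting

theorem UniformlySmall.tendsto {X : Type*} [MeasurableSpace X] {μ : Measure X}
    {Z : ℕ → ℕ → X → ℝ} (h : UniformlySmall μ Z) {M t : ℕ → ℕ} (hM : Tendsto M atTop atTop)
    (ht : ∀ n, t n ≤ M n) {ε : ℝ} (hε : 0 < ε) :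
    Tendsto (fun n => μ.real {x | ε ≤ Z (M n) (t n) x}) atTop (𝓝 0) := by
  rw [Metric.tendsto_atTop]
  intro η hη
  obtain ⟨N₀, hN₀⟩ := h ε hε (η / 2) (half_pos hη)
  obtain ⟨n₀, hn₀⟩ := eventually_atTop.1 (hM.eventually_ge_atTop N₀)
  refine ⟨n₀, fun n hn => ?_⟩
  rw [Real.dist_eq, sub_zero, abs_of_nonneg measureReal_nonneg]
  linarith [hN₀ (M n) (hn₀ n hn) (t n) (ht n)]

/-! ### Convergence in probability along powers and along products of powers. -/

namespace LCSSplitting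

variable {Γ Λ X 𝔥 : Type*} [Group Γ] [Group Λ] [MeasurableSpace X] {μ : Measure X}
  [IsProbabilityMeasure μ] [MulAction Γ X] [MeasurableConstSMul Γ X]
  {T : Set Λ} {α : Γ → X → Λ} [LieRing 𝔥] [LieAlgebra ℝ 𝔥] [LieRing.IsNilpotent 𝔥]
  [FiniteDimensional ℝ 𝔥] (D : LCSSplitting 𝔥) {ι : Λ → 𝔥}
  [ErgodicSMul Γ X μ] [Group.IsNilpotent Γ]

theorem abMean_mem_V_one (hι : ∀ a b, ι (a * b) = lieMul (ι a) (ι b)) (hT : T.Finite)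
    (hgen : Subgroup.closure T = ⊤) (hα : IsIntegrableCocycle T μ α) (s : Γ) :
    D.abMean μ ι α s ∈ D.V 1 := by
  rw [← D.abMean_mem μ ι α s fun i => D.integrable_coord hι hT hgen hα s _]
  exact D.proj_mem 1 _

/-- The coordinates of degree one are integrable real cocycles; their convergence in mean passes to
probability by Markov's inequality. -/
theorem tendsto_proj_one (hι : ∀ a b, ι (a * b) = lieMul (ι a) (ι b)) (hT : T.Finite)
    (hgen : Subgroup.closure T = ⊤) (hα : IsIntegrableCocycle T μ α) (s : Γ) {ε : ℝ}
    (hε : 0 < ε) : Tendsto (fun n : ℕ => μ.real {x | ε ≤ coordNorm 𝔥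
      (D.proj 1 (D.dilation (n : ℝ)⁻¹ (ι (α (s ^ n) x)) - D.abMean μ ι α s))}) atTop (𝓝 0) := by
  set b := Module.finBasis ℝ 𝔥
  set f : Fin (Module.finrank ℝ 𝔥) → Γ → X → ℝ := fun j g x => b.coord j (D.proj 1 (ι (α g x)))
    with hf
  have hInt : ∀ j g, Integrable (f j g) μ := fun j g => D.integrable_coord hι hT hgen hα g _
  have hlim := fun j => tendsto_integral_abs_cocycle_sub μ (f j) (hInt j) (fun g h => by
    filter_upwards [hα.cocycle g h] with x hx
    simp only [hf]
    rw [hx, hι, D.proj_lieMul_one, map_add]) s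
  have hcoord : ∀ j, b.coord j (D.abMean μ ι α s) = ∫ y, f j s y ∂μ := fun j => by
    rw [abMean, map_sum, Finset.sum_eq_single j]
    · rw [map_smul, Module.Basis.coord_apply, Module.Basis.repr_self, Finsupp.single_eq_same,
        smul_eq_mul, mul_one]
    · intro i _ hij
      rw [map_smul, Module.Basis.coord_apply, Module.Basis.repr_self,
        Finsupp.single_eq_of_ne hij.symm, smul_zero]
    · simp
  have heq : ∀ (n : ℕ) x, coordNorm 𝔥
      (D.proj 1 (D.dilation (n : ℝ)⁻¹ (ι (α (s ^ n) x)) - D.abMean μ ι α s)) =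
      ∑ j, |(n : ℝ)⁻¹ * f j (s ^ n) x - ∫ y, f j s y ∂μ| := fun n x => by
    rw [coordNorm_apply]
    refine Finset.sum_congr rfl fun j _ => ?_
    rw [map_sub, D.proj_dilation, pow_one,
      D.abMean_mem μ ι α s fun i => D.integrable_coord hι hT hgen hα s _, map_sub, map_smul,
      smul_eq_mul, hcoord]
  have hInt' : ∀ (n : ℕ) j, Integrable
      (fun x => |(n : ℝ)⁻¹ * f j (s ^ n) x - ∫ y, f j s y ∂μ|) μ := fun n j =>
    (((hInt j (s ^ n)).const_mul _).sub (integrable_const _)).abs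
  have hsum : Tendsto (fun n : ℕ => (∑ j, ∫ x, |(n : ℝ)⁻¹ * f j (s ^ n) x - ∫ y, f j s y ∂μ| ∂μ) / ε)
      atTop (𝓝 0) := by
    have := (tendsto_finsetSum Finset.univ fun j _ => hlim j).div_const ε
    simpa using this
  refine squeeze_zero (fun _ => measureReal_nonneg) (fun n => ?_) hsum
  simp only [heq]
  refine measureReal_ge_le_div (fun x => Finset.sum_nonneg fun j _ => abs_nonneg _)
    (integrable_finsetSum _ fun j _ => hInt' n j) (le_of_eq ?_) hε
  exact integral_finsetSum _ fun j _ => hInt' n j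

theorem trunc_eq_self (x : 𝔥) : D.trunc (LieModule.nilpotencyLength 𝔥 𝔥 + 1) x = x := by
  have h := D.sub_trunc_mem_fil (LieModule.nilpotencyLength 𝔥 𝔥 + 1) x
  rw [D.fil_eq_bot (Nat.lt_succ_self _), Submodule.mem_bot, sub_eq_zero] at h
  exact h.symm

/-- Along the powers of one element the rescaled cocycle converges in probability to its abelian
mean, uniformly at all smaller scales. -/
theorem uniformlySmall_dilation_sub (hι : ∀ a b, ι (a * b) = lieMul (ι a) (ι b)) (hT : T.Finite)
    (hgen : Subgroup.closure T = ⊤) (hα : IsIntegrableCocycle T μ α) (s : Γ) :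
    UniformlySmall μ fun N t x => coordNorm 𝔥 (D.dilation (N : ℝ)⁻¹ (ι (α (s ^ t) x)) -
      ((t : ℝ) / N) • D.abMean μ ι α s) := by
  have hv := D.abMean_mem_V_one hι hT hgen hα s
  have key : ∀ i, UniformlySmall μ fun N t x => coordNorm 𝔥 (D.proj i
      (D.dilation (N : ℝ)⁻¹ (ι (α (s ^ t) x)) - ((t : ℝ) / N) • D.abMean μ ι α s)) := by
    intro i
    induction i using Nat.strong_induction_on with
    | _ i ih =>
      -- Convergence at the final time suffices in each degree. Degree one is the ergodic input, and
      -- higher degrees follow from uniform control of all lower ones.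
      refine D.uniformlySmall_proj hι hT hgen hα s hv i fun ε hε => ?_
      rcases Nat.lt_or_ge i 2 with hi | hi
      · rcases (by omega : i = 0 ∨ i = 1) with rfl | rfl
        · refine tendsto_const_nhds.congr fun n => ?_
          simp only [D.proj_zero, map_zero, not_le.2 hε]
          simp
        · exact D.tendsto_proj_one hι hT hgen hα s hε
      · exact D.tendsto_proj_of_uniformlySmall hι hT hgen hα s hv hi
          (D.uniformlySmall_trunc s _ i ih) hε
  have h := D.uniformlySmall_trunc s _ (LieModule.nilpotencyLength 𝔥 𝔥 + 1) fun l _ => key l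
  simpa only [D.trunc_eq_self] using h

/-- Split off the first power: by the cocycle identity it is evaluated at `γ n • x`, where
invariance of the measure preserves its convergence in probability. The uniform bound `R` keeps the
products where the series is Lipschitz. -/
theorem exists_tendsto_product (hι : ∀ a b, ι (a * b) = lieMul (ι a) (ι b)) (hT : T.Finite)
    (hgen : Subgroup.closure T = ⊤) (hα : IsIntegrableCocycle T μ α) {k : ℕ} (s : Fin k → Γ)
    (a : ℕ → Fin k → ℕ) (M : ℕ → ℕ) (hM : Tendsto M atTop atTop) (haM : ∀ n i, a n i ≤ M n) :
    ∃ R, (∀ n, coordNorm 𝔥 ((List.ofFn fun i =>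
        ((a n i : ℝ) / M n) • D.abMean μ ι α (s i)).foldr D.star 0) ≤ R) ∧
      ∀ ε > 0, Tendsto (fun n => μ.real {x | ε ≤ coordNorm 𝔥
        (D.dilation (M n : ℝ)⁻¹ (ι (α (List.ofFn fun i => s i ^ a n i).prod x)) -
          (List.ofFn fun i => ((a n i : ℝ) / M n) • D.abMean μ ι α (s i)).foldr D.star 0)})
        atTop (𝓝 0) := by
  induction k with
  | zero =>
    refine ⟨0, fun n => by simp, fun ε hε => tendsto_const_nhds.congr fun n => Eq.symm ?_⟩
    refine le_antisymm ?_ measureReal_nonneg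
    refine (measureReal_le_of_ae_imp (t := ∅) ?_).trans (by simp)
    filter_upwards [hα.ae_one] with x hx h
    simp only [List.ofFn_zero, List.prod_nil, List.foldr_nil, hx,
      D.map_one_eq_zero hι, map_zero, sub_zero] at h
    exact absurd h (not_le.2 hε)
  | succ k ih =>
    obtain ⟨R, hR, hlim⟩ := ih (fun i => s i.succ) (fun n i => a n i.succ) (fun n i => haM n _)
    set v := D.abMean μ ι α (s 0)
    set P : ℕ → 𝔥 := fun n => (List.ofFn fun i : Fin k =>
      ((a n i.succ : ℝ) / M n) • D.abMean μ ι α (s i.succ)).foldr D.star 0 with hP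
    set γ : ℕ → Γ := fun n => (List.ofFn fun i : Fin k => s i.succ ^ a n i.succ).prod with hγ
    simp only [List.ofFn_succ, List.foldr_cons, List.prod_cons]
    obtain ⟨K, hK, hKB⟩ := D.exists_scaledBracket_le
    set R' := max (coordNorm 𝔥 v) R + 1 with hR'
    obtain ⟨C₁, hC₁, h1⟩ := exists_bch_le (coordNorm 𝔥) (LieModule.nilpotencyLength 𝔥 𝔥) K R'
    obtain ⟨C, hC, h2⟩ := exists_bch_sub_le (coordNorm 𝔥) (LieModule.nilpotencyLength 𝔥 𝔥) K R'
    have hv0 : ∀ n, coordNorm 𝔥 (((a n 0 : ℝ) / M n) • v) ≤ max (coordNorm 𝔥 v) R := fun n => by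
      rw [map_smul_eq_mul, Real.norm_of_nonneg (by positivity)]
      refine (mul_le_of_le_one_left (apply_nonneg _ _) ?_).trans (le_max_left _ _)
      refine div_le_one_of_le₀ ?_ (Nat.cast_nonneg _)
      exact_mod_cast haM n 0
    have hP0 : ∀ n, coordNorm 𝔥 (P n) ≤ max (coordNorm 𝔥 v) R := fun n =>
      (hR n).trans (le_max_right _ _)
    have hstar : ∀ x y, D.star x y = bch (D.scaledBracket 0) (LieModule.nilpotencyLength 𝔥 𝔥) x y :=
      fun x y => by rw [star, D.scaledBracket_zero]
    have hB0 := fun u v => (hKB 0 le_rfl zero_le_one u v).1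
    refine ⟨C₁, fun n => ?_, fun ε hε => ?_⟩
    · rw [hstar]
      exact h1 _ _ _ hB0 ((hv0 n).trans (by linarith)) ((hP0 n).trans (by linarith))
    set e := min 1 (ε / (2 * (C + 1))) with he
    have he0 : 0 < e := by positivity
    have heC : C * e ≤ ε / 2 := by
      have h3 : e ≤ ε / (2 * (C + 1)) := min_le_right _ _
      rw [le_div_iff₀ (by positivity)] at h3
      nlinarith
    have hlim1 := (D.uniformlySmall_dilation_sub hι hT hgen hα (s 0)).tendsto hM
      (fun n => haM n 0) he0
    -- The cost of replacing the rescaled group law by `⋆`, proportional to `1 / M n`.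
    have hsmall : ∀ᶠ n in atTop, C * (K * (M n : ℝ)⁻¹) < ε / 2 := by
      have h3 : Tendsto (fun n => C * (K * (M n : ℝ)⁻¹)) atTop (𝓝 (C * (K * 0))) :=
        ((tendsto_inv_atTop_zero.comp (tendsto_natCast_atTop_atTop.comp hM)).const_mul K).const_mul C
      exact h3.eventually_lt_const (by simpa using half_pos hε)
    refine squeeze_zero' (Eventually.of_forall fun _ => measureReal_nonneg) ?_
      (by simpa using hlim1.add (hlim e he0))
    filter_upwards [hsmall, hM.eventually_ge_atTop 1] with n hn hMn
    have hM0 : (0 : ℝ) < M n := by exact_mod_cast hMn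
    have hM1 : (M n : ℝ)⁻¹ ≤ 1 := inv_le_one_of_one_le₀ (by exact_mod_cast hMn)
    rw [← measureReal_setOf_smul (μ := μ) (γ n) (fun x => e ≤ coordNorm 𝔥
      (D.dilation (M n : ℝ)⁻¹ (ι (α (s 0 ^ a n 0) x)) - ((a n 0 : ℝ) / M n) • v))]
    refine (measureReal_le_of_ae_imp ?_).trans (measureReal_union_le _ _)
    filter_upwards [hα.cocycle (s 0 ^ a n 0) (γ n)] with x hx hbad
    by_contra hcon
    simp only [Set.mem_union, Set.mem_ofPred_eq, not_or, not_le] at hcon hbad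
    obtain ⟨hc1, hc2⟩ := hcon
    rw [hx, hι, D.dilation_lieMul (mul_inv_cancel₀ hM0.ne'), hstar] at hbad
    have hbd : ∀ z w : 𝔥, coordNorm 𝔥 (z - w) < e → coordNorm 𝔥 w ≤ max (coordNorm 𝔥 v) R →
        coordNorm 𝔥 z ≤ R' := fun z w hz hw => by
      have h3 := map_add_le_add (coordNorm 𝔥) (z - w) w
      rw [sub_add_cancel] at h3
      have h4 : e ≤ 1 := min_le_left _ _
      linarith
    have h5 := h2 (D.scaledBracket (M n : ℝ)⁻¹) (D.scaledBracket 0) (K * (M n : ℝ)⁻¹) e _ _ _ _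
      (by positivity) he0.le (fun u w => (hKB _ (by positivity) hM1 u w).1) hB0
      (fun u w => (hKB _ (by positivity) hM1 u w).2)
      (hbd _ _ hc1 (hv0 n)) (hbd _ _ hc2 (hP0 n)) ((hv0 n).trans (by linarith))
      ((hP0 n).trans (by linarith)) hc1.le hc2.le
    rw [mul_add] at h5
    linarith

end LCSSplitting

end

/-! ### Conclusion: from coordinates to the Carnot–Carathéodory distance. -/

theorem theoremT
    {Γ Λ X 𝔥 : Type*}
    [Group Γ] [Group.IsNilpotent Γ] (htfΓ : ∀ g : Γ, IsOfFinOrder g → g = 1)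
    [Group Λ] [Group.IsNilpotent Λ] (htfΛ : ∀ l : Λ, IsOfFinOrder l → l = 1)
    (S : Finset Γ) (hS : Subgroup.closure (S : Set Γ) = ⊤)
    (T : Finset Λ) (hT : Subgroup.closure (T : Set Λ) = ⊤)
    [MeasurableSpace X] (μ : Measure X) [IsProbabilityMeasure μ]
    [MulAction Γ X] [MeasurableConstSMul Γ X] [ErgodicSMul Γ X μ]
    (α : Γ → X → Λ) (hα : IsIntegrableCocycle (T : Set Λ) μ α)
    [LieRing 𝔥] [LieAlgebra ℝ 𝔥] [LieRing.IsNilpotent 𝔥] [FiniteDimensional ℝ 𝔥]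
    [TopologicalSpace 𝔥] [IsTopologicalAddGroup 𝔥] [ContinuousSMul ℝ 𝔥] [T2Space 𝔥]
    (ι : Λ → 𝔥) (hι : IsMalcevCompletion ι)
    (D : LCSSplitting 𝔥)
    (N : Seminorm ℝ (D.V 1)) (hN : ∀ v, N v = 0 → v = 0)
    {k : ℕ} (s : Fin k → Γ) (hs : ∀ i, s i ∈ S)
    (a : ℕ → Fin k → ℕ) (ha : ∀ i, Tendsto (fun n => a n i) atTop atTop)
    (ε : ℝ) (hε : 0 < ε) :
    Tendsto
      (fun n : ℕ => μ {x | D.ccDist N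
          (ι (α (List.ofFn fun i => s i ^ a n i).prod x))
          ((List.ofFn fun i => D.dilation (a n i) (D.abMean μ ι α (s i))).foldr D.star 0)
        / ((Finset.univ.sup (a n) : ℕ) : ENNReal) < ENNReal.ofReal ε})
      atTop (𝓝 1) := by
  have hTf : (T : Set Λ).Finite := T.finite_toSet
  -- For `k = 0` the normaliser is the empty supremum `0`. The distance vanishes almost surely, and
  -- `0 / 0 = 0` in `ENNReal`.
  rcases Nat.eq_zero_or_pos k with rfl | hk
  · refine tendsto_const_nhds.congr fun n => Eq.symm ?_
    have hae : ∀ᵐ x ∂μ, D.ccDist N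
        (ι (α (List.ofFn fun i => s i ^ a n i).prod x))
        ((List.ofFn fun i => D.dilation (a n i) (D.abMean μ ι α (s i))).foldr D.star 0)
        / ((Finset.univ.sup (a n) : ℕ) : ENNReal) < ENNReal.ofReal ε := by
      filter_upwards [hα.ae_one] with x hx
      have h0 : D.ccDist N (0 : 𝔥) 0 = 0 := by
        have h := D.ccDist_star_starProd_le N 0 []
        rw [D.starProd_nil, D.star_zero] at h
        simpa using h
      simp only [List.ofFn_zero, List.prod_nil, List.foldr_nil, hx, D.map_one_eq_zero hι.map_mul,
        h0, ENNReal.zero_div]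
      exact ENNReal.ofReal_pos.2 hε
    rw [← measure_univ (μ := μ)]
    exact measure_congr (eventuallyEq_univ.2 hae)
  set M : ℕ → ℕ := fun n => Finset.univ.sup (a n) with hMdef
  have haM : ∀ n i, a n i ≤ M n := fun n i => Finset.le_sup (f := a n) (Finset.mem_univ i)
  have hM : Tendsto M atTop atTop := tendsto_atTop_mono (fun n => haM n ⟨0, hk⟩) (ha ⟨0, hk⟩)
  obtain ⟨R, hR, hlim⟩ := D.exists_tendsto_product hι.map_mul hTf hT hα s a M hM haM
  set P : ℕ → 𝔥 := fun n => (List.ofFn fun i =>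
    ((a n i : ℝ) / M n) • D.abMean μ ι α (s i)).foldr D.star 0 with hP
  -- `ε / 2` makes the final inequality strict; `R + 1` leaves room for the rescaled cocycle, which
  -- is within `1` of the product on the good event.
  obtain ⟨δ, hδ, hcc⟩ := D.exists_ccDist_dilation_le N (R + 1) (half_pos hε)
  have hfold : ∀ (t : ℝ) (l : List 𝔥),
      D.dilation t (l.foldr D.star 0) = (l.map (D.dilation t)).foldr D.star 0 := by
    intro t l
    induction l with
    | nil => simp
    | cons z l ih => rw [List.foldr_cons, D.dilation_star, ih, List.map_cons, List.foldr_cons]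
  have hbad := hlim (min δ 1) (lt_min hδ one_pos)
  have hgood : ∀ᶠ n in atTop, 1 - ENNReal.ofReal (μ.real {x | min δ 1 ≤ coordNorm 𝔥
      (D.dilation (M n : ℝ)⁻¹ (ι (α (List.ofFn fun i => s i ^ a n i).prod x)) - P n)}) ≤
      μ {x | D.ccDist N (ι (α (List.ofFn fun i => s i ^ a n i).prod x))
          ((List.ofFn fun i => D.dilation (a n i) (D.abMean μ ι α (s i))).foldr D.star 0)
        / ((Finset.univ.sup (a n) : ℕ) : ENNReal) < ENNReal.ofReal ε} := by
    filter_upwards [hM.eventually_ge_atTop 1] with n hMn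
    have hM0 : (0 : ℝ) < M n := by exact_mod_cast hMn
    have hdil : D.dilation (M n) (P n) =
        (List.ofFn fun i => D.dilation (a n i) (D.abMean μ ι α (s i))).foldr D.star 0 := by
      rw [hP, hfold, List.map_ofFn]
      congr 2
      funext i
      have hv := D.abMean_mem_V_one hι.map_mul hTf hT hα (s i)
      rw [Function.comp_apply, map_smul, D.dilation_of_mem_V_one _ hv,
        D.dilation_of_mem_V_one _ hv, smul_smul, div_mul_cancel₀ _ hM0.ne']
    -- The whole space is covered by the good and the bad event, and subadditivity of the outer
    -- measure gives the bound without measurability of the distance.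
    rw [ofReal_measureReal, tsub_le_iff_right, ← measure_univ (μ := μ)]
    refine (measure_mono fun x _ => ?_).trans (measure_union_le _ _)
    by_cases hx : min δ 1 ≤ coordNorm 𝔥
      (D.dilation (M n : ℝ)⁻¹ (ι (α (List.ofFn fun i => s i ^ a n i).prod x)) - P n)
    · exact Or.inr hx
    refine Or.inl ?_
    rw [not_le] at hx
    set u := D.dilation (M n : ℝ)⁻¹ (ι (α (List.ofFn fun i => s i ^ a n i).prod x)) with hu
    have hui : D.dilation (M n) u = ι (α (List.ofFn fun i => s i ^ a n i).prod x) := by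
      rw [hu, D.dilation_dilation, mul_inv_cancel₀ hM0.ne', D.dilation_one]
    have huR : coordNorm 𝔥 u ≤ R + 1 := by
      have h1 := map_add_le_add (coordNorm 𝔥) (u - P n) (P n)
      rw [sub_add_cancel] at h1
      linarith [hR n, hx.trans_le (min_le_right _ _)]
    have h2 := hcc u (P n) huR ((hR n).trans (by linarith)) (hx.trans_le (min_le_left _ _))
      (M n) hM0.le
    rw [hui, hdil] at h2
    change _ / ((M n : ℕ) : ENNReal) < ENNReal.ofReal ε
    rw [ENNReal.div_lt_iff (Or.inl (by exact_mod_cast hM0.ne'))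
      (Or.inl (ENNReal.natCast_ne_top _))]
    refine h2.trans_lt ?_
    rw [← ENNReal.ofReal_natCast, ← ENNReal.ofReal_mul hε.le,
      ENNReal.ofReal_lt_ofReal_iff (by positivity)]
    nlinarith
  refine tendsto_of_tendsto_of_tendsto_of_le_of_le' ?_ tendsto_const_nhds hgood
    (Eventually.of_forall fun n => prob_le_one)
  have h1 := ENNReal.tendsto_ofReal hbad
  have h2 := ENNReal.Tendsto.sub (tendsto_const_nhds (x := (1 : ENNReal)) (f := atTop)) h1
    (Or.inl ENNReal.one_ne_top)
  simpa using h2
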